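/- Let $d\in\{2,3\}$, $T>0$ and $\mathbb T^d=\mathbb R^d/\mathbb Z^d$. A pair $(v,\Pi)$ is a weak solution of the incompressible Euler equations $\partial_t v+v\cdot\nabla v+\nabla\Pi=0$, $\operatorname{div}v=0$ on $[0,T]\times\mathbb T^d$ if $v\in C_{\mathrm{weak}}([0,T];L^2(\mathbb T^d)^d)$, $\Pi\in L^1((0,T)\times\mathbb T^d)$, for all $\varphi\in C^\infty([0,T]\times\mathbb T^d)^d$ $$\int_{\mathbb T^d}\big[v(x,T)\cdot\varphi(x,T)-v(x,0)\cdot\varphi(x,0)\big]dx=\int_0^T\!\!\int_{\mathbb T^d}\big[v\cdot\partial_t\varphi+(v\otimes v):\nabla\varphi+\Pi\operatorname{div}\varphi\big]\,dx\,dt,$$ and $\int_0^T\int_{\mathbb T^d}v\cdot\nabla\psi\,dx\,dt=0$ for all $\psi\in C^\infty([0,T]\times\mathbb T^d)$. For $0<\alpha<1$ and $1\le p,q<\infty$, write $f\in L^p(0,T;B^\alpha_{q,c(\mathbb N)}(\mathbb T^d))$ if $f\in L^p(0,T;L^q(\mathbb T^d))$ and $$\lim_{z\to0}|z|^{-\alpha}\,\|f(\cdot+z,\cdot)-f\|_{L^p(0,T;L^q(\mathbb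 T^d))}=0,$$ and $f\in L^p(0,T;\underline B^\alpha_{q,VMO}(\mathbb T^d))$ if $f\in L^p(0,T;L^q(\mathbb T^d))$ and $$\lim_{\varepsilon\to0^+}\varepsilon^{-\alpha}\bigg(\int_0^T\Big[\int_{\mathbb T^d}\frac1{|B_\varepsilon(0)|}\int_{B_\varepsilon(0)}|f(x,t)-f(x-y,t)|^q\,dy\,dx\Big]^{p/q}dt\bigg)^{1/p}=0.$$ **Theorem 1.2.** Let $(v,\Pi)$ be a weak solution of the incompressible Euler equations on $[0,T]\times\mathbb T^d$, $d=2,3$, let $1<p\le3$, and suppose that one of the following conditions is satisfied: 1. $v\in L^p\big(0,T;B^{1/p}_{\frac{2p}{p-1},c(\mathbb N)}(\mathbb T^d)\big)$; 2. $v\in L^p\big(0,T;\underline B^{1/p}_{\frac{2p}{p-1},VMO}(\mathbb T^d)\big)$; 3. $\nabla v\in L^p\big(0,T;L^{\frac{2dp}{(d+2)(p-1)}}(\mathbb T^d)\big)$, where $\nabla v$ is the weak spatial gradient. Then for every $0\le t\le T$ $$\frac12\int_{\mathbb T^d}|v(x,t)|^2\,dx=\frac12\int_{\mathbb T^d}|v(x,0)|^2\,dx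 .$$ -/

import Mathlib

open MeasureTheory Set Filter Topology
open scoped ENNReal ContDiff

namespace EulerTorus

/-- The space `ℝ^d` with its Euclidean norm. -/
abbrev Vec (d : ℕ) := EuclideanSpace ℝ (Fin d)

/-- The torus `𝕋^d = (ℝ / ℤ)^d`; its `volume` is Lebesgue (Haar) measure of total mass one. -/
abbrev Torus (d : ℕ) := UnitAddTorus (Fin d)

/-- The projection `ℝ^d → 𝕋^d`. -/
noncomputable def proj {d : ℕ} (y : Vec d) : Torus d := fun i => ((y i : ℝ) : UnitAddCircle)

/-- Lebesgue measure on the space-time domain `(0,T) × 𝕋^d`. -/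
noncomputable def spaceTime (d : ℕ) (T : ℝ) : Measure (ℝ × Torus d) :=
  ((volume : Measure ℝ).restrict (Ioo 0 T)).prod (volume : Measure (Torus d))

/-- The spatial partial derivative `∂_j f (x)` of a function on the torus. -/
noncomputable def pderiv {d : ℕ} (j : Fin d) (f : Torus d → ℝ) (x : Torus d) : ℝ :=
  deriv (fun s : ℝ => f (x + proj (EuclideanSpace.single j s))) 0

/-- `ψ : 𝕋^d → F` is `C^∞`, i.e. its periodic lift to `ℝ^d` is. -/
def IsSmooth {d : ℕ} {F : Type*} [NormedAddCommGroup F] [NormedSpace ℝ F]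
    (ψ : Torus d → F) : Prop :=
  ContDiff ℝ ∞ (fun y : Vec d => ψ (proj y))

/-- `φ : ℝ × 𝕋^d → F` is jointly `C^∞`, i.e. its lift to `ℝ × ℝ^d` is.  The restrictions of such
functions to `[0,T] × 𝕋^d` are the test functions; they need not vanish at `t = 0` or `t = T`. -/
def IsSmoothSpaceTime {d : ℕ} {F : Type*} [NormedAddCommGroup F] [NormedSpace ℝ F]
    (φ : ℝ → Torus d → F) : Prop :=
  ContDiff ℝ ∞ (fun p : ℝ × Vec d => φ p.1 (proj p.2))

/-- `(v, Π)` is a weak solution of the incompressible Euler equations on `[0,T] × 𝕋^d`: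
`v ∈ C_weak([0,T]; L²)`, `Π ∈ L¹`, the momentum equation tested against all smooth vector fields
on `[0,T] × 𝕋^d`, and the weak divergence-free condition. -/
structure IsWeakSolution {d : ℕ} (T : ℝ) (v : ℝ → Torus d → Vec d) (Pr : ℝ → Torus d → ℝ) :
    Prop where
  /-- `v` is a measurable function on space-time -/
  measurable : AEStronglyMeasurable (fun p : ℝ × Torus d => v p.1 p.2) (spaceTime d T)
  /-- `v(t) ∈ L²(𝕋^d)` for every `t ∈ [0,T]` -/
  memLp_two : ∀ t ∈ Icc (0 : ℝ) T, MemLp (v t) 2 volume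
  /-- `t ↦ v(t)` is continuous on `[0,T]` for the weak topology of `L²(𝕋^d)` -/
  weak_continuous : ∀ w : Torus d → Vec d, MemLp w 2 volume →
    ContinuousOn (fun t : ℝ => ∫ x, inner ℝ (v t x) (w x)) (Icc (0 : ℝ) T)
  /-- the pressure is integrable on `[0,T] × 𝕋^d` -/
  pressure_integrable : Integrable (fun p : ℝ × Torus d => Pr p.1 p.2) (spaceTime d T)
  /-- the momentum equation -/
  momentum : ∀ φ : ℝ → Torus d → Vec d, IsSmoothSpaceTime φ →
    (∫ x, (inner ℝ (v T x) (φ T x) - inner ℝ (v 0 x) (φ 0 x))) =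
      ∫ t in Ioo (0 : ℝ) T, ∫ x,
        (inner ℝ (v t x) (deriv (fun s : ℝ => φ s x) t)
          + (∑ i : Fin d, ∑ j : Fin d, v t x i * v t x j * pderiv j (fun y => φ t y i) x)
          + Pr t x * ∑ i : Fin d, pderiv i (fun y => φ t y i) x)
  /-- `v` is weakly divergence free -/
  div_free : ∀ ψ : ℝ → Torus d → ℝ, IsSmoothSpaceTime ψ →
    (∫ t in Ioo (0 : ℝ) T, ∫ x, ∑ i : Fin d, v t x i * pderiv i (ψ t) x) = 0

/-- The norm of `L^p(0,T; L^q(𝕋^d))` for finite exponents, with values in `[0,∞]`: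
`(∫_0^T (∫_{𝕋^d} |f(t,x)|^q dx)^{p/q} dt)^{1/p}`. -/
noncomputable def mixedNorm {d : ℕ} {F : Type*} [NormedAddCommGroup F] (T p q : ℝ)
    (f : ℝ → Torus d → F) : ℝ≥0∞ :=
  (∫⁻ t in Ioo (0 : ℝ) T, (∫⁻ x, ‖f t x‖ₑ ^ q) ^ (p / q)) ^ (1 / p)

/-- `f ∈ L^p(0,T; L^q(𝕋^d))`. -/
def MemLpLq {d : ℕ} {F : Type*} [NormedAddCommGroup F] (T p q : ℝ)
    (f : ℝ → Torus d → F) : Prop :=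
  AEStronglyMeasurable (fun z : ℝ × Torus d => f z.1 z.2) (spaceTime d T) ∧
    mixedNorm T p q f < ⊤

/-- `f ∈ L^p(0,T; B^α_{q,c(ℕ)}(𝕋^d))`, for `0 < α < 1`: `f ∈ L^p(0,T; L^q)` and
`‖f(· + z) - f‖_{L^p(0,T; L^q)} / |z|^α → 0` as `ℝ^d ∋ z → 0`. -/
def MemLpBesovC {d : ℕ} {F : Type*} [NormedAddCommGroup F] (T p α q : ℝ)
    (f : ℝ → Torus d → F) : Prop :=
  MemLpLq T p q f ∧
    Tendsto (fun z : Vec d =>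
        mixedNorm T p q (fun t x => f t (x + proj z) - f t x) / ENNReal.ofReal (‖z‖ ^ α))
      (𝓝[≠] 0) (𝓝 0)

/-- `f ∈ L^p(0,T; B^α_{q,VMO}(𝕋^d))`: `f ∈ L^p(0,T; L^q)` and
`ε^{-α} (∫_0^T [∫_{𝕋^d} ⨍_{|y| < ε} |f(t,x) - f(t,x-y)|^q dy dx]^{p/q} dt)^{1/p} → 0`
as `ε → 0⁺`. -/
def MemLpBesovVMO {d : ℕ} {F : Type*} [NormedAddCommGroup F] (T p α q : ℝ)
    (f : ℝ → Torus d → F) : Prop :=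
  MemLpLq T p q f ∧
    Tendsto (fun ε : ℝ =>
        (∫⁻ t in Ioo (0 : ℝ) T,
            (∫⁻ x, ⨍⁻ y in Metric.ball (0 : Vec d) ε, ‖f t x - f t (x - proj y)‖ₑ ^ q ∂volume)
              ^ (p / q)) ^ (1 / p) / ENNReal.ofReal (ε ^ α))
      (𝓝[>] 0) (𝓝 0)

/-- `g` is the weak gradient of the vector field `u` on `𝕋^d`, `g_{ij} = ∂_j u_i`. -/
def IsWeakGradient {d : ℕ} (u : Torus d → Vec d)
    (g : Torus d → EuclideanSpace ℝ (Fin d × Fin d)) : Prop :=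
  ∀ ψ : Torus d → ℝ, IsSmooth ψ → ∀ i j : Fin d,
    (∫ x, u x i * pderiv j ψ x) = -∫ x, g x (i, j) * ψ x

/-- `∇f ∈ L^p(0,T; L^q(𝕋^d))`: for almost every `t` the weak gradient of `f(t)` exists, and as a
function of `(t,x)` it lies in `L^p(0,T; L^q)`, for `q ≥ 1`. -/
def GradMemLpLq {d : ℕ} (T p q : ℝ) (f : ℝ → Torus d → Vec d) : Prop :=
  ∃ g : ℝ → Torus d → EuclideanSpace ℝ (Fin d × Fin d),
    MemLpLq T p q g ∧ ∀ᵐ t ∂(volume.restrict (Ioo (0 : ℝ) T)), IsWeakGradient (f t) (g t)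

end EulerTorus

/-! The proof is the Constantin–E–Titi argument, arranged so that only averaged third-order
increments of the velocity matter. Mollify at scale ε with a kernel K and write δ_y v = v - v(· -
y). The mollified field is smooth in space and absolutely continuous in time, so its energy balance
is classical. The pressure drops out by incompressibility. What is left is the flux ∫ ∇v_ε :
((v⊗v)_ε - v_ε⊗v_ε). Since ∇K has mean zero, |∇v_ε| is at most C/ε times the average of |δ_y v| over
|y| < ε. The commutator is quadratic in the increments. Jensen's inequality then bounds the flux by
(C/ε) ∫ ⨍ |δ_y v|³ (`IsMollifier.enorm_flux_le`). Hence energy is conserved once the time integral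
of this quantity vanishes along some sequence ε → 0 (`IsWeakSolution.energy_eq_of_tendsto`).

With r = 2p/(p-1), interpolation gives ∫F³ ≤ (∫F^r)^{p/r} (∫F²)^{(3-p)/2}
(`lintegral_rpow_three_le`). The L² factor is bounded uniformly in time: weak continuity and
Banach–Steinhaus give `IsWeakSolution.exists_bound`. It remains to see that (1/ε) ∫ (∫ ⨍ |δ_y
v|^r)^{p/r} dt → 0, or the same for each fixed shift y. The two Besov conditions, raised to the
power p, say this directly.

For the gradient condition the exponent q satisfies d(1/q - 1/r) = 1 - 1/p. A function with gradient
in L^q has L^q increments of size |y|. Telescoping over dyadic mollifications, each estimated from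
L^q to L^r by Young's inequality, turns this into L^r increments of size ε^{1/p}
(`exists_eLpNorm_increment_le`). Subtracting a fixed mollification improves the bound to o(ε^{1/p})
at almost every time (`HasMollifiedGradient.eventually_increment_le`). Dominated convergence in time
finishes the proof. -/

namespace EulerTorus

/-! ### The torus as a quotient of ℝ^d, and partial derivatives on it -/

theorem proj_add {d : ℕ} (y z : Vec d) : proj (y + z) = proj y + proj z := by
  ext i; simp [proj]

theorem proj_neg {d : ℕ} (y : Vec d) : proj (-y) = -proj y := by
  ext i; simp [proj]

theorem proj_zero {d : ℕ} : proj (0 : Vec d) = 0 := by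
  ext i; simp [proj]

theorem proj_surjective {d : ℕ} (x : Torus d) : ∃ y : Vec d, proj y = x := by
  choose y hy using fun i => QuotientAddGroup.mk_surjective (x i)
  exact ⟨WithLp.toLp 2 y, funext fun i => hy i⟩

theorem continuous_proj {d : ℕ} : Continuous (proj : Vec d → Torus d) := by
  unfold proj
  refine continuous_pi fun i => ?_
  exact (AddCircle.continuous_mk' 1).comp (by fun_prop)

theorem measurable_proj {d : ℕ} : Measurable (proj : Vec d → Torus d) :=
  continuous_proj.measurable

/-- The cube `(-1/2, 1/2]^d`, a fundamental domain of the torus. -/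
def cube (d : ℕ) : Set (Vec d) := {y | ∀ i, y i ∈ Ioc (-(1 / 2) : ℝ) (-(1 / 2) + 1)}

theorem measurableSet_cube {d : ℕ} : MeasurableSet (cube d) := by
  simp only [cube, ofPred_forall]
  exact MeasurableSet.iInter fun i => measurableSet_Ioc.preimage (by fun_prop)

theorem measurePreserving_proj {d : ℕ} :
    MeasurePreserving (proj : Vec d → Torus d) (volume.restrict (cube d)) volume := by
  have h1 : MeasurePreserving (fun (x : Fin d → ℝ) (i : Fin d) => ((x i : ℝ) : UnitAddCircle))
      (Measure.pi fun _ => volume.restrict (Ioc (-(1 / 2) : ℝ) (-(1 / 2) + 1))) volume :=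
    measurePreserving_pi _ _ fun _ => UnitAddCircle.measurePreserving_mk _
  rw [← Measure.restrict_pi_pi] at h1
  have h2 := (EuclideanSpace.volume_preserving_symm_measurableEquiv_toLp (Fin d)).restrict_preimage
    (MeasurableSet.univ_pi fun _ : Fin d =>
      measurableSet_Ioc (a := (-(1 / 2) : ℝ)) (b := -(1 / 2) + 1))
  have h3 := h1.comp h2
  have e : ⇑(MeasurableEquiv.toLp 2 (Fin d → ℝ)).symm ⁻¹'
      univ.pi (fun _ : Fin d => Ioc (-(1 / 2) : ℝ) (-(1 / 2) + 1)) = cube d := by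
    ext y; simp [cube]
  rw [e] at h3
  exact h3

/-- The inequality half of the change of variables needs no measurability of the integrand, so the
mollifier bounds hold for arbitrary `G`. -/
theorem lintegral_torus_le {d : ℕ} (G : Torus d → ℝ≥0∞) :
    ∫⁻ x, G x ≤ ∫⁻ y in cube d, G (proj y) := by
  rw [← measurePreserving_proj.map_eq]
  exact lintegral_map_le _ _

/-- `F'` is the partial derivative of `F` in direction `j`, at every point of the torus. -/
def HasPDeriv {d : ℕ} (j : Fin d) (F F' : Torus d → ℝ) : Prop :=
  ∀ x, HasDerivAt (fun s : ℝ => F (x + proj (EuclideanSpace.single j s))) (F' x) 0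

theorem HasPDeriv.pderiv_eq {d : ℕ} {j : Fin d} {F F' : Torus d → ℝ} (h : HasPDeriv j F F')
    (x : Torus d) : pderiv j F x = F' x := (h x).deriv

theorem single_add {d : ℕ} (j : Fin d) (s t : ℝ) :
    EuclideanSpace.single j (s + t) = EuclideanSpace.single j s + EuclideanSpace.single j t := by
  ext i; by_cases h : i = j <;> simp [h]

theorem HasPDeriv.hasDerivAt {d : ℕ} {j : Fin d} {F F' : Torus d → ℝ} (h : HasPDeriv j F F')
    (x : Torus d) (s : ℝ) :
    HasDerivAt (fun s : ℝ => F (x + proj (EuclideanSpace.single j s)))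
      (F' (x + proj (EuclideanSpace.single j s))) s := by
  have h1 := h (x + proj (EuclideanSpace.single j s))
  have h2 : HasDerivAt (fun r : ℝ => r - s) 1 s := (hasDerivAt_id s).sub_const s
  have h3 := HasDerivAt.comp (𝕜 := ℝ) s
    (h₂ := fun r : ℝ => F (x + proj (EuclideanSpace.single j s) + proj (EuclideanSpace.single j r)))
    (h := fun r : ℝ => r - s) (by simpa using h1) h2
  simp only [mul_one] at h3
  refine h3.congr_of_eventuallyEq (Eventually.of_forall fun r => ?_)
  simp only [Function.comp, add_assoc, ← proj_add, ← single_add]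
  simp

theorem HasPDeriv.mul {d : ℕ} {j : Fin d} {F F' G G' : Torus d → ℝ} (hF : HasPDeriv j F F')
    (hG : HasPDeriv j G G') :
    HasPDeriv j (fun x => F x * G x) (fun x => F' x * G x + F x * G' x) := by
  intro x
  have := (hF x).mul (hG x)
  have e : EuclideanSpace.single j (0 : ℝ) = 0 := by ext i; simp
  simp only [e, proj_zero, add_zero] at this
  exact this

/-! ### Construction of mollifiers -/

/-- The function `∑ᵢ (1 - cos (2 π xᵢ))` on the torus. -/
noncomputable def gap {d : ℕ} (x : Torus d) : ℝ := ∑ i, (1 - (fourier 1 (x i) : ℂ).re)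

theorem fourier_re (s : ℝ) :
    (fourier 1 ((s : ℝ) : UnitAddCircle) : ℂ).re = Real.cos (2 * Real.pi * s) := by
  rw [fourier_coe_apply]
  have : (2 * Real.pi * Complex.I * (1 : ℤ) * s / (1 : ℝ) : ℂ)
      = ((2 * Real.pi * s : ℝ) : ℂ) * Complex.I := by push_cast; ring
  rw [this, Complex.exp_ofReal_mul_I_re]

theorem fourier_im (s : ℝ) :
    (fourier 1 ((s : ℝ) : UnitAddCircle) : ℂ).im = Real.sin (2 * Real.pi * s) := by
  rw [fourier_coe_apply]
  have : (2 * Real.pi * Complex.I * (1 : ℤ) * s / (1 : ℝ) : ℂ)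
      = ((2 * Real.pi * s : ℝ) : ℂ) * Complex.I := by push_cast; ring
  rw [this, Complex.exp_ofReal_mul_I_im]

theorem gap_proj {d : ℕ} (y : Vec d) : gap (proj y) = ∑ i, (1 - Real.cos (2 * Real.pi * y i)) := by
  simp only [gap, proj, fourier_re]

theorem continuous_gap {d : ℕ} : Continuous (gap : Torus d → ℝ) := by
  unfold gap; fun_prop

theorem hasPDeriv_gap {d : ℕ} (j : Fin d) :
    HasPDeriv j gap (fun x => 2 * Real.pi * (fourier 1 (x j) : ℂ).im) := by
  intro x
  obtain ⟨y, rfl⟩ := proj_surjective x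
  simp only [← proj_add, gap_proj]
  have : ∀ i ∈ Finset.univ, HasDerivAt
      (fun s : ℝ => 1 - Real.cos (2 * Real.pi * (y + EuclideanSpace.single j s) i))
      (if i = j then 2 * Real.pi * Real.sin (2 * Real.pi * y j) else 0) 0 := by
    intro i _
    by_cases h : i = j
    · subst h
      have h1 : HasDerivAt (fun s : ℝ => 2 * Real.pi * (y i + s)) (2 * Real.pi * 1) 0 :=
        ((hasDerivAt_id 0).const_add (y i)).const_mul _
      have h2 := (h1.cos).const_sub 1
      simp only [PiLp.add_apply, PiLp.single_apply, if_true]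
      exact h2.congr_deriv (by rw [add_zero]; ring)
    · simp only [PiLp.add_apply, PiLp.single_apply, h, if_false]
      exact hasDerivAt_const _ _
  have h := HasDerivAt.fun_sum this
  rw [Finset.sum_ite_eq' Finset.univ j, if_pos (Finset.mem_univ j)] at h
  simp only [proj, fourier_im]
  exact h

theorem gap_proj_le {d : ℕ} (y : Vec d) : gap (proj y) ≤ 2 * Real.pi ^ 2 * ‖y‖ ^ 2 := by
  rw [gap_proj, EuclideanSpace.norm_sq_eq, Finset.mul_sum]
  refine Finset.sum_le_sum fun i _ => ?_
  have := Real.one_sub_sq_div_two_le_cos (x := 2 * Real.pi * y i)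
  rw [Real.norm_eq_abs, sq_abs]
  nlinarith

/-- On the cube |2πyᵢ| ≤ π, where cos s ≤ 1 - (2/π²)s²; the constant is 8 = (2/π²)(2π)². With the
quadratic upper bound, `gap` is a smooth periodic substitute for the squared distance to 0. -/
theorem le_gap_proj {d : ℕ} {y : Vec d} (hy : y ∈ cube d) : 8 * ‖y‖ ^ 2 ≤ gap (proj y) := by
  rw [gap_proj, EuclideanSpace.norm_sq_eq, Finset.mul_sum]
  refine Finset.sum_le_sum fun i _ => ?_
  have h1 : |2 * Real.pi * y i| ≤ Real.pi := by
    have := hy i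
    rw [abs_mul, abs_of_pos (by positivity)]
    have h2 : |y i| ≤ 1 / 2 := abs_le.2 ⟨by linarith [this.1], by linarith [this.2]⟩
    nlinarith [Real.pi_pos]
  have := Real.cos_le_one_sub_mul_cos_sq h1
  rw [Real.norm_eq_abs, sq_abs]
  have h3 : 2 / Real.pi ^ 2 * (2 * Real.pi * y i) ^ 2 = 8 * y i ^ 2 := by
    field_simp; ring
  linarith

/-- Here sin² = (1 - cos)(1 + cos) ≤ 2(1 - cos). Where `gap` ≲ ε² its gradient is therefore O(ε), so
differentiating a function of `gap`/ε² costs 1/ε and not 1/ε². -/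
theorem sin_sq_le_gap {d : ℕ} (x : Torus d) (j : Fin d) :
    (fourier 1 (x j) : ℂ).im ^ 2 ≤ 2 * gap x := by
  obtain ⟨y, rfl⟩ := proj_surjective x
  rw [gap_proj]
  simp only [proj, fourier_im]
  have h1 : 1 - Real.cos (2 * Real.pi * y j) ≤ ∑ i, (1 - Real.cos (2 * Real.pi * y i)) :=
    Finset.single_le_sum (f := fun i => 1 - Real.cos (2 * Real.pi * y i))
      (fun i _ => by linarith [Real.cos_le_one (2 * Real.pi * y i)]) (Finset.mem_univ j)
  have := Real.sin_sq_add_cos_sq (2 * Real.pi * y j)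
  nlinarith [Real.cos_le_one (2 * Real.pi * y j), Real.neg_one_le_cos (2 * Real.pi * y j)]

/-- The range s ≤ 2 is enough: the argument used below is 2 - `gap`/ε², and `gap` is nonnegative. -/
theorem exists_deriv_smoothTransition_le :
    ∃ M : ℝ, 0 < M ∧ ∀ s ≤ 2, |deriv Real.smoothTransition s| ≤ M ∧
      (s < 0 → deriv Real.smoothTransition s = 0) := by
  have hc : Continuous (deriv Real.smoothTransition) :=
    (Real.smoothTransition.contDiff (n := 1)).continuous_deriv le_rfl
  obtain ⟨M, hM⟩ := (isCompact_Icc (a := (0 : ℝ)) (b := 2)).exists_bound_of_continuousOn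
    hc.continuousOn
  have hM0 : 0 ≤ M := (norm_nonneg _).trans (hM 0 (by simp))
  have h0 : ∀ s < 0, deriv Real.smoothTransition s = 0 := by
    intro s hs
    have : Real.smoothTransition =ᶠ[𝓝 s] fun _ => 0 := by
      filter_upwards [gt_mem_nhds hs] with r hr
      exact Real.smoothTransition.zero_of_nonpos hr.le
    rw [this.deriv_eq]; simp
  refine ⟨M + 1, by linarith, fun s hs => ⟨?_, h0 s⟩⟩
  rcases lt_or_ge s 0 with h | h
  · rw [h0 s h]; simp; linarith
  · have := hM s ⟨h, hs⟩
    rw [Real.norm_eq_abs] at this; linarith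

/-- `K` is a nonnegative smooth kernel of mass one on the torus, with partial derivatives `K'`,
concentrated at scale `ε`. -/
structure IsMollifier {d : ℕ} (C ε : ℝ) (K : Torus d → ℝ) (K' : Fin d → Torus d → ℝ) : Prop where
  smooth : IsSmooth K
  cont : Continuous K
  cont_deriv : ∀ j, Continuous (K' j)
  hasPDeriv : ∀ j, HasPDeriv j K (K' j)
  nonneg : ∀ x, 0 ≤ K x
  integral_eq_one : ∫ x, K x = 1
  le : ∀ x, K x ≤ C / ε ^ d
  lintegral_le : ∀ G : Torus d → ℝ≥0∞, ∫⁻ y, ‖K y‖ₑ * G y ≤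
    ENNReal.ofReal C * ⨍⁻ y in Metric.ball (0 : Vec d) ε, G (proj y) ∂volume
  lintegral_deriv_le : ∀ j, ∀ G : Torus d → ℝ≥0∞, ∫⁻ y, ‖K' j y‖ₑ * G y ≤
    ENNReal.ofReal (C / ε) * ⨍⁻ y in Metric.ball (0 : Vec d) ε, G (proj y) ∂volume

/-- With Z at most the reciprocal volume of the ball, a function supported in the ball and bounded
by ZM is dominated by M times the uniform density. It serves both the kernel and its derivatives. -/
theorem lintegral_le_of_supported {d : ℕ} {ε Z M : ℝ} (hZ : 0 < Z)
    (hvol : ENNReal.ofReal Z * volume (Metric.ball (0 : Vec d) ε) ≤ 1)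
    (hvol0 : volume (Metric.ball (0 : Vec d) ε) ≠ 0)
    {k : Torus d → ℝ} (hk : ∀ y ∈ cube d, y ∉ Metric.ball (0 : Vec d) ε → k (proj y) = 0)
    (hkM : ∀ x, |k x| ≤ Z * M) (G : Torus d → ℝ≥0∞) :
    ∫⁻ y, ‖k y‖ₑ * G y ≤
      ENNReal.ofReal M * ⨍⁻ y in Metric.ball (0 : Vec d) ε, G (proj y) ∂volume := by
  have hB : volume (Metric.ball (0 : Vec d) ε) ≠ ⊤ := measure_ball_lt_top.ne
  rw [setLAverage_eq]
  refine (lintegral_torus_le _).trans ?_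
  calc ∫⁻ y in cube d, ‖k (proj y)‖ₑ * G (proj y)
      ≤ ∫⁻ y in cube d, (Metric.ball (0 : Vec d) ε).indicator
          (fun y => ENNReal.ofReal (Z * M) * G (proj y)) y := by
        refine setLIntegral_mono' measurableSet_cube fun y hy => ?_
        by_cases h : y ∈ Metric.ball (0 : Vec d) ε
        · rw [indicator_of_mem h]
          gcongr
          rw [Real.enorm_eq_ofReal_abs]
          exact ENNReal.ofReal_le_ofReal (hkM _)
        · simp [hk y hy h]
    _ ≤ ∫⁻ y, (Metric.ball (0 : Vec d) ε).indicator
          (fun y => ENNReal.ofReal (Z * M) * G (proj y)) y := setLIntegral_le_lintegral _ _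
    _ = ENNReal.ofReal (Z * M) * ∫⁻ y in Metric.ball (0 : Vec d) ε, G (proj y) := by
        rw [lintegral_indicator measurableSet_ball, lintegral_const_mul' _ _ ENNReal.ofReal_ne_top]
    _ ≤ _ := by
        rw [ENNReal.ofReal_mul hZ.le, mul_comm (ENNReal.ofReal Z), mul_assoc]
        gcongr
        rw [ENNReal.le_div_iff_mul_le (Or.inl hvol0) (Or.inl hB), mul_right_comm]
        exact mul_le_of_le_one_left zero_le hvol

theorem volume_ball_eq {d : ℕ} {ρ : ℝ} (hρ : 0 < ρ) :
    volume (Metric.ball (0 : Vec d) ρ)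
      = ENNReal.ofReal (ρ ^ d * (volume (Metric.ball (0 : Vec d) 1)).toReal) := by
  rw [Measure.addHaar_ball_of_pos _ _ hρ, ENNReal.ofReal_mul (by positivity),
    ENNReal.ofReal_toReal measure_ball_lt_top.ne]
  simp

theorem exists_isMollifier (d : ℕ) : ∃ C : ℝ, 0 < C ∧ ∀ ε : ℝ, 0 < ε → ε ≤ 1 →
    ∃ (K : Torus d → ℝ) (K' : Fin d → Torus d → ℝ), IsMollifier C ε K K' := by
  obtain ⟨M, hM0, hM⟩ := exists_deriv_smoothTransition_le
  set b : ℝ := (volume (Metric.ball (0 : Vec d) 1)).toReal with hb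
  have hb0 : 0 < b :=
    ENNReal.toReal_pos (Metric.measure_ball_pos volume _ one_pos).ne' measure_ball_lt_top.ne
  -- The factor 5^d compares the ball of radius ε with the plateau of radius ε/5. The three summands
  -- serve the mass, supremum and derivative bounds.
  set C : ℝ := 5 ^ d * (1 + 1 / b + 4 * Real.pi * M) with hC
  have hC0 : 0 < C := by positivity
  refine ⟨C, hC0, fun ε hε hε1 => ?_⟩
  set h := Real.smoothTransition with hh
  have hhc : Continuous h := Real.smoothTransition.continuous
  have hhd : Continuous (deriv h) :=
    (Real.smoothTransition.contDiff (n := 1)).continuous_deriv le_rfl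
  set k : Torus d → ℝ := fun x => h (2 - gap x / ε ^ 2) with hk
  have hkc : Continuous k := hhc.comp (by have := continuous_gap (d := d); fun_prop)
  have hk0 : ∀ x, 0 ≤ k x := fun x => Real.smoothTransition.nonneg _
  have hk1 : ∀ x, k x ≤ 1 := fun x => Real.smoothTransition.le_one _
  have hki : Integrable k volume := hkc.integrable_of_hasCompactSupport (HasCompactSupport.of_compactSpace _)
  set Z : ℝ := ∫ x, k x with hZ
  -- For ‖y‖ < ε/5 one has `gap` ≤ 2π²ε²/25 < ε², so the profile equals 1 there; since ε ≤ 1 this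
  -- ball lies in the cube.
  have hZge : (ε / 5) ^ d * b ≤ Z := by
    have h1 : ENNReal.ofReal Z = ∫⁻ y in cube d, ENNReal.ofReal (k (proj y)) := by
      rw [hZ, ofReal_integral_eq_lintegral_ofReal hki (Eventually.of_forall hk0),
        ← measurePreserving_proj.lintegral_comp (by fun_prop)]
    have h2 : volume (Metric.ball (0 : Vec d) (ε / 5)) ≤ ENNReal.ofReal Z := by
      rw [h1, ← setLIntegral_one]
      have hsub : Metric.ball (0 : Vec d) (ε / 5) ⊆ cube d := by
        intro y hy i
        rw [mem_ball_zero_iff] at hy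
        have h3 := (PiLp.norm_apply_le y i).trans_lt hy
        rw [Real.norm_eq_abs, abs_lt] at h3
        exact ⟨by linarith [h3.1], by linarith [h3.2]⟩
      refine le_trans ?_ (lintegral_mono_set hsub)
      refine setLIntegral_mono' measurableSet_ball fun y hy => ?_
      rw [mem_ball_zero_iff] at hy
      have h4 : gap (proj y) / ε ^ 2 ≤ 1 := by
        rw [div_le_one (by positivity)]
        refine (gap_proj_le y).trans ?_
        have h5 : ‖y‖ ^ 2 ≤ (ε / 5) ^ 2 := by gcongr
        have h6 : Real.pi ^ 2 ≤ 3.15 ^ 2 := by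
          gcongr; exact Real.pi_lt_d2.le
        nlinarith [sq_nonneg ‖y‖, sq_nonneg ε, Real.pi_pos]
      simp only [hk, hh]
      rw [Real.smoothTransition.one_of_one_le (by linarith)]
      simp
    rw [volume_ball_eq (by positivity)] at h2
    exact (ENNReal.ofReal_le_ofReal_iff (integral_nonneg hk0)).1 h2
  have hZ0 : 0 < Z := lt_of_lt_of_le (by positivity) hZge
  set a : ℝ := 1 / (ε ^ d * b) with ha
  have ha0 : 0 < a := by positivity
  have hZa : 1 / Z ≤ a * 5 ^ d := by
    calc 1 / Z ≤ 1 / ((ε / 5) ^ d * b) := one_div_le_one_div_of_le (by positivity) hZge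
      _ = a * 5 ^ d := by rw [ha, div_pow]; field_simp
  have hvol0 : volume (Metric.ball (0 : Vec d) ε) ≠ 0 := (Metric.measure_ball_pos volume _ hε).ne'
  have hvol : ENNReal.ofReal a * volume (Metric.ball (0 : Vec d) ε) ≤ 1 := by
    rw [volume_ball_eq hε, ← ENNReal.ofReal_mul ha0.le, ha, ← hb, one_div_mul_cancel (by positivity)]
    simp
  have hC1 : (5 : ℝ) ^ d ≤ C := by
    rw [hC]
    have : (0 : ℝ) ≤ 1 / b + 4 * Real.pi * M := by positivity
    nlinarith [pow_pos (by norm_num : (0 : ℝ) < 5) d]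
  have hC2 : (5 : ℝ) ^ d * (1 / b) ≤ C := by
    rw [hC]; gcongr; have : (0 : ℝ) ≤ 4 * Real.pi * M := by positivity
    linarith
  have hC3 : (5 : ℝ) ^ d * (4 * Real.pi * M) ≤ C := by
    rw [hC]; gcongr; have : (0 : ℝ) ≤ 1 / b := by positivity
    linarith
  have hKle : ∀ x, |k x / Z| ≤ 1 / Z := fun x => by
    rw [abs_of_nonneg (div_nonneg (hk0 x) hZ0.le)]
    gcongr; exact hk1 x
  set K' : Fin d → Torus d → ℝ := fun j x =>
    deriv h (2 - gap x / ε ^ 2) * (-(2 * Real.pi * (fourier 1 (x j) : ℂ).im) / ε ^ 2) / Z with hK'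
  -- Strict negativity makes both the profile and its derivative vanish outside the ball.
  have hgap : ∀ y ∈ cube d, y ∉ Metric.ball (0 : Vec d) ε → 2 - gap (proj y) / ε ^ 2 < 0 := by
    intro y hy hyb
    rw [mem_ball_zero_iff, not_lt] at hyb
    have h1 := le_gap_proj hy
    have h2 : ε ^ 2 ≤ ‖y‖ ^ 2 := by gcongr
    rw [sub_neg, lt_div_iff₀ (by positivity)]
    nlinarith [pow_pos hε 2]
  refine ⟨fun x => k x / Z, K', ?_, by fun_prop, ?_, ?_, fun x => div_nonneg (hk0 x) hZ0.le, ?_, ?_,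
    ?_, ?_⟩
  · unfold IsSmooth
    simp only [hk, gap_proj]
    refine ContDiff.div_const (ContDiff.comp (g := h) (f := fun y : Vec d =>
      2 - (∑ i, (1 - Real.cos (2 * Real.pi * y i))) / ε ^ 2)
      (Real.smoothTransition.contDiff) ?_) _
    fun_prop
  · intro j
    have := continuous_gap (d := d)
    have h1 : Continuous fun x : Torus d => deriv h (2 - gap x / ε ^ 2) := hhd.comp (by fun_prop)
    simp only [hK']
    fun_prop
  · intro j x
    have h1 := ((hasPDeriv_gap j x).div_const (ε ^ 2)).const_sub 2
    have h2 : HasDerivAt h (deriv h (2 - gap x / ε ^ 2))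
        (2 - gap (x + proj (EuclideanSpace.single j 0)) / ε ^ 2) := by
      have e : EuclideanSpace.single j (0 : ℝ) = 0 := by ext i; simp
      rw [e, proj_zero, add_zero]
      exact ((Real.smoothTransition.contDiff (n := 1)).differentiable one_ne_zero _).hasDerivAt
    have h3 := (h2.comp (0 : ℝ) h1).div_const Z
    have e : deriv h (2 - gap x / ε ^ 2) * -(2 * Real.pi * (fourier 1 (x j) : ℂ).im / ε ^ 2) / Z
        = K' j x := by simp only [hK']; ring
    rw [← e]
    exact h3
  · rw [integral_div, ← hZ, div_self hZ0.ne']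
  · intro x
    have := (le_abs_self _).trans ((hKle x).trans hZa)
    refine this.trans ?_
    calc a * 5 ^ d = 5 ^ d * (1 / b) / ε ^ d := by rw [ha]; field_simp
      _ ≤ _ := by gcongr
  · refine lintegral_le_of_supported ha0 hvol hvol0 (fun y hy hyb => ?_) (fun x => ?_)
    · simp only [hk, hh]
      rw [Real.smoothTransition.zero_of_nonpos (hgap y hy hyb).le, zero_div]
    · exact (hKle x).trans (hZa.trans (by gcongr))
  · intro j
    refine lintegral_le_of_supported ha0 hvol hvol0 (fun y hy hyb => ?_) (fun x => ?_)
    · have h1 := hgap y hy hyb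
      simp only [hK']
      rw [(hM _ (by linarith)).2 h1]; simp
    · have hgx : 0 ≤ gap x := by
        have := sin_sq_le_gap x j
        nlinarith [sq_nonneg (fourier 1 (x j) : ℂ).im]
      have hle2 : 2 - gap x / ε ^ 2 ≤ 2 := by
        have : 0 ≤ gap x / ε ^ 2 := by positivity
        linarith
      rcases lt_or_ge (2 - gap x / ε ^ 2) 0 with h1 | h1
      · simp only [hK']
        rw [(hM _ hle2).2 h1]; simp; positivity
      · have h2 : gap x ≤ 2 * ε ^ 2 := by
          rwa [sub_nonneg, div_le_iff₀ (by positivity)] at h1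
        have h3 : |(fourier 1 (x j) : ℂ).im| ≤ 2 * ε := by
          apply abs_le_of_sq_le_sq _ (by positivity)
          have := sin_sq_le_gap x j
          nlinarith
        have h4 := (hM _ hle2).1
        calc |K' j x| = |deriv h (2 - gap x / ε ^ 2)| *
              (2 * Real.pi * |(fourier 1 (x j) : ℂ).im| / ε ^ 2) * (1 / Z) := by
              simp only [hK']
              rw [abs_div, abs_mul, abs_div, abs_neg, abs_mul, abs_of_pos hZ0,
                abs_of_pos (by positivity : 0 < ε ^ 2), abs_of_pos (by positivity : 0 < 2 * Real.pi)]
              ring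
          _ ≤ M * (2 * Real.pi * (2 * ε) / ε ^ 2) * (a * 5 ^ d) := by gcongr
          _ = a * (5 ^ d * (4 * Real.pi * M) / ε) := by field_simp; ring
          _ ≤ a * (C / ε) := by gcongr

/-! ### Convolution and integration by parts on the torus -/

instance instIsNegInvariantTorus {d : ℕ} : (volume : Measure (Torus d)).IsNegInvariant :=
  Pi.isNegInvariant_volume

instance instIsProbabilityMeasureTorus {d : ℕ} : IsProbabilityMeasure (volume : Measure (Torus d)) := by
  constructor
  rw [volume_pi, Measure.pi_univ]
  have : (volume : Measure UnitAddCircle) univ = 1 := by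
    rw [AddCircle.measure_univ]; simp
  simp [this]

/-- The convolution of `K` and `f` on the torus. -/
noncomputable def conv {d : ℕ} (K f : Torus d → ℝ) (x : Torus d) : ℝ := ∫ y, K (x - y) * f y

theorem exists_abs_le {d : ℕ} {K : Torus d → ℝ} (hK : Continuous K) :
    ∃ M, 0 ≤ M ∧ ∀ x, |K x| ≤ M := by
  obtain ⟨M, hM⟩ := isCompact_univ.exists_bound_of_continuousOn hK.continuousOn
  exact ⟨M, (norm_nonneg _).trans (hM 0 (mem_univ _)), fun x => hM x (mem_univ _)⟩

theorem integrable_of_continuous {d : ℕ} {K : Torus d → ℝ} (hK : Continuous K) :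
    Integrable K volume :=
  hK.integrable_of_hasCompactSupport (HasCompactSupport.of_compactSpace _)

theorem integrable_conv {d : ℕ} {K f : Torus d → ℝ} (hK : Continuous K) (hf : Integrable f)
    (x : Torus d) : Integrable (fun y => K (x - y) * f y) := by
  obtain ⟨M, -, hM⟩ := exists_abs_le hK
  exact hf.bdd_mul (c := M) (by fun_prop) (Eventually.of_forall fun y => hM _)

theorem conv_congr {d : ℕ} {K f g : Torus d → ℝ} (h : f =ᵐ[volume] g) : conv K f = conv K g := by
  ext x
  refine integral_congr_ae ?_
  filter_upwards [h] with y hy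
  rw [hy]

theorem conv_eq {d : ℕ} (K f : Torus d → ℝ) (x : Torus d) :
    conv K f x = ∫ y, K y * f (x - y) := by
  rw [conv, ← integral_sub_left_eq_self _ volume x]
  simp

theorem integrable_conv' {d : ℕ} {K f : Torus d → ℝ} (hK : Continuous K) (hf : Integrable f)
    (x : Torus d) : Integrable (fun y => K y * f (x - y)) := by
  have := (integrable_conv hK hf x).comp_sub_left x
  simpa using this

theorem conv_sub {d : ℕ} {K f g : Torus d → ℝ} (hK : Continuous K) (hf : Integrable f)
    (hg : Integrable g) (x : Torus d) : conv K (fun y => f y - g y) x = conv K f x - conv K g x := by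
  simp only [conv, mul_sub]
  exact integral_sub (integrable_conv hK hf x) (integrable_conv hK hg x)

theorem continuous_conv {d : ℕ} {K f : Torus d → ℝ} (hK : Continuous K) (hf : Integrable f) :
    Continuous (conv K f) := by
  obtain ⟨M, hM0, hM⟩ := exists_abs_le hK
  refine continuous_of_dominated (bound := fun y => M * ‖f y‖)
    (fun x => (integrable_conv hK hf x).aestronglyMeasurable) (fun x => ?_) (hf.norm.const_mul M)
    (Eventually.of_forall fun y => by fun_prop)
  refine Eventually.of_forall fun y => ?_
  rw [norm_mul]
  exact mul_le_mul_of_nonneg_right (hM _) (norm_nonneg _)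

theorem abs_conv_le {d : ℕ} {K f : Torus d → ℝ} {M : ℝ} (hM : ∀ x, |K x| ≤ M) (hf : Integrable f)
    (x : Torus d) : |conv K f x| ≤ M * ∫ y, |f y| := by
  rw [← integral_const_mul]
  rw [← Real.norm_eq_abs]
  unfold conv
  refine norm_integral_le_of_norm_le (hf.norm.const_mul M) (Eventually.of_forall fun y => ?_)
  rw [norm_mul]
  exact mul_le_mul_of_nonneg_right (hM _) (norm_nonneg _)

theorem HasPDeriv.conv {d : ℕ} {j : Fin d} {K K' f : Torus d → ℝ} (h : HasPDeriv j K K')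
    (hK : Continuous K) (hK' : Continuous K') (hf : Integrable f) :
    HasPDeriv j (conv K f) (EulerTorus.conv K' f) := by
  intro x
  obtain ⟨M, hM0, hM⟩ := exists_abs_le hK'
  have e : proj (EuclideanSpace.single j (0 : ℝ)) = 0 := by
    rw [← proj_zero]; congr 1; ext i; simp
  have := (hasDerivAt_integral_of_dominated_loc_of_deriv_le (μ := (volume : Measure (Torus d)))
    (bound := fun y => M * ‖f y‖) (s := univ) (x₀ := (0 : ℝ))
    (F := fun s y => K (x + proj (EuclideanSpace.single j s) - y) * f y)
    (F' := fun s y => K' (x + proj (EuclideanSpace.single j s) - y) * f y)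
    univ_mem (Eventually.of_forall fun s => (integrable_conv hK hf _).aestronglyMeasurable)
    (integrable_conv hK hf _) (integrable_conv hK' hf _).aestronglyMeasurable
    (Eventually.of_forall fun y s _ => by
      rw [norm_mul]
      exact mul_le_mul_of_nonneg_right (hM _) (norm_nonneg _)) (hf.norm.const_mul M)
    (Eventually.of_forall fun y s _ => by
      have := (h.hasDerivAt (x - y) s).mul_const (f y)
      simpa only [add_sub_right_comm] using this)).2
  simp only [e, add_zero] at this
  exact this

/-- Convolving with the constant 1 gives the constant function ∫F, while its derivative is ∫F'. -/
theorem HasPDeriv.integral_eq_zero {d : ℕ} {j : Fin d} {F F' : Torus d → ℝ} (h : HasPDeriv j F F')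
    (hF : Continuous F) (hF' : Continuous F') : ∫ x, F' x = 0 := by
  have h1 := h.conv hF hF' (integrable_const (1 : ℝ))
  have h2 : ∀ x, EulerTorus.conv F (fun _ => 1) x = ∫ y, F y := fun x => by
    simp only [EulerTorus.conv, mul_one]; exact integral_sub_left_eq_self _ _ _
  have h3 : ∀ x, EulerTorus.conv F' (fun _ => 1) x = ∫ y, F' y := fun x => by
    simp only [EulerTorus.conv, mul_one]; exact integral_sub_left_eq_self _ _ _
  have h4 := h1 0
  simp only [h2, h3] at h4
  exact h4.unique (hasDerivAt_const _ _)

theorem HasPDeriv.integral_mul_eq_neg {d : ℕ} {j : Fin d} {F F' G G' : Torus d → ℝ}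
    (hF : HasPDeriv j F F') (hG : HasPDeriv j G G') (cF : Continuous F) (cF' : Continuous F')
    (cG : Continuous G) (cG' : Continuous G') : ∫ x, F x * G' x = -∫ x, F' x * G x := by
  have := (hF.mul hG).integral_eq_zero (by fun_prop) (by fun_prop)
  rw [integral_add (integrable_of_continuous (by fun_prop))
    (integrable_of_continuous (by fun_prop))] at this
  linarith

theorem HasPDeriv.comp_sub_left {d : ℕ} {j : Fin d} {F F' : Torus d → ℝ} (h : HasPDeriv j F F')
    (x : Torus d) : HasPDeriv j (fun y => F (x - y)) (fun y => -F' (x - y)) := by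
  intro y
  have e : proj (EuclideanSpace.single j (-0 : ℝ)) = 0 := by
    rw [← proj_zero]; congr 1; ext i; simp
  have h1 := (h.hasDerivAt (x - y) (-0)).scomp (𝕜 := ℝ) (0 : ℝ) (hasDerivAt_neg (0 : ℝ))
  rw [e] at h1
  simp only [add_zero, smul_eq_mul, neg_mul, one_mul] at h1
  refine h1.congr_of_eventuallyEq (Eventually.of_forall fun s => ?_)
  have : EuclideanSpace.single j (-s) = -EuclideanSpace.single j s := by
    ext i; by_cases h : i = j <;> simp [h]
  simp only [Function.comp, this, proj_neg]
  congr 1; abel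

theorem conv_conv_comm {d : ℕ} {K L f : Torus d → ℝ} (hK : Continuous K) (hL : Continuous L)
    (hf : Integrable f) (x : Torus d) : conv K (conv L f) x = conv L (conv K f) x := by
  have key : ∀ {K L : Torus d → ℝ}, Continuous K → Continuous L →
      conv K (conv L f) x = ∫ z, (∫ y, K (x - y) * L (y - z)) * f z := by
    intro K L hK hL
    obtain ⟨M, hM0, hM⟩ := exists_abs_le hK
    obtain ⟨N, hN0, hN⟩ := exists_abs_le hL
    have hint : Integrable (Function.uncurry fun y z => K (x - y) * L (y - z) * f z)
        ((volume : Measure (Torus d)).prod (volume : Measure (Torus d))) := by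
      refine (hf.comp_snd volume).bdd_mul (c := M * N) (Continuous.aestronglyMeasurable (by fun_prop))
        (Eventually.of_forall fun p => ?_)
      rw [norm_mul]
      exact mul_le_mul (hM _) (hN _) (norm_nonneg _) hM0
    calc conv K (conv L f) x = ∫ y, ∫ z, K (x - y) * L (y - z) * f z := by
          simp only [conv, ← integral_const_mul, mul_assoc]
      _ = ∫ z, ∫ y, K (x - y) * L (y - z) * f z := integral_integral_swap hint
      _ = _ := by simp only [integral_mul_const]
  rw [key hK hL, key hL hK]
  congr 1; ext z; congr 1
  -- The reflection y ↦ x + z - y exchanges the arguments x - y and y - z.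
  rw [← integral_sub_left_eq_self _ volume (x + z)]
  congr 1; ext y
  rw [mul_comm]; congr 2 <;> abel

/-! ### Jensen and Young inequalities for mollification -/

/-- Jensen for a weight of mass at most one: apply Hölder to wF = (wF^q)^{1/q} w^{1-1/q}. -/
theorem rpow_lintegral_mul_le {α : Type*} [MeasurableSpace α] {μ : Measure α} {w F : α → ℝ≥0∞}
    (hw : AEMeasurable w μ) (hF : AEMeasurable F μ) (hw1 : ∫⁻ a, w a ∂μ ≤ 1)
    {q : ℝ} (hq : 1 ≤ q) : (∫⁻ a, w a * F a ∂μ) ^ q ≤ ∫⁻ a, w a * F a ^ q ∂μ := by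
  have hq0 : 0 < q := by linarith
  have h1 := ENNReal.lintegral_mul_norm_pow_le (μ := μ) (f := fun a => w a * F a ^ q) (g := w)
    (p := 1 / q) (q := 1 - 1 / q) (hw.mul (hF.pow_const q)) hw (by positivity)
    (by rw [sub_nonneg]; exact (div_le_one hq0).2 hq) (by ring)
  have h2 : ∀ a, (w a * F a ^ q) ^ (1 / q) * w a ^ (1 - 1 / q) = w a * F a := by
    intro a
    rw [ENNReal.mul_rpow_of_nonneg _ _ (by positivity), ← ENNReal.rpow_mul, mul_one_div_cancel hq0.ne',
      ENNReal.rpow_one, mul_right_comm, ← ENNReal.rpow_add_of_nonneg _ _ (by positivity)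
      (by rw [sub_nonneg]; exact (div_le_one hq0).2 hq)]
    simp
  simp only [h2] at h1
  calc (∫⁻ a, w a * F a ∂μ) ^ q ≤ ((∫⁻ a, w a * F a ^ q ∂μ) ^ (1 / q) *
        (∫⁻ a, w a ∂μ) ^ (1 - 1 / q)) ^ q := by gcongr
    _ ≤ ((∫⁻ a, w a * F a ^ q ∂μ) ^ (1 / q) * 1) ^ q := by
        gcongr
        exact ENNReal.rpow_le_one hw1 (by rw [sub_nonneg]; exact (div_le_one hq0).2 hq)
    _ = _ := by rw [mul_one, ← ENNReal.rpow_mul, one_div_mul_cancel hq0.ne', ENNReal.rpow_one]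

theorem eLpNorm_ofReal_eq {α F : Type*} [MeasurableSpace α] [NormedAddCommGroup F] {μ : Measure α}
    {q : ℝ} (hq : 0 < q) (f : α → F) :
    eLpNorm f (ENNReal.ofReal q) μ = (∫⁻ x, ‖f x‖ₑ ^ q ∂μ) ^ (1 / q) := by
  rw [eLpNorm_eq_lintegral_rpow_enorm_toReal (by simpa using hq) ENNReal.ofReal_ne_top,
    ENNReal.toReal_ofReal hq.le]

theorem eLpNorm_ofReal_rpow {α F : Type*} [MeasurableSpace α] [NormedAddCommGroup F] {μ : Measure α}
    {q : ℝ} (hq : 0 < q) (f : α → F) :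
    eLpNorm f (ENNReal.ofReal q) μ ^ q = ∫⁻ x, ‖f x‖ₑ ^ q ∂μ := by
  rw [eLpNorm_ofReal_eq hq, ← ENNReal.rpow_mul, one_div_mul_cancel hq.ne', ENNReal.rpow_one]

theorem enorm_conv_le {d : ℕ} (K f : Torus d → ℝ) (x : Torus d) :
    ‖conv K f x‖ₑ ≤ ∫⁻ y, ‖K (x - y)‖ₑ * ‖f y‖ₑ := by
  refine (enorm_integral_le_lintegral_enorm _).trans_eq ?_
  simp only [enorm_mul]

theorem IsMollifier.lintegral_enorm {d : ℕ} {C ε : ℝ} {K : Torus d → ℝ} {K' : Fin d → Torus d → ℝ}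
    (h : IsMollifier C ε K K') : ∫⁻ y, ‖K y‖ₑ = 1 := by
  have h1 := ofReal_integral_eq_lintegral_ofReal (integrable_of_continuous h.cont)
    (Eventually.of_forall h.nonneg)
  rw [h.integral_eq_one, ENNReal.ofReal_one] at h1
  rw [h1]
  congr 1; ext y
  rw [Real.enorm_eq_ofReal_abs, abs_of_nonneg (h.nonneg y)]

theorem lintegral_lintegral_conv {d : ℕ} {K f : Torus d → ℝ≥0∞} (hK : Measurable K)
    (hf : Measurable f) : ∫⁻ x, ∫⁻ y, K (x - y) * f y = (∫⁻ y, K y) * ∫⁻ y, f y := by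
  rw [lintegral_lintegral_swap (by fun_prop)]
  calc ∫⁻ y, ∫⁻ x, K (x - y) * f y = ∫⁻ y, (∫⁻ x, K x) * f y := by
        congr 1; ext y
        rw [lintegral_mul_const _ (by fun_prop), lintegral_sub_right_eq_self (fun x => K x) y]
    _ = _ := lintegral_const_mul _ hf

/-- By Jensen |K * f|^q ≤ H := K * |f|^q, where H has integral ‖f‖_q^q and supremum at most
(C/ε^d)‖f‖_q^q. Raising to the power r/q and interpolating between these two facts gives Young's
inequality. -/
theorem IsMollifier.eLpNorm_conv_le {d : ℕ} {C ε : ℝ} {K : Torus d → ℝ} {K' : Fin d → Torus d → ℝ}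
    (h : IsMollifier C ε K K') {f : Torus d → ℝ} (hf : Measurable f) {q r : ℝ} (hq : 1 ≤ q)
    (hqr : q ≤ r) : eLpNorm (conv K f) (ENNReal.ofReal r) volume ≤
      ENNReal.ofReal (C / ε ^ d) ^ (1 / q - 1 / r) * eLpNorm f (ENNReal.ofReal q) volume := by
  have hq0 : 0 < q := by linarith
  have hr0 : 0 < r := by linarith
  have hKm : Measurable K := h.cont.measurable
  set A : ℝ≥0∞ := ∫⁻ y, ‖f y‖ₑ ^ q with hA
  set S : ℝ≥0∞ := ENNReal.ofReal (C / ε ^ d) with hS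
  set H : Torus d → ℝ≥0∞ := fun x => ∫⁻ y, ‖K (x - y)‖ₑ * ‖f y‖ₑ ^ q with hH
  have hK1 : ∀ x, ∫⁻ y, ‖K (x - y)‖ₑ = 1 := fun x => by
    rw [lintegral_sub_left_eq_self (fun y => ‖K y‖ₑ) x, h.lintegral_enorm]
  have h1 : ∀ x, ‖conv K f x‖ₑ ^ q ≤ H x := fun x =>
    (ENNReal.rpow_le_rpow (enorm_conv_le K f x) hq0.le).trans
      (rpow_lintegral_mul_le (by fun_prop) (by fun_prop) (hK1 x).le hq)
  have h2 : ∀ x, H x ≤ S * A := fun x => by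
    rw [hA, ← lintegral_const_mul _ (by fun_prop)]
    refine lintegral_mono fun y => ?_
    gcongr
    rw [Real.enorm_eq_ofReal_abs, abs_of_nonneg (h.nonneg _)]
    exact ENNReal.ofReal_le_ofReal (h.le _)
  have h3 : ∫⁻ x, H x = A := by
    rw [hH, lintegral_lintegral_conv (K := fun y => ‖K y‖ₑ) (f := fun y => ‖f y‖ₑ ^ q)
      (by fun_prop) (by fun_prop), h.lintegral_enorm, one_mul]
  have hexp : 0 ≤ r / q - 1 := by rw [sub_nonneg]; exact (one_le_div hq0).2 hqr
  have h4 : ∀ x, ‖conv K f x‖ₑ ^ r ≤ (S * A) ^ (r / q - 1) * H x := fun x => by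
    calc ‖conv K f x‖ₑ ^ r = (‖conv K f x‖ₑ ^ q) ^ (r / q) := by
          rw [← ENNReal.rpow_mul, mul_div_cancel₀ _ hq0.ne']
      _ ≤ H x ^ (r / q) := by gcongr; exact h1 x
      _ = H x ^ (r / q - 1) * H x := by
          conv_rhs => rw [← ENNReal.rpow_one (H x), ← ENNReal.rpow_mul, one_mul,
            ← ENNReal.rpow_add_of_nonneg _ _ hexp zero_le_one]
          simp
      _ ≤ _ := by gcongr; exact h2 x
  have h5 : ∫⁻ x, ‖conv K f x‖ₑ ^ r ≤ (S * A) ^ (r / q - 1) * A := by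
    refine (lintegral_mono h4).trans ?_
    rw [lintegral_const_mul _ (by
      exact Measurable.lintegral_prod_right' (f := fun p : Torus d × Torus d =>
        ‖K (p.1 - p.2)‖ₑ * ‖f p.2‖ₑ ^ q) (by fun_prop)), h3]
  rw [eLpNorm_ofReal_eq hr0, eLpNorm_ofReal_eq hq0, ← hA]
  have hexp2 : 0 ≤ 1 / q - 1 / r := sub_nonneg.2 (one_div_le_one_div_of_le hq0 hqr)
  calc (∫⁻ x, ‖conv K f x‖ₑ ^ r) ^ (1 / r) ≤ ((S * A) ^ (r / q - 1) * A) ^ (1 / r) := by gcongr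
    _ = S ^ (1 / q - 1 / r) * (A ^ (1 / q - 1 / r) * A ^ (1 / r)) := by
        rw [ENNReal.mul_rpow_of_nonneg _ _ (by positivity), ← ENNReal.rpow_mul,
          show (r / q - 1) * (1 / r) = 1 / q - 1 / r by field_simp,
          ENNReal.mul_rpow_of_nonneg _ _ hexp2, mul_assoc]
    _ = _ := by
        rw [← ENNReal.rpow_add_of_nonneg _ _ hexp2 (by positivity)]
        simp

theorem IsMollifier.eLpNorm_conv_le_self {d : ℕ} {C ε : ℝ} {K : Torus d → ℝ}
    {K' : Fin d → Torus d → ℝ} (h : IsMollifier C ε K K') {f : Torus d → ℝ} (hf : Measurable f)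
    {q : ℝ} (hq : 1 ≤ q) :
    eLpNorm (EulerTorus.conv K f) (ENNReal.ofReal q) volume ≤ eLpNorm f (ENNReal.ofReal q) volume := by
  have := h.eLpNorm_conv_le hf hq le_rfl
  simpa using this

theorem setLAverage_le_of_forall {d : ℕ} {s : Set (Vec d)} (hs : MeasurableSet s) {G : Vec d → ℝ≥0∞} {M : ℝ≥0∞} (h : ∀ y ∈ s, G y ≤ M) :
    ⨍⁻ y in s, G y ∂volume ≤ M := by
  rw [setLAverage_eq]
  refine ENNReal.div_le_of_le_mul ((setLIntegral_mono' hs h).trans_eq ?_)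
  rw [setLIntegral_const]

theorem IsMollifier.sub_conv_eq {d : ℕ} {C ε : ℝ} {K : Torus d → ℝ} {K' : Fin d → Torus d → ℝ}
    (h : IsMollifier C ε K K') {f : Torus d → ℝ} (hf : Integrable f) (c : ℝ) (x : Torus d) :
    c - conv K f x = ∫ y, K y * (c - f (x - y)) := by
  simp only [mul_sub]
  rw [integral_sub ((integrable_of_continuous h.cont).mul_const _) (integrable_conv' h.cont hf x),
    integral_mul_const, h.integral_eq_one, one_mul, conv_eq]

/-- Since K has mass one, f - K * f is a K-average of increments. Jensen followed by domination of K
by C times the ball average produces C^{1/q}. -/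
theorem IsMollifier.eLpNorm_sub_conv_le {d : ℕ} {C ε : ℝ} {K : Torus d → ℝ}
    {K' : Fin d → Torus d → ℝ} (h : IsMollifier C ε K K') {f : Torus d → ℝ} (hf : Measurable f)
    (hfi : Integrable f) {q : ℝ} (hq : 1 ≤ q) {M : ℝ≥0∞}
    (hM : ∀ y ∈ Metric.ball (0 : Vec d) ε,
      eLpNorm (fun x => f x - f (x - proj y)) (ENNReal.ofReal q) volume ≤ M) :
    eLpNorm (fun x => f x - conv K f x) (ENNReal.ofReal q) volume ≤
      ENNReal.ofReal C ^ (1 / q) * M := by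
  have hq0 : 0 < q := by linarith
  have hKm : Measurable K := h.cont.measurable
  have h1 : ∀ x, ‖f x - conv K f x‖ₑ ^ q ≤ ∫⁻ y, ‖K y‖ₑ * ‖f x - f (x - y)‖ₑ ^ q := by
    intro x
    rw [h.sub_conv_eq hfi]
    refine (ENNReal.rpow_le_rpow (enorm_integral_le_lintegral_enorm _) hq0.le).trans ?_
    simp only [enorm_mul]
    exact rpow_lintegral_mul_le (by fun_prop) (by fun_prop) h.lintegral_enorm.le hq
  have h2 : ∫⁻ x, ‖f x - conv K f x‖ₑ ^ q ≤ ENNReal.ofReal C * M ^ q := by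
    calc ∫⁻ x, ‖f x - conv K f x‖ₑ ^ q ≤ ∫⁻ x, ∫⁻ y, ‖K y‖ₑ * ‖f x - f (x - y)‖ₑ ^ q :=
          lintegral_mono h1
      _ = ∫⁻ y, ‖K y‖ₑ * ∫⁻ x, ‖f x - f (x - y)‖ₑ ^ q := by
          rw [lintegral_lintegral_swap (by fun_prop)]
          congr 1; ext y
          rw [lintegral_const_mul _ (by fun_prop)]
      _ ≤ _ := by
          refine (h.lintegral_le _).trans ?_
          gcongr
          refine setLAverage_le_of_forall measurableSet_ball fun y hy => ?_
          rw [← eLpNorm_ofReal_rpow hq0 (fun x => f x - f (x - proj y))]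
          gcongr
          exact hM y hy
  rw [eLpNorm_ofReal_eq hq0]
  calc _ ≤ (ENNReal.ofReal C * M ^ q) ^ (1 / q) := by gcongr
    _ = _ := by
      rw [ENNReal.mul_rpow_of_nonneg _ _ (by positivity), ← ENNReal.rpow_mul,
        mul_one_div_cancel hq0.ne', ENNReal.rpow_one]

/-- Translations act continuously on L^q for finite q. -/
theorem exists_eLpNorm_sub_translate_le {d : ℕ} {f : Torus d → ℝ} {q : ℝ} (hq : 1 ≤ q)
    (hf : MemLp f (ENNReal.ofReal q) volume) {δ : ℝ≥0∞} (hδ : 0 < δ) :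
    ∃ ε₀ > 0, ∀ y ∈ Metric.ball (0 : Vec d) ε₀,
      eLpNorm (fun x => f x - f (x - proj y)) (ENNReal.ofReal q) volume ≤ δ := by
  have : Fact (1 ≤ ENNReal.ofReal q) := ⟨by simpa using hq⟩
  have : Fact (ENNReal.ofReal q ≠ ⊤) := ⟨ENNReal.ofReal_ne_top⟩
  have : ContinuousVAdd (Torus d)ᵈᵃᵃ (Lp ℝ (ENNReal.ofReal q) (volume : Measure (Torus d))) :=
    Lp.instContinuousVAddDomAddAct
  have h1 : Continuous fun y : Vec d => DomAddAct.mk (-proj y) +ᵥ hf.toLp f := by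
    have : Continuous fun y : Vec d => DomAddAct.mk (-proj y) :=
      DomAddAct.continuous_mk.comp continuous_proj.neg
    exact this.vadd continuous_const
  have h2 := h1.tendsto 0
  rw [EMetric.tendsto_nhds] at h2
  obtain ⟨ε₀, hε₀, h3⟩ := Metric.eventually_nhds_iff_ball.1 (h2 δ hδ)
  refine ⟨ε₀, hε₀, fun y hy => ?_⟩
  have h4 := h3 y hy
  rw [DomAddAct.mk_vadd_toLp, DomAddAct.mk_vadd_toLp, Lp.edist_toLp_toLp, eLpNorm_sub_comm] at h4
  refine le_of_eq_of_le ?_ h4.le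
  congr 1; ext x
  simp [proj_zero, sub_eq_neg_add]

/-! ### Energy flux and third-order increments -/

/-- The uniform probability measure on the ball of radius `ε` around the origin. -/
noncomputable def ballAvg (d : ℕ) (ε : ℝ) : Measure (Vec d) :=
  (volume (Metric.ball (0 : Vec d) ε))⁻¹ • volume.restrict (Metric.ball (0 : Vec d) ε)

theorem setLAverage_ball_eq {d : ℕ} (ε : ℝ) (G : Vec d → ℝ≥0∞) :
    ⨍⁻ y in Metric.ball (0 : Vec d) ε, G y ∂volume = ∫⁻ y, G y ∂ballAvg d ε :=
  setLAverage_eq' _ G _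

theorem isProbabilityMeasure_ballAvg {d : ℕ} {ε : ℝ} (hε : 0 < ε) :
    IsProbabilityMeasure (ballAvg d ε) := by
  constructor
  rw [ballAvg, Measure.smul_apply, Measure.restrict_apply_univ, smul_eq_mul]
  exact ENNReal.inv_mul_cancel (Metric.measure_ball_pos volume _ hε).ne' measure_ball_lt_top.ne

instance instSFiniteBallAvg {d : ℕ} (ε : ℝ) : SFinite (ballAvg d ε) := by
  unfold ballAvg; infer_instance

theorem ae_ballAvg_of_forall {d : ℕ} {ε : ℝ} {P : Vec d → Prop}
    (h : ∀ y ∈ Metric.ball (0 : Vec d) ε, P y) : ∀ᵐ y ∂ballAvg d ε, P y := by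
  refine Measure.ae_smul_measure ?_ _
  filter_upwards [ae_restrict_mem measurableSet_ball] with y hy using h y hy

/-- On a probability space the two factors are at most the powers 1/3 and 2/3 of ∫F³. -/
theorem lintegral_mul_lintegral_sq_le {α : Type*} [MeasurableSpace α] {μ : Measure α}
    [IsProbabilityMeasure μ] {F : α → ℝ≥0∞} (hF : AEMeasurable F μ) :
    (∫⁻ a, F a ∂μ) * ∫⁻ a, F a ^ (2 : ℝ) ∂μ ≤ ∫⁻ a, F a ^ (3 : ℝ) ∂μ := by
  have h1 := rpow_lintegral_mul_le (μ := μ) (w := fun _ => 1) (by fun_prop) hF (by simp)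
    (q := 3) (by norm_num)
  have h2 := rpow_lintegral_mul_le (μ := μ) (w := fun _ => 1) (by fun_prop) (hF.pow_const (2 : ℝ)) (by simp)
    (q := 3 / 2) (by norm_num)
  have e : ∀ a, (F a ^ (2 : ℝ)) ^ (3 / 2 : ℝ) = F a ^ (3 : ℝ) := fun a => by
    rw [← ENNReal.rpow_mul]; norm_num
  simp only [one_mul, e] at h1 h2
  set I := ∫⁻ a, F a ^ (3 : ℝ) ∂μ
  calc (∫⁻ a, F a ∂μ) * ∫⁻ a, F a ^ (2 : ℝ) ∂μ
      = ((∫⁻ a, F a ∂μ) ^ (3 : ℝ)) ^ (1 / 3 : ℝ) *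
        ((∫⁻ a, F a ^ (2 : ℝ) ∂μ) ^ (3 / 2 : ℝ)) ^ (2 / 3 : ℝ) := by
        rw [← ENNReal.rpow_mul, ← ENNReal.rpow_mul]; norm_num
    _ ≤ I ^ (1 / 3 : ℝ) * I ^ (2 / 3 : ℝ) := by
        gcongr
    _ = I := by
        rw [← ENNReal.rpow_add_of_nonneg _ _ (by norm_num) (by norm_num)]; norm_num

section Flux

variable {d : ℕ} {C ε : ℝ} {K : Torus d → ℝ} {K' : Fin d → Torus d → ℝ} {u : Torus d → Vec d}

theorem integrable_apply (hu : MemLp u 2 volume) (i : Fin d) : Integrable fun y => u y i := by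
  have h := (hu.integrable (by norm_num))
  exact h.mono ((EuclideanSpace.proj (𝕜 := ℝ) i).continuous.comp_aestronglyMeasurable h.1)
    (Eventually.of_forall fun _ => PiLp.norm_apply_le _ _)

theorem memLp_apply (hu : MemLp u 2 volume) (i : Fin d) : MemLp (fun y => u y i) 2 volume :=
  hu.mono ((EuclideanSpace.proj (𝕜 := ℝ) i).continuous.comp_aestronglyMeasurable hu.1)
    (Eventually.of_forall fun _ => PiLp.norm_apply_le _ _)

theorem integrable_apply_mul (hu : MemLp u 2 volume) (i j : Fin d) :
    Integrable fun y => u y i * u y j :=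
  (memLp_apply hu i).integrable_mul (memLp_apply hu j)

/-- The derivative of K has mean zero, so the value at x may be subtracted inside the convolution: a
derivative costs 1/ε but leaves only increments. -/
theorem IsMollifier.enorm_conv_deriv_le (h : IsMollifier C ε K K') (hu : MemLp u 2 volume)
    (i j : Fin d) (x : Torus d) : ‖conv (K' j) (fun y => u y i) x‖ₑ ≤
      ENNReal.ofReal (C / ε) * ∫⁻ y, ‖u x - u (x - proj y)‖ₑ ∂ballAvg d ε := by
  have h0 : ∫ y, K' j y = 0 := (h.hasPDeriv j).integral_eq_zero h.cont (h.cont_deriv j)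
  have h1 : conv (K' j) (fun y => u y i) x = ∫ y, K' j y * (u (x - y) i - u x i) := by
    simp only [mul_sub]
    rw [integral_sub (integrable_conv' (h.cont_deriv j) (integrable_apply hu i) x)
      ((integrable_of_continuous (h.cont_deriv j)).mul_const _), integral_mul_const, h0, conv_eq]
    simp
  rw [h1, ← setLAverage_ball_eq]
  refine (enorm_integral_le_lintegral_enorm _).trans
    (le_trans ?_ (h.lintegral_deriv_le j fun y => ‖u x - u (x - y)‖ₑ))
  refine lintegral_mono fun y => ?_
  rw [enorm_mul]
  gcongr
  rw [enorm_le_iff_norm_le, norm_sub_rev (u x)]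
  exact PiLp.norm_apply_le (u (x - y) - u x) i

/-- The Constantin–E–Titi identity writes the commutator as ∫ K δuᵢ δuⱼ - (uᵢ - K * uᵢ)(uⱼ - K *
uⱼ). Both terms are quadratic in increments; the second is handled by Jensen, whence the factor 2.
-/
theorem IsMollifier.enorm_conv_mul_sub_le (h : IsMollifier C ε K K') (hum : Measurable u)
    (hu : MemLp u 2 volume) (i j : Fin d) (x : Torus d) :
    ‖conv K (fun y => u y i * u y j) x - conv K (fun y => u y i) x * conv K (fun y => u y j) x‖ₑ ≤
      2 * ENNReal.ofReal C * ∫⁻ y, ‖u x - u (x - proj y)‖ₑ ^ (2 : ℝ) ∂ballAvg d ε := by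
  have hKm : Measurable K := h.cont.measurable
  have hint : ∀ i, Integrable fun y => K y * u (x - y) i := fun i =>
    integrable_conv' h.cont (integrable_apply hu i) x
  have hint2 : Integrable fun y => K y * (u (x - y) i * u (x - y) j) :=
    integrable_conv' h.cont (integrable_apply_mul hu i j) x
  have hK := integrable_of_continuous h.cont
  have e1 : ∫ y, K y * ((u x i - u (x - y) i) * (u x j - u (x - y) j)) =
      conv K (fun y => u y i * u y j) x - u x j * conv K (fun y => u y i) x
        - u x i * conv K (fun y => u y j) x + u x i * u x j := by
    calc _ = ∫ y, (K y * (u (x - y) i * u (x - y) j) - u x j * (K y * u (x - y) i)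
            - u x i * (K y * u (x - y) j) + K y * (u x i * u x j)) := by
          congr 1; ext y; ring
      _ = _ := by
          have i1 : Integrable fun y => K y * (u (x - y) i * u (x - y) j)
              - u x j * (K y * u (x - y) i) := hint2.sub ((hint i).const_mul _)
          have i2 : Integrable fun y => K y * (u (x - y) i * u (x - y) j)
              - u x j * (K y * u (x - y) i) - u x i * (K y * u (x - y) j) :=
            i1.sub ((hint j).const_mul _)
          rw [integral_add i2 (hK.mul_const _), integral_sub i1 ((hint j).const_mul _),
            integral_sub hint2 ((hint i).const_mul _), integral_mul_const, h.integral_eq_one,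
            integral_const_mul, integral_const_mul, conv_eq, conv_eq, conv_eq, one_mul]
  have e2 : conv K (fun y => u y i * u y j) x - conv K (fun y => u y i) x * conv K (fun y => u y j) x
      = (∫ y, K y * ((u x i - u (x - y) i) * (u x j - u (x - y) j)))
        - (u x i - conv K (fun y => u y i) x) * (u x j - conv K (fun y => u y j) x) := by
    rw [e1]; ring
  set D : Torus d → ℝ≥0∞ := fun y => ‖u x - u (x - y)‖ₑ with hD
  have hDm : Measurable D := by fun_prop
  have hDi : ∀ i y, ‖u x i - u (x - y) i‖ₑ ≤ D y := fun i y => by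
    rw [hD, enorm_le_iff_norm_le]
    exact PiLp.norm_apply_le (u x - u (x - y)) i
  have b1 : ∀ i, ‖u x i - conv K (fun y => u y i) x‖ₑ ≤ ∫⁻ y, ‖K y‖ₑ * D y := fun i => by
    rw [h.sub_conv_eq (integrable_apply hu i)]
    refine (enorm_integral_le_lintegral_enorm _).trans (lintegral_mono fun y => ?_)
    rw [enorm_mul]
    gcongr
    exact hDi i y
  have b2 : (∫⁻ y, ‖K y‖ₑ * D y) * (∫⁻ y, ‖K y‖ₑ * D y) ≤ ∫⁻ y, ‖K y‖ₑ * D y ^ (2 : ℝ) := by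
    have := rpow_lintegral_mul_le (μ := (volume : Measure (Torus d))) (w := fun y => ‖K y‖ₑ) (F := D)
      (by fun_prop) (by fun_prop) h.lintegral_enorm.le (q := 2) (by norm_num)
    rwa [ENNReal.rpow_two, sq] at this
  have b3 : ‖∫ y, K y * ((u x i - u (x - y) i) * (u x j - u (x - y) j))‖ₑ ≤
      ∫⁻ y, ‖K y‖ₑ * D y ^ (2 : ℝ) := by
    refine (enorm_integral_le_lintegral_enorm _).trans (lintegral_mono fun y => ?_)
    rw [enorm_mul, enorm_mul, ENNReal.rpow_two, sq]
    gcongr <;> exact hDi _ y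
  rw [e2]
  calc _ ≤ (∫⁻ y, ‖K y‖ₑ * D y ^ (2 : ℝ)) + ∫⁻ y, ‖K y‖ₑ * D y ^ (2 : ℝ) := by
        refine enorm_sub_le.trans (add_le_add b3 (le_trans ?_ b2))
        rw [enorm_mul]
        gcongr <;> exact b1 _
    _ = 2 * ∫⁻ y, ‖K y‖ₑ * D y ^ (2 : ℝ) := by rw [two_mul]
    _ ≤ 2 * (ENNReal.ofReal C * ∫⁻ y, D (proj y) ^ (2 : ℝ) ∂ballAvg d ε) := by
        rw [← setLAverage_ball_eq]
        gcongr
        exact h.lintegral_le fun y => D y ^ (2 : ℝ)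
    _ = _ := by rw [mul_assoc]

/-- The flux of energy through scale `ε` is controlled by third order increments. -/
theorem IsMollifier.enorm_flux_le (hε : 0 < ε) (h : IsMollifier C ε K K')
    (hum : Measurable u) (hu : MemLp u 2 volume) {P : Torus d → ℝ} (hP : Integrable P)
    (hdiv : ∀ x, ∑ i, conv (K' i) (fun y => u y i) x = 0) :
    ‖∫ x, ∑ i, conv K (fun y => u y i) x *
        ((∑ j, conv (K' j) (fun y => u y i * u y j) x) + conv (K' i) P x)‖ₑ ≤
      (d : ℝ≥0∞) ^ 2 * (2 * ENNReal.ofReal C * ENNReal.ofReal (C / ε)) *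
        ∫⁻ x, ∫⁻ y, ‖u x - u (x - proj y)‖ₑ ^ (3 : ℝ) ∂ballAvg d ε := by
  have hprob := isProbabilityMeasure_ballAvg (d := d) hε
  set a : Fin d → Torus d → ℝ := fun i => conv K fun y => u y i with ha
  set A : Fin d → Fin d → Torus d → ℝ := fun i j => conv (K' j) fun y => u y i with hA
  set w : Fin d → Fin d → Torus d → ℝ := fun i j => conv K fun y => u y i * u y j with hw
  have ca : ∀ i, Continuous (a i) := fun i => continuous_conv h.cont (integrable_apply hu i)
  have cA : ∀ i j, Continuous (A i j) := fun i j =>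
    continuous_conv (h.cont_deriv j) (integrable_apply hu i)
  have cw : ∀ i j, Continuous (w i j) := fun i j =>
    continuous_conv h.cont (integrable_apply_mul hu i j)
  have da : ∀ i j, HasPDeriv j (a i) (A i j) := fun i j =>
    (h.hasPDeriv j).conv h.cont (h.cont_deriv j) (integrable_apply hu i)
  have cw' : ∀ i j, Continuous (conv (K' j) fun y => u y i * u y j) := fun i j =>
    continuous_conv (h.cont_deriv j) (integrable_apply_mul hu i j)
  have cP := continuous_conv h.cont hP
  have cP' : ∀ i, Continuous (conv (K' i) P) := fun i => continuous_conv (h.cont_deriv i) hP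
  have parts : ∀ i j (W : Torus d → ℝ), Integrable W →
      ∫ x, a i x * conv (K' j) W x = -∫ x, A i j x * conv K W x := fun i j W hW =>
    (da i j).integral_mul_eq_neg ((h.hasPDeriv j).conv h.cont (h.cont_deriv j) hW) (ca i) (cA i j)
      (continuous_conv h.cont hW) (continuous_conv (h.cont_deriv j) hW)
  -- Integration by parts moves the derivative from the mollified pressure to the divergence of the
  -- mollified field, which is zero. Integrability of the pressure is enough.
  have hpress : ∑ i, ∫ x, a i x * conv (K' i) P x = 0 := by
    calc ∑ i, ∫ x, a i x * conv (K' i) P x = ∑ i, -∫ x, A i i x * conv K P x := by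
          congr 1; ext i; exact parts i i P hP
      _ = -∫ x, (∑ i, A i i x) * conv K P x := by
          rw [Finset.sum_neg_distrib, ← integral_finsetSum _ fun i _ =>
            integrable_of_continuous (by fun_prop)]
          simp only [Finset.sum_mul]
      _ = 0 := by simp only [hA, hdiv]; simp
  -- Integrate ∂ⱼ(aᵢ²aⱼ) = 2aᵢaⱼ∂ⱼaᵢ + aᵢ²∂ⱼaⱼ and sum over j. This inserts the product aᵢaⱼ into
  -- the flux at no cost, turning (v⊗v)_ε into the commutator.
  have hcubic : ∀ i, ∑ j, ∫ x, A i j x * (a i x * a j x) = 0 := by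
    intro i
    have h1 : ∀ j, (2 * ∫ x, A i j x * (a i x * a j x)) + ∫ x, A j j x * (a i x * a i x) = 0 := by
      intro j
      have h2 := (((da i j).mul (da i j)).mul (da j j)).integral_eq_zero
        (by fun_prop) (by fun_prop)
      rw [← h2, ← integral_const_mul, ← integral_add (integrable_of_continuous (by fun_prop))
        (integrable_of_continuous (by fun_prop))]
      congr 1; ext x; ring
    have h3 : ∑ j, ∫ x, A j j x * (a i x * a i x) = 0 := by
      rw [← integral_finsetSum _ fun i _ => integrable_of_continuous (by fun_prop)]
      simp only [← Finset.sum_mul, hA, hdiv]; simp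
    have h4 := Finset.sum_congr rfl fun j (_ : j ∈ Finset.univ) => h1 j
    rw [Finset.sum_add_distrib, h3, ← Finset.mul_sum] at h4
    simpa using h4
  have key : ∫ x, ∑ i, a i x * ((∑ j, conv (K' j) (fun y => u y i * u y j) x) + conv (K' i) P x)
      = -∫ x, ∑ i, ∑ j, A i j x * (w i j x - a i x * a j x) := by
    calc _ = ∑ i, ∑ j, ∫ x, a i x * conv (K' j) (fun y => u y i * u y j) x := by
          rw [integral_finsetSum _ fun i _ => integrable_of_continuous (by fun_prop)]
          rw [← add_zero (∑ i, ∑ j, _), ← hpress, ← Finset.sum_add_distrib]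
          congr 1; ext i
          rw [← integral_finsetSum _ fun j _ => integrable_of_continuous (by fun_prop),
            ← integral_add (integrable_of_continuous (by fun_prop))
              (integrable_of_continuous (by fun_prop))]
          simp only [mul_add, Finset.mul_sum]
      _ = -∑ i, ∑ j, ∫ x, A i j x * w i j x := by
          rw [← Finset.sum_neg_distrib]
          congr 1; ext i
          rw [← Finset.sum_neg_distrib]
          congr 1; ext j
          exact parts i j _ (integrable_apply_mul hu i j)
      _ = _ := by
          rw [integral_finsetSum _ fun i _ => integrable_of_continuous (by fun_prop)]
          congr 2; ext i
          rw [integral_finsetSum _ fun i _ => integrable_of_continuous (by fun_prop),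
            ← sub_zero (∑ j, ∫ x, A i j x * w i j x), ← hcubic i, ← Finset.sum_sub_distrib]
          congr 1; ext j
          rw [← integral_sub (integrable_of_continuous (by fun_prop))
              (integrable_of_continuous (by fun_prop))]
          simp only [mul_sub]
  rw [key, enorm_neg]
  refine (enorm_integral_le_lintegral_enorm _).trans ?_
  rw [← lintegral_const_mul' _ _ (by finiteness)]
  refine lintegral_mono fun x => ?_
  set D : Vec d → ℝ≥0∞ := fun y => ‖u x - u (x - proj y)‖ₑ with hD
  have hDm : Measurable D := by have := measurable_proj (d := d); fun_prop
  calc ‖∑ i, ∑ j, A i j x * (w i j x - a i x * a j x)‖ₑ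
      ≤ ∑ i, ∑ j, ‖A i j x * (w i j x - a i x * a j x)‖ₑ :=
        (enorm_sum_le _ _).trans (Finset.sum_le_sum fun i _ => enorm_sum_le _ _)
    _ ≤ ∑ i : Fin d, ∑ j : Fin d, 2 * ENNReal.ofReal C * ENNReal.ofReal (C / ε) *
          ∫⁻ y, D y ^ (3 : ℝ) ∂ballAvg d ε := by
        refine Finset.sum_le_sum fun i _ => Finset.sum_le_sum fun j _ => ?_
        rw [enorm_mul]
        -- The derivative is linear and the commutator quadratic in the increments; together they
        -- give the cubic average.
        calc _ ≤ (ENNReal.ofReal (C / ε) * ∫⁻ y, D y ∂ballAvg d ε) *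
              (2 * ENNReal.ofReal C * ∫⁻ y, D y ^ (2 : ℝ) ∂ballAvg d ε) :=
              mul_le_mul' (h.enorm_conv_deriv_le hu i j x) (h.enorm_conv_mul_sub_le hum hu i j x)
          _ = 2 * ENNReal.ofReal C * ENNReal.ofReal (C / ε) *
              ((∫⁻ y, D y ∂ballAvg d ε) * ∫⁻ y, D y ^ (2 : ℝ) ∂ballAvg d ε) := by ring
          _ ≤ _ := by
              gcongr
              exact lintegral_mul_lintegral_sq_le hDm.aemeasurable
    _ = _ := by
        simp only [Finset.sum_const, Finset.card_univ, Fintype.card_fin, nsmul_eq_mul]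
        ring

end Flux

/-! ### From weak time derivatives to absolutely continuous functions -/

/-- The fundamental lemma of the calculus of variations, applied to the extension by zero, gives
vanishing almost everywhere; continuity upgrades it to every time, endpoints included. -/
theorem eq_zero_of_integral_smooth_mul_eq_zero {T : ℝ} (hT : 0 < T) {h : ℝ → ℝ}
    (hc : ContinuousOn h (Icc 0 T))
    (hint : ∀ g : ℝ → ℝ, ContDiff ℝ ∞ g → ∫ t in Ioo 0 T, g t * h t = 0) :
    ∀ t ∈ Icc 0 T, h t = 0 := by
  have h1 : Integrable ((Icc 0 T).indicator h) :=
    (hc.integrableOn_compact isCompact_Icc).integrable_indicator measurableSet_Icc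
  have h2 := ae_eq_zero_of_integral_contDiff_smul_eq_zero h1.locallyIntegrable fun g hg _ => by
    refine Eq.trans ?_ (hint g hg)
    rw [← integral_Icc_eq_integral_Ioo, ← integral_indicator measurableSet_Icc]
    congr 1; ext t
    by_cases ht : t ∈ Icc 0 T
    · rw [indicator_of_mem ht, indicator_of_mem ht, smul_eq_mul]
    · rw [indicator_of_notMem ht, indicator_of_notMem ht, smul_zero]
  have h3 : h =ᵐ[volume.restrict (Icc 0 T)] fun _ => 0 := by
    filter_upwards [ae_restrict_of_ae h2, ae_restrict_mem measurableSet_Icc] with t ht ht'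
    rwa [indicator_of_mem ht'] at ht
  exact fun t ht => Measure.eqOn_Icc_of_ae_eq volume hT.ne h3 hc continuousOn_const ht

/-- Integration by parts for absolutely continuous functions. Mere integrability of the derivatives
matters because the pressure is only L¹ in time. -/
theorem integral_primitive_mul_add {a b : ℝ} {f g : ℝ → ℝ} (c c' : ℝ)
    (hf : IntervalIntegrable f volume a b) (hg : IntervalIntegrable g volume a b) :
    ∫ t in a..b, f t * (c' + ∫ s in a..t, g s) + (c + ∫ s in a..t, f s) * g t =
      (c + ∫ s in a..b, f s) * (c' + ∫ s in a..b, g s) - c * c' := by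
  have ac : ∀ (f : ℝ → ℝ) (c : ℝ), IntervalIntegrable f volume a b →
      AbsolutelyContinuousOnInterval (fun t => c + ∫ s in a..t, f s) a b := fun f c hf =>
    (LipschitzOnWith.absolutelyContinuousOnInterval (K := 0)
      ((LipschitzWith.const c).lipschitzOnWith)).add
      (hf.absolutelyContinuousOnInterval_intervalIntegral (by simp))
  have h := (ac f c hf).integral_deriv_mul_eq_sub (ac g c' hg)
  simp only [intervalIntegral.integral_same, add_zero] at h
  rw [← h]
  refine intervalIntegral.integral_congr_ae ?_
  filter_upwards [hf.ae_hasDerivAt_integral, hg.ae_hasDerivAt_integral] with t h1 h2 ht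
  have ht' := uIoc_subset_uIcc ht
  rw [((h1 ht' a (by simp)).const_add c).deriv, ((h2 ht' a (by simp)).const_add c').deriv]

theorem contDiff_primitive {g : ℝ → ℝ} (hg : ContDiff ℝ ∞ g) (a : ℝ) :
    ContDiff ℝ ∞ fun t => ∫ s in a..t, g s := by
  have h : ∀ t, HasDerivAt (fun t => ∫ s in a..t, g s) (g t) t := fun t =>
    intervalIntegral.integral_hasDerivAt_right (hg.continuous.intervalIntegrable _ _)
      hg.continuous.aestronglyMeasurable.stronglyMeasurableAtFilter hg.continuous.continuousAt
  rw [contDiff_infty_iff_deriv]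
  refine ⟨fun t => (h t).differentiableAt, ?_⟩
  rwa [show deriv (fun t => ∫ s in a..t, g s) = g from funext fun t => (h t).deriv]

/-- A du Bois-Reymond argument: a - a(0) - ∫f is continuous and orthogonal to every smooth g, as one
sees by testing with a primitive of g. -/
theorem sub_eq_integral_of_weak_deriv {T : ℝ} (hT : 0 < T) {a f : ℝ → ℝ}
    (ha : ContinuousOn a (Icc 0 T)) (hf : IntegrableOn f (Ioo 0 T))
    (h : ∀ χ : ℝ → ℝ, ContDiff ℝ ∞ χ →
      χ T * a T - χ 0 * a 0 = ∫ t in Ioo 0 T, (deriv χ t * a t + χ t * f t)) :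
    ∀ t ∈ Icc 0 T, a t - a 0 = ∫ s in (0 : ℝ)..t, f s := by
  have hfi : IntervalIntegrable f volume 0 T := by
    rwa [intervalIntegrable_iff_integrableOn_Ioo_of_le hT.le]
  have hai : IntervalIntegrable a volume 0 T := by
    apply ContinuousOn.intervalIntegrable; rwa [uIcc_of_le hT.le]
  set F : ℝ → ℝ := fun t => ∫ s in (0 : ℝ)..t, f s with hF
  have hFc : ContinuousOn F (Icc 0 T) := by
    have := intervalIntegral.continuousOn_primitive_interval' hfi left_mem_uIcc
    rwa [uIcc_of_le hT.le] at this
  have hFi : IntervalIntegrable F volume 0 T := by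
    apply ContinuousOn.intervalIntegrable; rwa [uIcc_of_le hT.le]
  have key := eq_zero_of_integral_smooth_mul_eq_zero hT (h := fun t => a t - a 0 - F t)
    ((ha.sub continuousOn_const).sub hFc) fun g hg => by
      have hgi : ∀ a b, IntervalIntegrable g volume a b := fun a b =>
        hg.continuous.intervalIntegrable _ _
      set G : ℝ := ∫ s in (0 : ℝ)..T, g s with hG
      -- The constant -G makes this primitive vanish at T, so the only boundary term is G · a(0) = ∫
      -- g · a(0).
      have h1 := h (fun t => -G + ∫ s in (0 : ℝ)..t, g s)
        (contDiff_const.add (contDiff_primitive hg 0))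
      have hd : ∀ t, deriv (fun t => -G + ∫ s in (0 : ℝ)..t, g s) t = g t := fun t =>
        ((intervalIntegral.integral_hasDerivAt_right (hgi _ _)
          hg.continuous.aestronglyMeasurable.stronglyMeasurableAtFilter
          hg.continuous.continuousAt).const_add _).deriv
      have h2 := integral_primitive_mul_add (-G) 0 (hgi 0 T) hfi
      simp only [hd, ← integral_Ioc_eq_integral_Ioo, ← intervalIntegral.integral_of_le hT.le] at h1 ⊢
      simp only [intervalIntegral.integral_same, add_zero, zero_add, ← hG, neg_add_cancel, zero_mul,
        mul_zero, sub_zero] at h1 h2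
      have hgc : Continuous fun t => -G + ∫ s in (0 : ℝ)..t, g s :=
        (contDiff_const.add (contDiff_primitive hg 0)).continuous
      have i1 : IntervalIntegrable (fun t => g t * a t) volume 0 T :=
        hai.continuousOn_mul hg.continuous.continuousOn
      have i2 : IntervalIntegrable (fun t => g t * F t) volume 0 T :=
        hFi.continuousOn_mul hg.continuous.continuousOn
      have i3 : IntervalIntegrable (fun t => (-G + ∫ s in (0 : ℝ)..t, g s) * f t) volume 0 T :=
        hfi.continuousOn_mul hgc.continuousOn
      rw [intervalIntegral.integral_add i1 i3] at h1
      rw [intervalIntegral.integral_add i2 i3] at h2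
      have e : ∀ t, g t * (a t - a 0 - F t) = g t * a t - a 0 * g t - g t * F t := fun t => by ring
      simp only [e]
      rw [intervalIntegral.integral_sub (i1.sub ((hgi 0 T).const_mul _)) i2,
        intervalIntegral.integral_sub i1 ((hgi 0 T).const_mul _),
        intervalIntegral.integral_const_mul]
      linarith
  intro t ht
  have := key t ht
  linarith

theorem sq_sub_sq_eq_integral {t : ℝ} {a f : ℝ → ℝ} (ht : 0 ≤ t)
    (hf : IntervalIntegrable f volume 0 t)
    (h : ∀ s ∈ Icc 0 t, a s - a 0 = ∫ r in (0 : ℝ)..s, f r) :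
    a t ^ 2 - a 0 ^ 2 = 2 * ∫ s in (0 : ℝ)..t, a s * f s := by
  have h1 := integral_primitive_mul_add (a 0) (a 0) hf hf
  rw [← h t ⟨ht, le_rfl⟩] at h1
  rw [← intervalIntegral.integral_const_mul]
  calc a t ^ 2 - a 0 ^ 2 = (a 0 + (a t - a 0)) * (a 0 + (a t - a 0)) - a 0 * a 0 := by ring
    _ = _ := by
      rw [← h1]
      refine intervalIntegral.integral_congr fun s hs => ?_
      rw [uIcc_of_le ht] at hs
      simp only [← h s hs]; ring

/-! ### The mollified Euler equations -/

instance instSFiniteSpaceTime {d : ℕ} {T : ℝ} : SFinite (spaceTime d T) := by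
  unfold spaceTime; infer_instance

/-- Joint integrability in (x,t) justifies exchanging the space and time integrals in the energy
balance. -/
theorem integrable_prod_conv {d : ℕ} {T : ℝ} {L : Torus d → ℝ} (hL : Continuous L)
    {w : ℝ → Torus d → ℝ} (hw : Integrable (fun p : ℝ × Torus d => w p.1 p.2) (spaceTime d T)) :
    Integrable (fun p : Torus d × ℝ => conv L (w p.2) p.1)
      ((volume : Measure (Torus d)).prod (volume.restrict (Ioo 0 T))) := by
  obtain ⟨M, -, hM⟩ := exists_abs_le hL
  have h1 : Integrable (fun p : (Torus d × ℝ) × Torus d => w p.1.2 p.2)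
      (((volume : Measure (Torus d)).prod (volume.restrict (Ioo 0 T))).prod volume) :=
    (measurePreserving_prodAssoc (volume : Measure (Torus d)) (volume.restrict (Ioo 0 T))
      (volume : Measure (Torus d))).integrable_comp_of_integrable (hw.comp_snd volume)
  have h2 : Integrable (fun p : (Torus d × ℝ) × Torus d => L (p.1.1 - p.2) * w p.1.2 p.2)
      (((volume : Measure (Torus d)).prod (volume.restrict (Ioo 0 T))).prod volume) :=
    h1.bdd_mul (c := M) (Continuous.aestronglyMeasurable (by fun_prop))
      (Eventually.of_forall fun p => hM _)
  exact h2.integral_prod_left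

theorem integrable_conv_time {d : ℕ} {T : ℝ} {L : Torus d → ℝ} (hL : Continuous L)
    {w : ℝ → Torus d → ℝ} (hw : Integrable (fun p : ℝ × Torus d => w p.1 p.2) (spaceTime d T))
    (x : Torus d) : IntegrableOn (fun t => conv L (w t) x) (Ioo 0 T) := by
  obtain ⟨M, -, hM⟩ := exists_abs_le hL
  have h2 : Integrable (fun p : ℝ × Torus d => L (x - p.2) * w p.1 p.2) (spaceTime d T) :=
    hw.bdd_mul (c := M) (Continuous.aestronglyMeasurable (by fun_prop))
      (Eventually.of_forall fun p => hM _)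
  exact h2.integral_prod_left

theorem spaceTime_mono {d : ℕ} {t T : ℝ} (h : t ≤ T) : spaceTime d t ≤ spaceTime d T := by
  have e : ∀ s, spaceTime d s =
      ((volume : Measure ℝ).prod (volume : Measure (Torus d))).restrict (Ioo 0 s ×ˢ univ) := fun s => by
    rw [← Measure.prod_restrict, Measure.restrict_univ]; rfl
  rw [e, e]
  exact Measure.restrict_mono (prod_mono (Ioo_subset_Ioo_right h) le_rfl) le_rfl

theorem isSmoothSpaceTime_mul_comp_sub {d : ℕ} {χ : ℝ → ℝ} (hχ : ContDiff ℝ ∞ χ)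
    {K : Torus d → ℝ} (hK : IsSmooth K) (x : Torus d) :
    IsSmoothSpaceTime (fun t y => χ t * K (x - y)) := by
  obtain ⟨z, rfl⟩ := proj_surjective x
  unfold IsSmoothSpaceTime
  have h1 : ∀ p : ℝ × Vec d, proj z - proj p.2 = proj (z - p.2) := fun p => by
    rw [sub_eq_add_neg z, proj_add, proj_neg, sub_eq_add_neg]
  simp only [h1]
  refine (hχ.comp contDiff_fst).mul ?_
  exact ContDiff.comp (g := fun y => K (proj y)) (f := fun p : ℝ × Vec d => z - p.2) hK (by fun_prop)

theorem isSmoothSpaceTime_single {d : ℕ} {ψ : ℝ → Torus d → ℝ} (hψ : IsSmoothSpaceTime ψ)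
    (i : Fin d) : IsSmoothSpaceTime (fun t y => EuclideanSpace.single i (ψ t y)) := by
  unfold IsSmoothSpaceTime at *
  rw [contDiff_euclidean]
  intro j
  by_cases h : j = i
  · subst h; simpa using hψ
  · simpa [h] using contDiff_const

section Solution

variable {d : ℕ} {T : ℝ} {v : ℝ → Torus d → Vec d} {Pr : ℝ → Torus d → ℝ}
  {C ε : ℝ} {K : Torus d → ℝ} {K' : Fin d → Torus d → ℝ}

theorem inner_single_right' (u : Vec d) (i : Fin d) (c : ℝ) :
    inner ℝ u (EuclideanSpace.single i c) = u i * c := by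
  rw [EuclideanSpace.inner_single_right]; simp [mul_comm]

/-- For fixed x the convolution is the L² pairing of v(t) with the bounded field y ↦ L(x - y)eᵢ, so
weak continuity applies. -/
theorem IsWeakSolution.continuousOn_conv (hv : IsWeakSolution T v Pr) {L : Torus d → ℝ}
    (hL : Continuous L) (i : Fin d) (x : Torus d) :
    ContinuousOn (fun t => conv L (fun y => v t y i) x) (Icc 0 T) := by
  have hw : MemLp (fun y : Torus d => (EuclideanSpace.single i (L (x - y)) : Vec d)) 2 volume := by
    obtain ⟨M, -, hM⟩ := exists_abs_le hL
    refine MemLp.of_bound ?_ M (Eventually.of_forall fun y => ?_)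
    · refine Continuous.aestronglyMeasurable ?_
      exact (LinearIsometry.continuous (E := ℝ) (E₂ := Vec d)
        (σ₁₂ := RingHom.id ℝ) ⟨LinearMap.toSpanSingleton ℝ (Vec d) (EuclideanSpace.single i 1),
          fun s => by simp [LinearMap.toSpanSingleton_apply, norm_smul]⟩).comp
        (g := _) (f := fun y => L (x - y)) (by fun_prop) |>.congr fun y => by
          ext j; simp [LinearMap.toSpanSingleton_apply]
    · rw [PiLp.norm_single]; exact hM _
  refine (hv.weak_continuous _ hw).congr fun t _ => ?_
  simp only [inner_single_right', conv]
  congr 1; ext y; ring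

/-- Every pairing t ↦ ⟨v(t), w⟩ is continuous on a compact interval, hence bounded; Banach–Steinhaus
makes the L² norms bounded. The bound holds at every time, which the interpolation later relies on.
-/
theorem IsWeakSolution.exists_bound (hv : IsWeakSolution T v Pr) :
    ∃ M : ℝ≥0∞, M ≠ ⊤ ∧ ∀ t ∈ Icc 0 T, ∫⁻ x, ‖v t x‖ₑ ^ (2 : ℝ) ≤ M := by
  set U : Icc (0 : ℝ) T → Lp (Vec d) 2 (volume : Measure (Torus d)) :=
    fun t => (hv.memLp_two t t.2).toLp (v t) with hU
  have h1 : ∀ w : Lp (Vec d) 2 (volume : Measure (Torus d)), ∃ B, ∀ t : Icc (0 : ℝ) T,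
      ‖innerSL ℝ (U t) w‖ ≤ B := by
    intro w
    obtain ⟨B, hB⟩ := isCompact_Icc.exists_bound_of_continuousOn
      (hv.weak_continuous w (Lp.memLp w))
    refine ⟨B, fun t => ?_⟩
    have h2 := hB t t.2
    rw [innerSL_apply_apply, L2.inner_def]
    refine le_of_eq_of_le ?_ h2
    congr 1
    refine integral_congr_ae ?_
    filter_upwards [(hv.memLp_two t t.2).coeFn_toLp] with x hx
    rw [hU, hx]
  obtain ⟨B, hB⟩ := banach_steinhaus h1
  refine ⟨ENNReal.ofReal B ^ (2 : ℝ), by finiteness, fun t ht => ?_⟩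
  have h3 := hB ⟨t, ht⟩
  rw [innerSL_apply_norm, hU, Lp.norm_toLp] at h3
  have h4 : eLpNorm (v t) 2 volume ≤ ENNReal.ofReal B :=
    (ENNReal.le_ofReal_iff_toReal_le (hv.memLp_two t ht).eLpNorm_ne_top
      (ENNReal.toReal_nonneg.trans h3)).2 h3
  have h5 := eLpNorm_ofReal_rpow (μ := (volume : Measure (Torus d))) (q := 2) two_pos (v t)
  rw [ENNReal.ofReal_ofNat] at h5
  rw [← h5]
  gcongr

theorem IsWeakSolution.memLp_spaceTime (hv : IsWeakSolution T v Pr) :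
    MemLp (fun p : ℝ × Torus d => v p.1 p.2) 2 (spaceTime d T) := by
  obtain ⟨M, hM, hb⟩ := hv.exists_bound
  refine ⟨hv.measurable, ?_⟩
  have h5 := eLpNorm_ofReal_rpow (μ := spaceTime d T) (q := 2) two_pos
    (fun p : ℝ × Torus d => v p.1 p.2)
  rw [ENNReal.ofReal_ofNat] at h5
  rw [← ENNReal.rpow_lt_top_iff_of_pos (y := 2) two_pos, h5, spaceTime,
    lintegral_prod _ (hv.measurable.enorm.pow_const _)]
  calc ∫⁻ t in Ioo 0 T, ∫⁻ x, ‖v t x‖ₑ ^ (2 : ℝ) ≤ ∫⁻ t in Ioo 0 T, M :=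
        setLIntegral_mono' measurableSet_Ioo fun t ht => hb t (Ioo_subset_Icc_self ht)
    _ < ⊤ := by
        rw [setLIntegral_const]
        exact ENNReal.mul_lt_top hM.lt_top measure_Ioo_lt_top

theorem IsWeakSolution.integrable_apply (hv : IsWeakSolution T v Pr) (i : Fin d) :
    Integrable (fun p : ℝ × Torus d => v p.1 p.2 i) (spaceTime d T) := by
  have : IsFiniteMeasure (spaceTime d T) := by unfold spaceTime; infer_instance
  have h := hv.memLp_spaceTime.integrable (by norm_num)
  exact h.mono ((EuclideanSpace.proj (𝕜 := ℝ) i).continuous.comp_aestronglyMeasurable h.1)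
    (Eventually.of_forall fun _ => PiLp.norm_apply_le _ _)

theorem IsWeakSolution.integrable_apply_mul (hv : IsWeakSolution T v Pr) (i j : Fin d) :
    Integrable (fun p : ℝ × Torus d => v p.1 p.2 i * v p.1 p.2 j) (spaceTime d T) := by
  have h : ∀ i, MemLp (fun p : ℝ × Torus d => v p.1 p.2 i) 2 (spaceTime d T) := fun i =>
    hv.memLp_spaceTime.mono ((EuclideanSpace.proj (𝕜 := ℝ) i).continuous.comp_aestronglyMeasurable
      hv.measurable) (Eventually.of_forall fun _ => PiLp.norm_apply_le _ _)
  exact (h i).integrable_mul (h j)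

theorem IsWeakSolution.ae_integrable_pressure (hv : IsWeakSolution T v Pr) :
    ∀ᵐ t ∂volume.restrict (Ioo 0 T), Integrable (Pr t) :=
  hv.pressure_integrable.prod_right_ae

theorem pderiv_const_mul_comp_sub {j : Fin d} {F F' : Torus d → ℝ} (h : HasPDeriv j F F') (c : ℝ)
    (x y : Torus d) : pderiv j (fun y => c * F (x - y)) y = -(c * F' (x - y)) := by
  have h1 := (h.comp_sub_left x y).const_mul c
  have h2 := h1.deriv
  rw [mul_neg] at h2
  exact h2

/-- Testing with g(t)K(x - y) shows that the mollified divergence at x, continuous in time, is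
orthogonal to every smooth g. -/
theorem IsWeakSolution.div_eq_zero (hT : 0 < T) (hv : IsWeakSolution T v Pr)
    (h : IsMollifier C ε K K') {t : ℝ} (ht : t ∈ Icc 0 T) (x : Torus d) :
    ∑ i, conv (K' i) (fun y => v t y i) x = 0 := by
  refine eq_zero_of_integral_smooth_mul_eq_zero hT
    (h := fun t => ∑ i, conv (K' i) (fun y => v t y i) x)
    (continuousOn_finsetSum _ fun i _ => hv.continuousOn_conv (h.cont_deriv i) i x)
    (fun g hg => ?_) t ht
  have h1 := hv.div_free _ (isSmoothSpaceTime_mul_comp_sub hg h.smooth x)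
  rw [← neg_eq_zero, ← integral_neg]
  refine Eq.trans ?_ h1
  refine setIntegral_congr_fun measurableSet_Ioo fun s hs => ?_
  have hs' := hv.memLp_two s (Ioo_subset_Icc_self hs)
  simp only [pderiv_const_mul_comp_sub (h.hasPDeriv _)]
  have e : ∀ i y, v s y i * -(g s * K' i (x - y)) = -g s * (K' i (x - y) * v s y i) :=
    fun i y => by ring
  simp only [e]
  rw [integral_finsetSum _ fun i _ => (integrable_conv (h.cont_deriv i)
    (EulerTorus.integrable_apply hs' i) x).const_mul _]
  rw [← neg_mul, Finset.mul_sum]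
  simp only [integral_const_mul, conv]

/-- The test field χ(t)K(x - y)eᵢ reduces the momentum equation to a weak ordinary differential
equation in time at the fixed point x. -/
theorem IsWeakSolution.conv_sub_eq_integral (hT : 0 < T) (hv : IsWeakSolution T v Pr)
    (h : IsMollifier C ε K K') (i : Fin d) (x : Torus d) {t : ℝ} (ht : t ∈ Icc 0 T) :
    conv K (fun y => v t y i) x - conv K (fun y => v 0 y i) x =
      ∫ s in (0 : ℝ)..t, -((∑ j, conv (K' j) (fun y => v s y i * v s y j) x)
        + conv (K' i) (Pr s) x) := by
  refine sub_eq_integral_of_weak_deriv hT (a := fun t => conv K (fun y => v t y i) x)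
    (hv.continuousOn_conv h.cont i x) ?_ (fun χ hχ => ?_) t ht
  · exact ((integrable_finsetSum _ fun j _ => integrable_conv_time (h.cont_deriv j)
      (hv.integrable_apply_mul i j) x).add
      (integrable_conv_time (h.cont_deriv i) hv.pressure_integrable x)).neg
  have h1 := hv.momentum _ (isSmoothSpaceTime_single
    (isSmoothSpaceTime_mul_comp_sub hχ h.smooth x) i)
  have hd : ∀ s y, deriv (fun r => (EuclideanSpace.single i (χ r * K (x - y)) : Vec d)) s
      = EuclideanSpace.single i (deriv χ s * K (x - y)) := by
    intro s y
    have h2 := ((hχ.differentiable (by simp)) s).hasDerivAt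
    have e : ∀ c : ℝ, (EuclideanSpace.single i (c * K (x - y)) : Vec d)
        = c • EuclideanSpace.single i (K (x - y)) := fun c => by
      ext j; by_cases hj : j = i <;> simp [hj]
    simp only [e]
    exact (h2.smul_const _).deriv
  have hp : ∀ s y (i' j : Fin d), pderiv j (fun z =>
      (EuclideanSpace.single i (χ s * K (x - z)) : Vec d) i') y
      = if i' = i then -(χ s * K' j (x - y)) else 0 := by
    intro s y i' j
    by_cases hi : i' = i
    · simp only [hi, PiLp.single_apply, if_true]
      exact pderiv_const_mul_comp_sub (h.hasPDeriv j) _ _ _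
    · simp [hi, pderiv]
  simp only [inner_single_right', hd, hp] at h1
  have h0T : (0 : ℝ) ∈ Icc 0 T := ⟨le_rfl, hT.le⟩
  have hTT : T ∈ Icc 0 T := ⟨hT.le, le_rfl⟩
  have hvi : ∀ s ∈ Icc 0 T, ∀ c : ℝ, Integrable fun y => v s y i * (c * K (x - y)) := fun s hs c => by
    have := (integrable_conv h.cont (EulerTorus.integrable_apply (hv.memLp_two s hs) i) x).const_mul c
    refine this.congr (Eventually.of_forall fun y => ?_)
    ring
  have hve : ∀ s (c : ℝ), ∫ y, v s y i * (c * K (x - y)) = c * conv K (fun y => v s y i) x :=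
    fun s c => by
      rw [conv, ← integral_const_mul]; congr 1; ext y; ring
  rw [integral_sub (hvi T hTT _) (hvi 0 h0T _), hve, hve] at h1
  rw [h1]
  refine setIntegral_congr_ae measurableSet_Ioo ?_
  have hPi := hv.ae_integrable_pressure
  rw [ae_restrict_iff' measurableSet_Ioo] at hPi
  filter_upwards [hPi] with s hPs hs
  have hs' := Ioo_subset_Icc_self hs
  have hi1 : ∀ j, Integrable fun y => K' j (x - y) * (v s y i * v s y j) := fun j =>
    integrable_conv (h.cont_deriv j) (EulerTorus.integrable_apply_mul (hv.memLp_two s hs') i j) x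
  have hi2 := integrable_conv (h.cont_deriv i) (hPs hs) x
  have e : ∀ y, v s y i * (deriv χ s * K (x - y)) +
        ∑ i', ∑ j, v s y i' * v s y j * (if i' = i then -(χ s * K' j (x - y)) else 0) +
        Pr s y * ∑ i', (if i' = i then -(χ s * K' i' (x - y)) else 0) =
      v s y i * (deriv χ s * K (x - y)) - χ s * ((∑ j, K' j (x - y) * (v s y i * v s y j))
        + K' i (x - y) * Pr s y) := by
    intro y
    have e1 : ∀ i', ∑ j, v s y i' * v s y j * (if i' = i then -(χ s * K' j (x - y)) else 0) =
        if i' = i then ∑ j, v s y i * v s y j * -(χ s * K' j (x - y)) else 0 := fun i' => by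
      by_cases hi : i' = i <;> simp [hi]
    simp only [e1, Finset.sum_ite_eq', Finset.mem_univ, if_true]
    have e2 : ∑ j, v s y i * v s y j * -(χ s * K' j (x - y))
        = -χ s * ∑ j, K' j (x - y) * (v s y i * v s y j) := by
      rw [Finset.mul_sum]; congr 1; ext j; ring
    rw [e2]; ring
  have hi3 : Integrable fun y => (∑ j, K' j (x - y) * (v s y i * v s y j)) + K' i (x - y) * Pr s y :=
    (integrable_finsetSum _ fun j _ => hi1 j).add hi2
  simp only [e]
  rw [integral_sub (hvi s hs' _) (hi3.const_mul _),
    hve, integral_const_mul, integral_add (integrable_finsetSum _ fun j _ => hi1 j) hi2,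
    integral_finsetSum _ fun j _ => hi1 j]
  simp only [conv]
  ring

end Solution

theorem enorm_le_one_add_sq {F : Type*} [NormedAddCommGroup F] (z : F) :
    ‖z‖ₑ ≤ 1 + ‖z‖ₑ ^ (2 : ℝ) := by
  rcases le_total ‖z‖ₑ 1 with h | h
  · exact h.trans le_self_add
  · refine le_trans ?_ le_add_self
    calc ‖z‖ₑ = ‖z‖ₑ ^ (1 : ℝ) := by simp
      _ ≤ _ := ENNReal.rpow_le_rpow_of_exponent_le h (by norm_num)

section Solution

variable {d : ℕ} {T : ℝ} {v : ℝ → Torus d → Vec d} {Pr : ℝ → Torus d → ℝ}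
  {C ε : ℝ} {K : Torus d → ℝ} {K' : Fin d → Torus d → ℝ}

theorem IsWeakSolution.exists_abs_conv_le (hv : IsWeakSolution T v Pr) {L : Torus d → ℝ}
    (hL : Continuous L) :
    ∃ B : ℝ, ∀ t ∈ Icc 0 T, ∀ i x, |conv L (fun y => v t y i) x| ≤ B := by
  obtain ⟨M, hM, hb⟩ := hv.exists_bound
  obtain ⟨N, hN0, hN⟩ := exists_abs_le hL
  refine ⟨N * (1 + M).toReal, fun t ht i x => ?_⟩
  have hi := EulerTorus.integrable_apply (hv.memLp_two t ht) i
  refine (abs_conv_le hN hi x).trans ?_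
  gcongr
  have h1 : ∫ y, |v t y i| = (∫⁻ y, ‖v t y i‖ₑ).toReal :=
    integral_norm_eq_lintegral_enorm hi.1
  rw [h1]
  refine ENNReal.toReal_mono (by finiteness) ?_
  calc ∫⁻ y, ‖v t y i‖ₑ ≤ ∫⁻ y, (1 + ‖v t y‖ₑ ^ (2 : ℝ)) := by
        refine lintegral_mono fun y => (?_ : _ ≤ _).trans (enorm_le_one_add_sq _)
        rw [enorm_le_iff_norm_le]; exact PiLp.norm_apply_le _ _
    _ ≤ 1 + M := by
        rw [lintegral_add_left measurable_const]
        simpa using hb t ht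

/-- At each x the square of the mollified field obeys the chain rule in time. Integrating in x,
exchanging integrals and applying the flux bound at almost every time gives the estimate. The
jointly measurable representative `V` makes the iterated increment integrals meaningful. -/
theorem IsWeakSolution.enorm_energy_sub_le (hT : 0 < T) (hv : IsWeakSolution T v Pr) (hε : 0 < ε)
    (h : IsMollifier C ε K K') {V : ℝ × Torus d → Vec d} (hVm : Measurable V)
    (hV : ∀ᵐ s ∂volume.restrict (Ioo 0 T), v s =ᵐ[volume] fun x => V (s, x)) {t : ℝ}
    (ht : t ∈ Icc 0 T) :
    ‖(∫ x, ∑ i, conv K (fun y => v t y i) x ^ 2) - ∫ x, ∑ i, conv K (fun y => v 0 y i) x ^ 2‖ₑ ≤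
      2 * ((d : ℝ≥0∞) ^ 2 * (2 * ENNReal.ofReal C * ENNReal.ofReal (C / ε)) *
        ∫⁻ s in Ioo 0 T, ∫⁻ x, ∫⁻ y, ‖V (s, x) - V (s, x - proj y)‖ₑ ^ (3 : ℝ) ∂ballAvg d ε) := by
  have h0T : (0 : ℝ) ∈ Icc 0 T := ⟨le_rfl, hT.le⟩
  set a : Fin d → Torus d → ℝ → ℝ := fun i x s => conv K (fun y => v s y i) x with ha
  set f : Fin d → Torus d → ℝ → ℝ := fun i x s =>
    -((∑ j, conv (K' j) (fun y => v s y i * v s y j) x) + conv (K' i) (Pr s) x) with hf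
  have ca : ∀ i, ∀ s ∈ Icc 0 T, Continuous fun x => a i x s := fun i s hs =>
    continuous_conv h.cont (EulerTorus.integrable_apply (hv.memLp_two s hs) i)
  have hmono := spaceTime_mono (d := d) ht.2
  have hfi : ∀ i x, IntegrableOn (f i x) (Ioo 0 t) := fun i x =>
    ((integrable_finsetSum _ fun j _ => integrable_conv_time (h.cont_deriv j)
      ((hv.integrable_apply_mul i j).mono_measure hmono) x).add
      (integrable_conv_time (h.cont_deriv i) (hv.pressure_integrable.mono_measure hmono) x)).neg
  have hfp : ∀ i, Integrable (fun p : Torus d × ℝ => f i p.1 p.2)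
      ((volume : Measure (Torus d)).prod (volume.restrict (Ioo 0 t))) := fun i =>
    ((integrable_finsetSum Finset.univ fun j _ => integrable_prod_conv (h.cont_deriv j)
      (w := fun s y => v s y i * v s y j) ((hv.integrable_apply_mul i j).mono_measure hmono)).add
      (integrable_prod_conv (h.cont_deriv i) (hv.pressure_integrable.mono_measure hmono))).neg
  obtain ⟨B, hB⟩ := hv.exists_abs_conv_le h.cont
  have haf : ∀ i, Integrable (fun p : Torus d × ℝ => a i p.1 p.2 * f i p.1 p.2)
      ((volume : Measure (Torus d)).prod (volume.restrict (Ioo 0 t))) := by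
    intro i
    refine (hfp i).bdd_mul (c := B)
      (integrable_prod_conv h.cont (w := fun s y => v s y i) ((hv.integrable_apply i).mono_measure hmono)).1 ?_
    have : ∀ᵐ s ∂volume.restrict (Ioo 0 t), s ∈ Ioo 0 t := ae_restrict_mem measurableSet_Ioo
    filter_upwards [Measure.quasiMeasurePreserving_snd.ae this] with p hp
    exact hB p.2 ⟨hp.1.le, hp.2.le.trans ht.2⟩ i p.1
  have hafs : Integrable (fun p : Torus d × ℝ => ∑ i, a i p.1 p.2 * f i p.1 p.2)
      ((volume : Measure (Torus d)).prod (volume.restrict (Ioo 0 t))) :=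
    integrable_finsetSum _ fun i _ => haf i
  have hx : ∀ x, ∑ i, a i x t ^ 2 - ∑ i, a i x 0 ^ 2 =
      2 * ∫ s in Ioo 0 t, ∑ i, a i x s * f i x s := by
    intro x
    rw [integral_finsetSum, Finset.mul_sum, ← Finset.sum_sub_distrib]
    · congr 1; ext i
      rw [← integral_Ioc_eq_integral_Ioo, ← intervalIntegral.integral_of_le ht.1]
      refine sq_sub_sq_eq_integral ht.1 ?_ fun s hs => ?_
      · rw [intervalIntegrable_iff_integrableOn_Ioo_of_le ht.1]; exact hfi i x
      · exact hv.conv_sub_eq_integral hT h i x ⟨hs.1, hs.2.trans ht.2⟩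
    · intro i _
      have hac : ContinuousOn (a i x) (Icc 0 T) := hv.continuousOn_conv h.cont i x
      refine (hfi i x).bdd_mul (c := B) ?_ ?_
      · exact (hac.mono ((Ioo_subset_Ioo_right ht.2).trans Ioo_subset_Icc_self)).aestronglyMeasurable
          measurableSet_Ioo
      · filter_upwards [ae_restrict_mem measurableSet_Ioo] with s hs
        exact hB s ⟨hs.1.le, hs.2.le.trans ht.2⟩ i x
  have key : (∫ x, ∑ i, a i x t ^ 2) - ∫ x, ∑ i, a i x 0 ^ 2 =
      2 * ∫ s in Ioo 0 t, ∫ x, ∑ i, a i x s * f i x s := by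
    have c1 := fun i => ca i t ht
    have c0 := fun i => ca i 0 h0T
    rw [← integral_sub (integrable_of_continuous (by fun_prop))
      (integrable_of_continuous (by fun_prop))]
    simp only [hx]
    rw [integral_const_mul, integral_integral_swap hafs]
  rw [key, enorm_mul]
  gcongr
  · simp [Real.enorm_eq_ofReal_abs]
  refine (enorm_integral_le_lintegral_enorm _).trans ?_
  rw [← lintegral_const_mul' _ _ (by finiteness)]
  -- Enlarging (0,t) to (0,T) makes the bound independent of t.
  refine (lintegral_mono_set (Ioo_subset_Ioo_right ht.2)).trans ?_
  refine lintegral_mono_ae ?_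
  filter_upwards [hV, hv.ae_integrable_pressure, ae_restrict_mem measurableSet_Ioo] with s hs hPs hsT
  have hs2 : MemLp (fun x => V (s, x)) 2 volume :=
    (memLp_congr_ae hs).1 (hv.memLp_two s (Ioo_subset_Icc_self hsT))
  have hsm : Measurable fun x => V (s, x) := by fun_prop
  have e1 : ∀ L i, conv L (fun y => v s y i) = conv L (fun y => V (s, y) i) := fun L i =>
    conv_congr (by filter_upwards [hs] with y hy; rw [hy])
  have e2 : ∀ L i j, conv L (fun y => v s y i * v s y j)
      = conv L (fun y => V (s, y) i * V (s, y) j) := fun L i j =>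
    conv_congr (by filter_upwards [hs] with y hy; rw [hy])
  have h3 := h.enorm_flux_le hε hsm hs2 hPs fun x => by
    simp only [← e1]
    exact hv.div_eq_zero hT h (Ioo_subset_Icc_self hsT) x
  refine le_of_eq_of_le ?_ h3
  rw [← enorm_neg, ← integral_neg]
  simp only [ha, hf, e1, e2, mul_neg, Finset.sum_neg_distrib, neg_neg]

end Solution

/-! ### Removing the mollification -/

theorem integral_sq_eq_norm_sq {d : ℕ} {f : Torus d → ℝ} (hf : MemLp f 2 volume) :
    ∫ x, f x ^ 2 = ‖hf.toLp f‖ ^ 2 := by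
  rw [← real_inner_self_eq_norm_sq, L2.inner_def]
  refine integral_congr_ae ?_
  filter_upwards [hf.coeFn_toLp] with x hx
  rw [hx]; simp [sq]

theorem tendsto_eLpNorm_sub_conv {d : ℕ} {C q : ℝ} (hq : 1 ≤ q) {ε : ℕ → ℝ}
    (hε : Tendsto ε atTop (𝓝 0)) {K : ℕ → Torus d → ℝ} {K' : ℕ → Fin d → Torus d → ℝ}
    (h : ∀ n, IsMollifier C (ε n) (K n) (K' n)) {f : Torus d → ℝ} (hfm : Measurable f)
    (hf : MemLp f (ENNReal.ofReal q) volume) :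
    Tendsto (fun n => eLpNorm (fun x => f x - conv (K n) f x) (ENNReal.ofReal q) volume)
      atTop (𝓝 0) := by
  have hq0 : 0 < q := by linarith
  rw [ENNReal.tendsto_nhds_zero]
  intro δ hδ
  have hc : ENNReal.ofReal C ^ (1 / q) ≠ ⊤ := by finiteness
  obtain ⟨δ', hδ', hle⟩ : ∃ δ' : ℝ≥0∞, 0 < δ' ∧ ENNReal.ofReal C ^ (1 / q) * δ' ≤ δ := by
    refine ⟨δ / (ENNReal.ofReal C ^ (1 / q) + 1), ENNReal.div_pos hδ.ne' (by finiteness), ?_⟩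
    calc _ ≤ (ENNReal.ofReal C ^ (1 / q) + 1) * (δ / (ENNReal.ofReal C ^ (1 / q) + 1)) := by
          gcongr; exact le_self_add
      _ ≤ δ := ENNReal.mul_div_le
  obtain ⟨ε₀, hε₀, h0⟩ := exists_eLpNorm_sub_translate_le hq hf hδ'
  filter_upwards [hε.eventually (gt_mem_nhds hε₀)] with n hn
  refine le_trans ((h n).eLpNorm_sub_conv_le hfm (hf.integrable (by simpa using hq)) hq
    fun y hy => h0 y (Metric.ball_subset_ball hn.le hy)) hle

theorem tendsto_integral_conv_sq {d : ℕ} {C : ℝ} {ε : ℕ → ℝ} (hε : Tendsto ε atTop (𝓝 0))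
    {K : ℕ → Torus d → ℝ} {K' : ℕ → Fin d → Torus d → ℝ}
    (h : ∀ n, IsMollifier C (ε n) (K n) (K' n)) {f : Torus d → ℝ} (hf : MemLp f 2 volume) :
    Tendsto (fun n => ∫ x, conv (K n) f x ^ 2) atTop (𝓝 (∫ x, f x ^ 2)) := by
  obtain ⟨g, hgm, hfg⟩ := hf.1
  have hg : MemLp g 2 volume := (memLp_congr_ae hfg).1 hf
  have hgi : Integrable g := hg.integrable (by norm_num)
  have e : ∀ n, conv (K n) f = conv (K n) g := fun n => conv_congr hfg
  have e2 : ∫ x, f x ^ 2 = ∫ x, g x ^ 2 :=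
    integral_congr_ae (by filter_upwards [hfg] with x hx; rw [hx])
  have hcm : ∀ n, MemLp (conv (K n) g) 2 volume := fun n => by
    obtain ⟨M, -, hM⟩ := exists_abs_le (continuous_conv (h n).cont hgi)
    exact MemLp.of_bound (continuous_conv (h n).cont hgi).aestronglyMeasurable M
      (Eventually.of_forall hM)
  simp only [e, e2, integral_sq_eq_norm_sq hg, integral_sq_eq_norm_sq (hcm _)]
  refine (Tendsto.norm ?_).pow 2
  have h1 := tendsto_eLpNorm_sub_conv (q := 2) (by norm_num) hε h hgm.measurable (by simpa using hg)
  rw [ENNReal.ofReal_ofNat] at h1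
  refine (Lp.tendsto_Lp_iff_tendsto_eLpNorm'' _ hcm _ hg).2 (h1.congr fun n => ?_)
  exact eLpNorm_sub_comm g (conv (K n) g) 2 volume

/-- Since v(t) lies in L² at every time, the mollified energies converge at both t and 0. The bound
on their difference is a fixed constant times the quantity assumed to vanish. -/
theorem IsWeakSolution.energy_eq_of_tendsto {d : ℕ} {T : ℝ} {v : ℝ → Torus d → Vec d}
    {Pr : ℝ → Torus d → ℝ} (hT : 0 < T) (hv : IsWeakSolution T v Pr) {V : ℝ × Torus d → Vec d}
    (hVm : Measurable V)
    (hV : ∀ᵐ s ∂volume.restrict (Ioo 0 T), v s =ᵐ[volume] fun x => V (s, x))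
    {ε : ℕ → ℝ} (hε : ∀ n, 0 < ε n) (hε1 : ∀ n, ε n ≤ 1) (hε0 : Tendsto ε atTop (𝓝 0))
    (hD : Tendsto (fun n => (∫⁻ s in Ioo 0 T, ∫⁻ x, ∫⁻ y,
      ‖V (s, x) - V (s, x - proj y)‖ₑ ^ (3 : ℝ) ∂ballAvg d (ε n)) / ENNReal.ofReal (ε n))
      atTop (𝓝 0)) {t : ℝ} (ht : t ∈ Icc 0 T) :
    ∫ x, ‖v t x‖ ^ 2 = ∫ x, ‖v 0 x‖ ^ 2 := by
  obtain ⟨C, hC, hmol⟩ := exists_isMollifier d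
  choose K K' hK using fun n => hmol (ε n) (hε n) (hε1 n)
  have hlim : ∀ s ∈ Icc 0 T, Tendsto (fun n => ∫ x, ∑ i, conv (K n) (fun y => v s y i) x ^ 2) atTop
      (𝓝 (∫ x, ‖v s x‖ ^ 2)) := by
    intro s hs
    have hs2 := hv.memLp_two s hs
    have e1 : ∀ n, ∫ x, ∑ i, conv (K n) (fun y => v s y i) x ^ 2
        = ∑ i, ∫ x, conv (K n) (fun y => v s y i) x ^ 2 := fun n => by
      have c := fun i => continuous_conv (hK n).cont (EulerTorus.integrable_apply hs2 i)
      exact integral_finsetSum _ fun i _ => integrable_of_continuous (by fun_prop)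
    have e2 : ∫ x, ‖v s x‖ ^ 2 = ∑ i, ∫ x, v s x i ^ 2 := by
      rw [← integral_finsetSum _ fun i _ => (memLp_apply hs2 i).integrable_sq]
      congr 1; ext x
      rw [EuclideanSpace.norm_sq_eq]
      simp
    simp only [e1, e2]
    exact tendsto_finsetSum _ fun i _ => tendsto_integral_conv_sq hε0 hK (memLp_apply hs2 i)
  have h1 := (hlim t ht).sub (hlim 0 ⟨le_rfl, hT.le⟩)
  have h2 : Tendsto (fun n => (∫ x, ∑ i, conv (K n) (fun y => v t y i) x ^ 2)
      - ∫ x, ∑ i, conv (K n) (fun y => v 0 y i) x ^ 2) atTop (𝓝 0) := by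
    rw [tendsto_zero_iff_enorm_tendsto_zero]
    have h3 := ENNReal.Tendsto.const_mul (a := 2 * ((d : ℝ≥0∞) ^ 2 * (2 * ENNReal.ofReal C *
      ENNReal.ofReal C))) hD (Or.inr (by finiteness))
    rw [mul_zero] at h3
    refine tendsto_of_tendsto_of_tendsto_of_le_of_le tendsto_const_nhds h3 (fun _ => zero_le)
      fun n => (hv.enorm_energy_sub_le hT (hε n) (hK n) hVm hV ht).trans_eq ?_
    rw [ENNReal.ofReal_div_of_pos (hε n), div_eq_mul_inv, div_eq_mul_inv]
    ring
  exact sub_eq_zero.1 (tendsto_nhds_unique h1 h2)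

/-! ### Interpolation and the two Besov conditions -/

/-- Hölder with weights (p-1)/2 and (3-p)/2, which sum to 1. With r = 2p/(p-1) one has r(p-1)/2 +
(3-p) = 3 and p/r = (p-1)/2. -/
theorem lintegral_rpow_three_le {α : Type*} [MeasurableSpace α] {μ : Measure α} {F : α → ℝ≥0∞}
    (hF : AEMeasurable F μ) {p : ℝ} (hp1 : 1 < p) (hp3 : p ≤ 3) :
    ∫⁻ a, F a ^ (3 : ℝ) ∂μ ≤ (∫⁻ a, F a ^ (2 * p / (p - 1)) ∂μ) ^ (p / (2 * p / (p - 1))) *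
      (∫⁻ a, F a ^ (2 : ℝ) ∂μ) ^ ((3 - p) / 2) := by
  have hp0 : p - 1 ≠ 0 := by linarith
  have hp00 : p ≠ 0 := by linarith
  have e : p / (2 * p / (p - 1)) = (p - 1) / 2 := by field_simp
  have h := ENNReal.lintegral_mul_norm_pow_le (hF.pow_const (2 * p / (p - 1)))
    (hF.pow_const (2 : ℝ)) (p := (p - 1) / 2) (q := (3 - p) / 2) (by linarith) (by linarith) (by ring)
  rw [e]
  refine le_trans (lintegral_mono fun a => le_of_eq ?_) h
  rw [← ENNReal.rpow_mul, ← ENNReal.rpow_mul, ← ENNReal.rpow_add_of_nonneg]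
  · congr 1; field_simp; ring
  · have : 0 < p - 1 := by linarith
    positivity
  · linarith

theorem enorm_sub_sq_le {F : Type*} [NormedAddCommGroup F] (a b : F) :
    ‖a - b‖ₑ ^ (2 : ℝ) ≤ 2 * (‖a‖ₑ ^ (2 : ℝ) + ‖b‖ₑ ^ (2 : ℝ)) := by
  have h := ENNReal.rpow_add_le_mul_rpow_add_rpow ‖a‖ₑ ‖b‖ₑ (p := 2) (by norm_num)
  rw [show (2 : ℝ) - 1 = 1 by norm_num, ENNReal.rpow_one] at h
  refine le_trans ?_ h
  gcongr
  exact enorm_sub_le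

theorem lintegral_enorm_sub_translate_sq_le {d : ℕ} {u : Torus d → Vec d} (hu : Measurable u)
    {M : ℝ≥0∞} (hM : ∫⁻ x, ‖u x‖ₑ ^ (2 : ℝ) ≤ M) (z : Torus d) :
    ∫⁻ x, ‖u x - u (x - z)‖ₑ ^ (2 : ℝ) ≤ 4 * M := by
  calc ∫⁻ x, ‖u x - u (x - z)‖ₑ ^ (2 : ℝ)
      ≤ ∫⁻ x, 2 * (‖u x‖ₑ ^ (2 : ℝ) + ‖u (x - z)‖ₑ ^ (2 : ℝ)) :=
        lintegral_mono fun x => enorm_sub_sq_le _ _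
    _ = 2 * ((∫⁻ x, ‖u x‖ₑ ^ (2 : ℝ)) + ∫⁻ x, ‖u x‖ₑ ^ (2 : ℝ)) := by
        rw [lintegral_const_mul _ (by fun_prop), lintegral_add_left (by fun_prop),
          lintegral_sub_right_eq_self (fun x => ‖u x‖ₑ ^ (2 : ℝ)) z]
    _ ≤ 2 * (M + M) := by gcongr
    _ = 4 * M := by ring

/-- For each y the shift preserves Haar measure, so (x,y) ↦ x - y pulls null sets back to null sets,
whatever the measure in y. Increments may thus be computed with any representative. -/
theorem ae_ae_sub_proj {d : ℕ} {ν : Measure (Vec d)} [SFinite ν] {P : Torus d → Prop}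
    (h : ∀ᵐ x, P x) : ∀ᵐ x, ∀ᵐ y ∂ν, P (x - proj y) := by
  have hq : Measure.QuasiMeasurePreserving (fun p : Torus d × Vec d => p.1 - proj p.2)
      ((volume : Measure (Torus d)).prod ν) volume :=
    QuasiMeasurePreserving.prod_of_left (by have := measurable_proj (d := d); fun_prop)
      (Eventually.of_forall fun y =>
        (measurePreserving_sub_right volume (proj y)).quasiMeasurePreserving)
  exact Measure.ae_ae_of_ae_prod (hq.ae h)

theorem lintegral_increment_congr {d : ℕ} {F : Type*} [NormedAddCommGroup F]
    {ν : Measure (Vec d)} [SFinite ν] {u w : Torus d → F} (h : u =ᵐ[volume] w) (r : ℝ) :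
    ∫⁻ x, ∫⁻ y, ‖u x - u (x - proj y)‖ₑ ^ r ∂ν = ∫⁻ x, ∫⁻ y, ‖w x - w (x - proj y)‖ₑ ^ r ∂ν := by
  refine lintegral_congr_ae ?_
  filter_upwards [h, ae_ae_sub_proj (ν := ν) h] with x hx hxy
  refine lintegral_congr_ae ?_
  filter_upwards [hxy] with y hy
  rw [hx, hy]

section Solution

variable {d : ℕ} {T : ℝ} {v : ℝ → Torus d → Vec d} {Pr : ℝ → Torus d → ℝ} {p : ℝ}

theorem IsWeakSolution.exists_representative (hv : IsWeakSolution T v Pr) :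
    ∃ V : ℝ × Torus d → Vec d, Measurable V ∧
      (∀ᵐ s ∂volume.restrict (Ioo 0 T), v s =ᵐ[volume] fun x => V (s, x)) ∧
      ∃ M : ℝ≥0∞, M ≠ ⊤ ∧
        ∀ᵐ s ∂volume.restrict (Ioo 0 T), ∫⁻ x, ‖V (s, x)‖ₑ ^ (2 : ℝ) ≤ M := by
  obtain ⟨V, hVm, hV⟩ := hv.measurable
  have hV' : ∀ᵐ s ∂volume.restrict (Ioo 0 T), v s =ᵐ[volume] fun x => V (s, x) :=
    Measure.ae_ae_of_ae_prod hV
  obtain ⟨M, hM, hb⟩ := hv.exists_bound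
  refine ⟨V, hVm.measurable, hV', M, hM, ?_⟩
  filter_upwards [hV', ae_restrict_mem measurableSet_Ioo] with s hs hsT
  refine (lintegral_congr_ae ?_).trans_le (hb s (Ioo_subset_Icc_self hsT))
  filter_upwards [hs] with x hx
  rw [hx]

/-- Energy conservation under a vanishing condition on averaged increments. -/
theorem IsWeakSolution.energy_eq_of_averaged_increments (hT : 0 < T) (hv : IsWeakSolution T v Pr)
    (hp1 : 1 < p) (hp3 : p ≤ 3) {ε : ℕ → ℝ} (hε : ∀ n, 0 < ε n) (hε1 : ∀ n, ε n ≤ 1)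
    (hε0 : Tendsto ε atTop (𝓝 0))
    (h : Tendsto (fun n => (∫⁻ s in Ioo 0 T, (∫⁻ x, ∫⁻ y,
      ‖v s x - v s (x - proj y)‖ₑ ^ (2 * p / (p - 1)) ∂ballAvg d (ε n)) ^ (p / (2 * p / (p - 1))))
        / ENNReal.ofReal (ε n)) atTop (𝓝 0)) {t : ℝ} (ht : t ∈ Icc 0 T) :
    ∫ x, ‖v t x‖ ^ 2 = ∫ x, ‖v 0 x‖ ^ 2 := by
  obtain ⟨V, hVm, hV, M, hM, hb⟩ := hv.exists_representative
  have hpm := measurable_proj (d := d)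
  refine hv.energy_eq_of_tendsto hT hVm hV hε hε1 hε0 ?_ ht
  have hc : (4 * M) ^ ((3 - p) / 2) ≠ ⊤ :=
    ENNReal.rpow_ne_top_of_nonneg (by linarith) (by finiteness)
  have h3 := ENNReal.Tendsto.const_mul (a := (4 * M) ^ ((3 - p) / 2)) h (Or.inr hc)
  rw [mul_zero] at h3
  refine tendsto_of_tendsto_of_tendsto_of_le_of_le tendsto_const_nhds h3 (fun _ => zero_le)
    fun n => ?_
  have hprob := isProbabilityMeasure_ballAvg (d := d) (hε n)
  simp only
  rw [← mul_div_assoc, ← lintegral_const_mul' _ _ hc]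
  refine ENNReal.div_le_div_right (lintegral_mono_ae ?_) _
  filter_upwards [hV, hb] with s hs hbs
  rw [lintegral_increment_congr hs, mul_comm]
  have hm : Measurable fun q : Torus d × Vec d => ‖V (s, q.1) - V (s, q.1 - proj q.2)‖ₑ := by
    fun_prop
  -- Interpolation on the product of the torus with the ball keeps the average over y inside the
  -- power p/r, as the VMO condition does.
  have h4 := lintegral_rpow_three_le (μ := (volume : Measure (Torus d)).prod (ballAvg d (ε n)))
    hm.aemeasurable hp1 hp3
  rw [lintegral_prod _ (by fun_prop), lintegral_prod _ (by fun_prop),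
    lintegral_prod _ (by fun_prop)] at h4
  refine h4.trans ?_
  gcongr
  rw [lintegral_lintegral_swap (by fun_prop)]
  calc _ ≤ ∫⁻ _, 4 * M ∂ballAvg d (ε n) := lintegral_mono fun y =>
        lintegral_enorm_sub_translate_sq_le (u := fun x => V (s, x)) (by fun_prop) hbs (proj y)
    _ = 4 * M := by simp

theorem mixedNorm_rpow {F : Type*} [NormedAddCommGroup F] {q : ℝ} (hp : 0 < p)
    (f : ℝ → Torus d → F) :
    mixedNorm T p q f ^ p = ∫⁻ t in Ioo (0 : ℝ) T, (∫⁻ x, ‖f t x‖ₑ ^ q) ^ (p / q) := by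
  rw [mixedNorm, ← ENNReal.rpow_mul, one_div_mul_cancel hp.ne', ENNReal.rpow_one]

theorem div_ofReal_rpow_rpow (hp : 0 < p) (a : ℝ≥0∞) {s : ℝ} (hs : 0 < s) :
    (a / ENNReal.ofReal (s ^ (1 / p))) ^ p = a ^ p / ENNReal.ofReal s := by
  rw [ENNReal.div_rpow_of_nonneg _ _ hp.le, ← ENNReal.ofReal_rpow_of_pos hs, ← ENNReal.rpow_mul,
    one_div_mul_cancel hp.ne', ENNReal.rpow_one]

theorem tendsto_rpow_zero {ι : Type*} {l : Filter ι} (hp : 0 < p) {f : ι → ℝ≥0∞}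
    (h : Tendsto f l (𝓝 0)) : Tendsto (fun i => f i ^ p) l (𝓝 0) := by
  have := (ENNReal.continuous_rpow_const (y := p)).tendsto 0
  rw [ENNReal.zero_rpow_of_pos hp] at this
  exact this.comp h

theorem IsWeakSolution.energy_eq_of_memLpBesovVMO (hT : 0 < T) (hv : IsWeakSolution T v Pr)
    (hp1 : 1 < p) (hp3 : p ≤ 3) (h : MemLpBesovVMO T p (1 / p) (2 * p / (p - 1)) v) {t : ℝ}
    (ht : t ∈ Icc 0 T) : ∫ x, ‖v t x‖ ^ 2 = ∫ x, ‖v 0 x‖ ^ 2 := by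
  have hp0 : 0 < p := by linarith
  have hpos : ∀ n : ℕ, (0 : ℝ) < 1 / ((n : ℝ) + 1) := fun n => by positivity
  have hlim := tendsto_one_div_add_atTop_nhds_zero_nat (𝕜 := ℝ)
  refine hv.energy_eq_of_averaged_increments hT hp1 hp3 (ε := fun n => 1 / ((n : ℝ) + 1)) hpos
    (fun n => ?_) hlim ?_ ht
  · rw [div_le_one (by positivity)]; linarith [n.cast_nonneg (α := ℝ)]
  have h1 := tendsto_rpow_zero hp0 (h.2.comp
    (tendsto_nhdsWithin_iff.2 ⟨hlim, Eventually.of_forall hpos⟩))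
  refine h1.congr fun n => ?_
  simp only [Function.comp]
  rw [div_ofReal_rpow_rpow hp0 _ (hpos n), ← ENNReal.rpow_mul, one_div_mul_cancel hp0.ne',
    ENNReal.rpow_one]
  simp only [setLAverage_ball_eq]

/-- As p ≤ r, the power p/r is concave and Jensen goes the wrong way for moving the ball average out
of it. The interpolation is therefore done for each fixed y, and the average over y is taken
afterwards. -/
theorem IsWeakSolution.energy_eq_of_memLpBesovC (hT : 0 < T) (hv : IsWeakSolution T v Pr)
    (hp1 : 1 < p) (hp3 : p ≤ 3) (h : MemLpBesovC T p (1 / p) (2 * p / (p - 1)) v) {t : ℝ}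
    (ht : t ∈ Icc 0 T) : ∫ x, ‖v t x‖ ^ 2 = ∫ x, ‖v 0 x‖ ^ 2 := by
  have hp0 : 0 < p := by linarith
  have hpos : ∀ n : ℕ, (0 : ℝ) < 1 / ((n : ℝ) + 1) := fun n => by positivity
  have hlim := tendsto_one_div_add_atTop_nhds_zero_nat (𝕜 := ℝ)
  obtain ⟨V, hVm, hV, M, hM, hb⟩ := hv.exists_representative
  have hpm := measurable_proj (d := d)
  refine hv.energy_eq_of_tendsto hT hVm hV (ε := fun n => 1 / ((n : ℝ) + 1)) hpos
    (fun n => ?_) hlim ?_ ht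
  · rw [div_le_one (by positivity)]; linarith [n.cast_nonneg (α := ℝ)]
  set r : ℝ := 2 * p / (p - 1) with hr
  have hr0 : 0 < r := div_pos (by linarith) (by linarith)
  set c : ℝ≥0∞ := (4 * M) ^ ((3 - p) / 2) with hc
  have hcT : c ≠ ⊤ := ENNReal.rpow_ne_top_of_nonneg (by linarith) (by finiteness)
  set J : Vec d → ℝ≥0∞ := fun y =>
    ∫⁻ s in Ioo (0 : ℝ) T, (∫⁻ x, ‖V (s, x) - V (s, x - proj y)‖ₑ ^ r) ^ (p / r) with hJ
  have hJ' : ∀ y : Vec d, mixedNorm T p r (fun t x => v t (x + proj (-y)) - v t x) ^ p = J y := by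
    intro y
    rw [mixedNorm_rpow hp0]
    refine lintegral_congr_ae ?_
    filter_upwards [hV] with s hs
    congr 1
    refine lintegral_congr_ae ?_
    filter_upwards [hs, (measurePreserving_sub_right volume (proj y)).quasiMeasurePreserving.ae hs]
      with x hx hxy
    rw [proj_neg, ← sub_eq_add_neg, hx, hxy, enorm_sub_rev]
  have hlim2 : Tendsto (fun y => J y / ENNReal.ofReal ‖y‖) (𝓝[≠] (0 : Vec d)) (𝓝 0) := by
    have hneg : Tendsto (fun y : Vec d => -y) (𝓝[≠] 0) (𝓝[≠] 0) := by
      refine tendsto_nhdsWithin_iff.2 ⟨?_, ?_⟩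
      · simpa using (continuous_neg.tendsto (0 : Vec d)).mono_left nhdsWithin_le_nhds
      · filter_upwards [self_mem_nhdsWithin] with y hy
        simpa using hy
    refine (tendsto_rpow_zero hp0 (h.2.comp hneg)).congr' ?_
    filter_upwards [self_mem_nhdsWithin] with y hy
    simp only [Function.comp]
    rw [div_ofReal_rpow_rpow hp0 _ (norm_pos_iff.2 (neg_ne_zero.2 hy)), hJ', norm_neg]
  rw [ENNReal.tendsto_nhds_zero] at hlim2 ⊢
  intro δ hδ
  obtain ⟨η, hη, hηδ⟩ : ∃ η : ℝ≥0∞, 0 < η ∧ c * η ≤ δ := by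
    refine ⟨δ / (c + 1), ENNReal.div_pos hδ.ne' (by finiteness), ?_⟩
    calc _ ≤ (c + 1) * (δ / (c + 1)) := by gcongr; exact le_self_add
      _ ≤ δ := ENNReal.mul_div_le
  obtain ⟨ε₀, hε₀, h0⟩ := Metric.mem_nhdsWithin_iff.1 (hlim2 η hη)
  filter_upwards [hlim.eventually (gt_mem_nhds hε₀)] with n hn
  set e : ℝ := 1 / ((n : ℝ) + 1) with he
  have hprob := isProbabilityMeasure_ballAvg (d := d) (hpos n)
  have hJle : ∀ y ∈ Metric.ball (0 : Vec d) e, J y ≤ η * ENNReal.ofReal e := by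
    intro y hy
    -- The limit concerns a punctured neighbourhood only; at y = 0 the increment is identically
    -- zero.
    by_cases hy0 : y = 0
    · have : J y = 0 := by
        simp only [hJ, hy0, proj_zero, sub_zero, sub_self, enorm_zero]
        rw [ENNReal.zero_rpow_of_pos hr0]
        simp [ENNReal.zero_rpow_of_pos (div_pos hp0 hr0)]
      rw [this]; exact zero_le
    · have h1 : J y / ENNReal.ofReal ‖y‖ ≤ η :=
        h0 ⟨Metric.ball_subset_ball hn.le hy, hy0⟩
      rw [ENNReal.div_le_iff (by simpa using hy0) ENNReal.ofReal_ne_top] at h1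
      refine h1.trans ?_
      gcongr
      rw [mem_ball_zero_iff] at hy
      exact hy.le
  rw [ENNReal.div_le_iff (ENNReal.ofReal_pos.2 (hpos n)).ne' ENNReal.ofReal_ne_top]
  calc ∫⁻ s in Ioo 0 T, ∫⁻ x, ∫⁻ y, ‖V (s, x) - V (s, x - proj y)‖ₑ ^ (3 : ℝ) ∂ballAvg d e
      = ∫⁻ s in Ioo 0 T, ∫⁻ y, (∫⁻ x, ‖V (s, x) - V (s, x - proj y)‖ₑ ^ (3 : ℝ)) ∂ballAvg d e := by
        refine lintegral_congr fun s => ?_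
        rw [lintegral_lintegral_swap (by fun_prop)]
    _ = ∫⁻ y, (∫⁻ s in Ioo 0 T, ∫⁻ x, ‖V (s, x) - V (s, x - proj y)‖ₑ ^ (3 : ℝ)) ∂ballAvg d e := by
        refine lintegral_lintegral_swap (Measurable.aemeasurable ?_)
        exact Measurable.lintegral_prod_right' (f := fun q : (ℝ × Vec d) × Torus d =>
          ‖V (q.1.1, q.2) - V (q.1.1, q.2 - proj q.1.2)‖ₑ ^ (3 : ℝ)) (by fun_prop)
    _ ≤ ∫⁻ y, c * (η * ENNReal.ofReal e) ∂ballAvg d e := by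
        refine lintegral_mono_ae (ae_ballAvg_of_forall fun y hy => ?_)
        refine le_trans ?_ (mul_le_mul_right (hJle y hy) c)
        rw [← lintegral_const_mul' _ _ hcT]
        refine lintegral_mono_ae ?_
        filter_upwards [hb] with s hbs
        refine (lintegral_rpow_three_le (by fun_prop) hp1 hp3).trans ?_
        rw [mul_comm, hc]
        gcongr
        exact lintegral_enorm_sub_translate_sq_le (u := fun x => V (s, x)) (by fun_prop) hbs _
    _ = c * η * ENNReal.ofReal e := by rw [lintegral_const, measure_univ, mul_one, mul_assoc]
    _ ≤ _ := by gcongr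

end Solution

/-! ### From a gradient in L^q to fractional increments in L^r -/

section Increments

variable {d : ℕ} {q r : ℝ}

theorem eLpNorm_sub_triangle {a b c : Torus d → ℝ} (hq : 1 ≤ q) (ha : Measurable a)
    (hb : Measurable b) (hc : Measurable c) :
    eLpNorm (fun x => a x - c x) (ENNReal.ofReal q) volume ≤
      eLpNorm (fun x => a x - b x) (ENNReal.ofReal q) volume +
        eLpNorm (fun x => b x - c x) (ENNReal.ofReal q) volume := by
  have h := eLpNorm_add_le (μ := (volume : Measure (Torus d))) (p := ENNReal.ofReal q)
    (f := fun x => a x - b x) (g := fun x => b x - c x) (by fun_prop) (by fun_prop)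
    (by simpa using hq)
  refine le_of_eq_of_le ?_ h
  congr 1; ext x; simp

theorem eLpNorm_comp_sub {f : Torus d → ℝ} (hf : Measurable f) (z : Torus d) (p : ℝ≥0∞) :
    eLpNorm (fun x => f (x - z)) p volume = eLpNorm f p volume :=
  eLpNorm_comp_measurePreserving (g := f) hf.aestronglyMeasurable (measurePreserving_sub_right volume z)

theorem measurable_comp_sub {f : Torus d → ℝ} (hf : Measurable f) (z : Torus d) :
    Measurable fun x => f (x - z) := by fun_prop

theorem eLpNorm_increment_add_le {f : Torus d → ℝ} (hf : Measurable f) (hq : 1 ≤ q)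
    (y z : Torus d) :
    eLpNorm (fun x => f x - f (x - (y + z))) (ENNReal.ofReal q) volume ≤
      eLpNorm (fun x => f x - f (x - y)) (ENNReal.ofReal q) volume +
        eLpNorm (fun x => f x - f (x - z)) (ENNReal.ofReal q) volume := by
  refine (eLpNorm_sub_triangle hq hf (measurable_comp_sub hf y)
    (measurable_comp_sub hf (y + z))).trans_eq ?_
  congr 1
  rw [← eLpNorm_comp_sub (f := fun x => f x - f (x - z)) (by fun_prop) y]
  simp only [sub_sub]

/-- The fundamental theorem of calculus along the segment, then Jensen in its parameter and
translation invariance in x. -/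
theorem HasPDeriv.eLpNorm_increment_le {j : Fin d} {F F' : Torus d → ℝ} (h : HasPDeriv j F F')
    (hF' : Continuous F') (hq : 1 ≤ q) (s : ℝ) :
    eLpNorm (fun x => F x - F (x - proj (EuclideanSpace.single j s))) (ENNReal.ofReal q) volume ≤
      ENNReal.ofReal |s| * eLpNorm F' (ENNReal.ofReal q) volume := by
  have hq0 : 0 < q := by linarith
  have hF'm : Measurable F' := hF'.measurable
  have hsc : Continuous fun t : ℝ => (EuclideanSpace.single j (t * s) : Vec d) := by
    have : (fun t : ℝ => (EuclideanSpace.single j (t * s) : Vec d))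
        = fun t => t • EuclideanSpace.single j s := by
      ext t i; by_cases hi : i = j <;> simp [hi]
    rw [this]; fun_prop
  have hpc : Continuous fun t : ℝ => proj (EuclideanSpace.single j (t * s) : Vec d) :=
    continuous_proj.comp hsc
  obtain ⟨Z, hZ⟩ : ∃ Z : ℝ → Torus d, Z = fun t => proj (EuclideanSpace.single j (t * s)) := ⟨_, rfl⟩
  have hZc : Continuous Z := hZ ▸ hpc
  have hZm := hZc.measurable
  have e0 : proj (EuclideanSpace.single j (0 : ℝ) : Vec d) = 0 := by
    rw [← proj_zero]; congr 1; ext i; simp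
  have hZ0 : Z 0 = 0 := by simp only [hZ, zero_mul, e0]
  have hZ1 : proj (EuclideanSpace.single j s) = Z 1 := by simp only [hZ, one_mul]
  rw [hZ1]
  have hbound : ∀ x, ‖F x - F (x - Z 1)‖ₑ ≤
      ENNReal.ofReal |s| * ∫⁻ t in Ioc (0 : ℝ) 1, ‖F' (x - Z 1 + Z t)‖ₑ := by
    intro x
    set z := x - Z 1 with hz
    have h1 : ∀ t ∈ uIcc (0 : ℝ) 1, HasDerivAt (fun t => F (z + Z t)) (F' (z + Z t) * s) t := by
      intro t _
      simp only [hZ]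
      exact HasDerivAt.comp (𝕜 := ℝ) t (h₂ := fun r : ℝ => F (z + proj (EuclideanSpace.single j r)))
        (h := fun t : ℝ => t * s) (h.hasDerivAt z (t * s))
        (by simpa using (hasDerivAt_id t).mul_const s)
    have h2 := intervalIntegral.integral_eq_sub_of_hasDerivAt h1
      (Continuous.intervalIntegrable (by fun_prop) _ _)
    rw [hZ0, add_zero] at h2
    rw [show F x = F (z + Z 1) by rw [hz, sub_add_cancel], ← h2,
      intervalIntegral.integral_of_le zero_le_one, integral_mul_const, enorm_mul, mul_comm,
      Real.enorm_eq_ofReal_abs s]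
    gcongr
    exact enorm_integral_le_lintegral_enorm _
  have h3 : ∫⁻ x, ‖F x - F (x - Z 1)‖ₑ ^ q ≤ ENNReal.ofReal |s| ^ q * ∫⁻ x, ‖F' x‖ₑ ^ q := by
    calc _ ≤ ∫⁻ x, ENNReal.ofReal |s| ^ q * ∫⁻ t in Ioc (0 : ℝ) 1, ‖F' (x - Z 1 + Z t)‖ₑ ^ q := by
          refine lintegral_mono fun x => ?_
          refine (ENNReal.rpow_le_rpow (hbound x) hq0.le).trans ?_
          rw [ENNReal.mul_rpow_of_nonneg _ _ hq0.le]
          gcongr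
          have := rpow_lintegral_mul_le (μ := volume.restrict (Ioc (0 : ℝ) 1)) (w := fun _ => 1)
            (F := fun t => ‖F' (x - Z 1 + Z t)‖ₑ) (by fun_prop)
            (Measurable.aemeasurable (by fun_prop)) (by simp) hq
          simpa using this
      _ = ENNReal.ofReal |s| ^ q * ∫⁻ t in Ioc (0 : ℝ) 1, ∫⁻ x, ‖F' x‖ₑ ^ q := by
          rw [lintegral_const_mul' _ _ (by finiteness),
            lintegral_lintegral_swap (Measurable.aemeasurable (by fun_prop))]
          congr 1
          refine lintegral_congr fun t => ?_
          have := lintegral_sub_right_eq_self (μ := (volume : Measure (Torus d)))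
            (fun x => ‖F' x‖ₑ ^ q) (Z 1 - Z t)
          simpa only [sub_sub_eq_add_sub, add_sub_right_comm] using this
      _ = _ := by simp
  rw [eLpNorm_ofReal_eq hq0, eLpNorm_ofReal_eq hq0]
  calc _ ≤ (ENNReal.ofReal |s| ^ q * ∫⁻ x, ‖F' x‖ₑ ^ q) ^ (1 / q) := by gcongr
    _ = _ := by
      rw [ENNReal.mul_rpow_of_nonneg _ _ (by positivity), ← ENNReal.rpow_mul,
        mul_one_div_cancel hq0.ne', ENNReal.rpow_one]

/-- All mollifications of `g` are the gradients of those of `f`. -/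
def HasMollifiedGradient (f : Torus d → ℝ) (g : Fin d → Torus d → ℝ) : Prop :=
  ∀ (C ε : ℝ) (K : Torus d → ℝ) (K' : Fin d → Torus d → ℝ), IsMollifier C ε K K' →
    ∀ j x, conv (K' j) f x = conv K (g j) x

theorem exists_seq_tendsto_conv {C : ℝ} {ε : ℕ → ℝ} (hε : Tendsto ε atTop (𝓝 0))
    {K : ℕ → Torus d → ℝ} {K' : ℕ → Fin d → Torus d → ℝ}
    (h : ∀ n, IsMollifier C (ε n) (K n) (K' n)) {f : Torus d → ℝ} (hfm : Measurable f)
    (hf : Integrable f) : ∃ ns : ℕ → ℕ, StrictMono ns ∧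
      ∀ᵐ x, Tendsto (fun n => conv (K (ns n)) f x) atTop (𝓝 (f x)) := by
  have h1 := tendsto_eLpNorm_sub_conv (q := 1) le_rfl hε h hfm (by simpa using memLp_one_iff_integrable.2 hf)
  rw [ENNReal.ofReal_one] at h1
  refine (tendstoInMeasure_of_tendsto_eLpNorm (p := 1) one_ne_zero
    (fun n => (continuous_conv (h n).cont hf).aestronglyMeasurable) hf.1
    (h1.congr fun n => eLpNorm_sub_comm f (conv (K n) f) 1 volume)).exists_seq_tendsto_ae

theorem exists_isMollifier_seq (d : ℕ) : ∃ C : ℝ, 0 < C ∧ ∀ ε : ℕ → ℝ, (∀ n, 0 < ε n) →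
    (∀ n, ε n ≤ 1) → ∃ (K : ℕ → Torus d → ℝ) (K' : ℕ → Fin d → Torus d → ℝ),
      ∀ n, IsMollifier C (ε n) (K n) (K' n) := by
  obtain ⟨C, hC, hmol⟩ := exists_isMollifier d
  refine ⟨C, hC, fun ε h0 h1 => ?_⟩
  choose K K' hK using fun n => hmol (ε n) (h0 n) (h1 n)
  exact ⟨K, K', hK⟩

/-- The bound for smooth functions applies to the mollifications, whose derivatives are
mollifications of g and hence no larger in L^q. Fatou's lemma along an almost everywhere convergent
subsequence passes it to f. -/
theorem HasMollifiedGradient.eLpNorm_increment_single_le {f : Torus d → ℝ} {g : Fin d → Torus d → ℝ}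
    (h : HasMollifiedGradient f g) (hfm : Measurable f) (hf : Integrable f)
    (hgm : ∀ j, Measurable (g j)) (hq : 1 ≤ q) (j : Fin d) (s : ℝ) :
    eLpNorm (fun x => f x - f (x - proj (EuclideanSpace.single j s))) (ENNReal.ofReal q) volume ≤
      ENNReal.ofReal |s| * eLpNorm (g j) (ENNReal.ofReal q) volume := by
  obtain ⟨C, hC, hmol⟩ := exists_isMollifier_seq d
  have hlim := tendsto_one_div_add_atTop_nhds_zero_nat (𝕜 := ℝ)
  obtain ⟨K, K', hK⟩ := hmol (fun n => 1 / ((n : ℝ) + 1)) (fun n => by positivity) fun n => by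
    rw [div_le_one (by positivity)]; linarith [n.cast_nonneg (α := ℝ)]
  obtain ⟨ns, -, hns⟩ := exists_seq_tendsto_conv hlim hK hfm hf
  set z := proj (EuclideanSpace.single j s : Vec d) with hz
  have hcm : ∀ n, Measurable (conv (K n) f) := fun n => (continuous_conv (hK n).cont hf).measurable
  refine (Lp.eLpNorm_lim_le_liminf_eLpNorm
    (f := fun n x => conv (K (ns n)) f x - conv (K (ns n)) f (x - z))
    (fun n => by have := hcm (ns n); fun_prop) _ ?_).trans ?_
  · filter_upwards [hns, (measurePreserving_sub_right volume z).quasiMeasurePreserving.ae hns]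
      with x h1 h2 using h1.sub h2
  · refine liminf_le_of_le (by isBoundedDefault) fun b hb => ?_
    obtain ⟨n, hn⟩ := hb.exists
    refine hn.trans ((((hK (ns n)).hasPDeriv j).conv (hK (ns n)).cont ((hK (ns n)).cont_deriv j)
      hf).eLpNorm_increment_le (continuous_conv ((hK (ns n)).cont_deriv j) hf) hq s |>.trans ?_)
    gcongr
    rw [show conv (K' (ns n) j) f = conv (K (ns n)) (g j) from funext fun x =>
      h _ _ _ _ (hK (ns n)) j x]
    exact (hK (ns n)).eLpNorm_conv_le_self (hgm j) hq

/-- Move from x to x - y one coordinate at a time. -/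
theorem HasMollifiedGradient.eLpNorm_increment_le {f : Torus d → ℝ} {g : Fin d → Torus d → ℝ}
    (h : HasMollifiedGradient f g) (hfm : Measurable f) (hf : Integrable f)
    (hgm : ∀ j, Measurable (g j)) (hq : 1 ≤ q) (y : Vec d) :
    eLpNorm (fun x => f x - f (x - proj y)) (ENNReal.ofReal q) volume ≤
      ENNReal.ofReal ‖y‖ * ∑ j, eLpNorm (g j) (ENNReal.ofReal q) volume := by
  have key : ∀ S : Finset (Fin d), eLpNorm (fun x => f x - f (x - proj (∑ j ∈ S,
      EuclideanSpace.single j (y j) : Vec d))) (ENNReal.ofReal q) volume ≤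
      ∑ j ∈ S, ENNReal.ofReal |y j| * eLpNorm (g j) (ENNReal.ofReal q) volume := by
    intro S
    induction S using Finset.induction_on with
    | empty => simp [proj_zero]
    | insert j S hj ih =>
      rw [Finset.sum_insert hj, Finset.sum_insert hj, proj_add]
      exact (eLpNorm_increment_add_le hfm hq _ _).trans
        (add_le_add (h.eLpNorm_increment_single_le hfm hf hgm hq j (y j)) ih)
  have hy : ∑ j, (EuclideanSpace.single j (y j) : Vec d) = y := by
    ext i; simp [Pi.single_apply]
  have h1 := key Finset.univ
  rw [hy] at h1
  refine h1.trans ?_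
  rw [Finset.mul_sum]
  refine Finset.sum_le_sum fun j _ => ?_
  gcongr
  exact PiLp.norm_apply_le y j

/-- The loss ε^{-dθ} of Young's inequality against the gain ε of one derivative leaves ε^β. -/
theorem ofReal_div_pow_rpow_mul {C ε θ β : ℝ} (hC : 0 < C) (hε : 0 < ε) (hβ : d * θ = 1 - β) :
    ENNReal.ofReal (C / ε ^ d) ^ θ * ENNReal.ofReal ε =
      ENNReal.ofReal (C ^ θ) * ENNReal.ofReal (ε ^ β) := by
  rw [ENNReal.ofReal_rpow_of_pos (by positivity), ← ENNReal.ofReal_mul (by positivity),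
    ← ENNReal.ofReal_mul (by positivity), Real.div_rpow hC.le (by positivity), ← Real.rpow_natCast,
    ← Real.rpow_mul hε.le, hβ, Real.rpow_sub hε, Real.rpow_one]
  congr 1
  have := Real.rpow_pos_of_pos hε β
  field_simp

theorem increment_conv_eq {K f : Torus d → ℝ} (hK : Continuous K) (hf : Integrable f)
    (z x : Torus d) : conv K f x - conv K f (x - z) = conv K (fun x => f x - f (x - z)) x := by
  have hz : Integrable (fun x => f (x - z)) :=
    (measurePreserving_sub_right volume z).integrable_comp_of_integrable hf
  have e : conv K f (x - z) = conv K (fun x => f (x - z)) x := by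
    rw [conv_eq, conv_eq]
    simp only [sub_right_comm]
  rw [conv_sub hK hf hz x, e]

theorem eLpNorm_sub_le_sum {w : ℕ → Torus d → ℝ} (hr : 1 ≤ r) (hw : ∀ n, Measurable (w n)) (n : ℕ) :
    eLpNorm (fun x => w n x - w 0 x) (ENNReal.ofReal r) volume ≤
      ∑ k ∈ Finset.range n, eLpNorm (fun x => w (k + 1) x - w k x) (ENNReal.ofReal r) volume := by
  induction n with
  | zero => simp
  | succ n ih =>
    rw [Finset.sum_range_succ_comm]
    have h := eLpNorm_sub_triangle hr (hw (n + 1)) (hw n) (hw 0)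
    exact le_trans h (add_le_add le_rfl ih)

/-- Convolutions commute, so L * f - K * f = L * (f - K * f) - K * (f - L * f). Each bracket is O(ε)
in L^q, and the outer kernel carries it to L^r at a cost no worse than that of the finer scale η. -/
theorem IsMollifier.eLpNorm_conv_sub_conv_le {C ε η : ℝ} {K L : Torus d → ℝ}
    {K' L' : Fin d → Torus d → ℝ} (hK : IsMollifier C ε K K') (hL : IsMollifier C η L L')
    (hη : 0 < η) (hηε : η ≤ ε) (hC : 0 < C) {f : Torus d → ℝ} (hfm : Measurable f)
    (hf : Integrable f) {Λ : ℝ≥0∞} (hq : 1 ≤ q) (hqr : q ≤ r)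
    (hΛ : ∀ y : Vec d, eLpNorm (fun x => f x - f (x - proj y)) (ENNReal.ofReal q) volume ≤
      ENNReal.ofReal ‖y‖ * Λ) :
    eLpNorm (fun x => conv L f x - conv K f x) (ENNReal.ofReal r) volume ≤
      2 * (ENNReal.ofReal (C / η ^ d) ^ (1 / q - 1 / r) *
        (ENNReal.ofReal C ^ (1 / q) * (ENNReal.ofReal ε * Λ))) := by
  have hq0 : 0 < q := by linarith
  have hε : 0 < ε := by linarith
  have cK := continuous_conv hK.cont hf
  have cL := continuous_conv hL.cont hf
  have iK := integrable_of_continuous cK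
  have iL := integrable_of_continuous cL
  have hθ : 0 ≤ 1 / q - 1 / r := sub_nonneg.2 (one_div_le_one_div_of_le hq0 hqr)
  have e1 : ∀ x, conv L f x - conv L (conv K f) x = conv L (fun y => f y - conv K f y) x :=
    fun x => (conv_sub hL.cont hf iK x).symm
  have e2 : ∀ x, conv L (conv K f) x - conv K f x = -conv K (fun y => f y - conv L f y) x :=
    fun x => by rw [conv_sub hK.cont hf iL x, conv_conv_comm hL.cont hK.cont hf]; ring
  have b1 : eLpNorm (conv L fun y => f y - conv K f y) (ENNReal.ofReal r) volume ≤
      ENNReal.ofReal (C / η ^ d) ^ (1 / q - 1 / r) *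
        (ENNReal.ofReal C ^ (1 / q) * (ENNReal.ofReal ε * Λ)) := by
    refine (hL.eLpNorm_conv_le (hfm.sub cK.measurable) hq hqr).trans ?_
    gcongr
    refine hK.eLpNorm_sub_conv_le hfm hf hq fun y hy => (hΛ y).trans ?_
    rw [mem_ball_zero_iff] at hy
    gcongr
  have b2 : eLpNorm (conv K fun y => f y - conv L f y) (ENNReal.ofReal r) volume ≤
      ENNReal.ofReal (C / η ^ d) ^ (1 / q - 1 / r) *
        (ENNReal.ofReal C ^ (1 / q) * (ENNReal.ofReal ε * Λ)) := by
    refine (hK.eLpNorm_conv_le (hfm.sub cL.measurable) hq hqr).trans ?_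
    gcongr
    refine hL.eLpNorm_sub_conv_le hfm hf hq fun y hy => (hΛ y).trans ?_
    rw [mem_ball_zero_iff] at hy
    gcongr
    exact hy.le.trans hηε
  refine (eLpNorm_sub_triangle (hq.trans hqr) cL.measurable
    (continuous_conv hL.cont iK).measurable cK.measurable).trans ?_
  rw [two_mul]
  refine add_le_add ?_ ?_
  · simp only [e1]; exact b1
  · simp only [e2]
    refine le_of_eq_of_le ?_ b2
    exact eLpNorm_neg (conv K fun y => f y - conv L f y) _ _

/-- A function which is Lipschitz in `L^q` has increments of size `ε ^ β` in `L^r`, where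
`d (1/q - 1/r) = 1 - β`. -/
theorem exists_eLpNorm_increment_le {β : ℝ} (hβ : 0 < β) (hq : 1 ≤ q) (hqr : q ≤ r)
    (hdβ : d * (1 / q - 1 / r) = 1 - β) :
    ∃ A : ℝ≥0∞, A ≠ ⊤ ∧ ∀ (f : Torus d → ℝ) (Λ : ℝ≥0∞), Measurable f → Integrable f →
      (∀ y : Vec d, eLpNorm (fun x => f x - f (x - proj y)) (ENNReal.ofReal q) volume ≤
        ENNReal.ofReal ‖y‖ * Λ) → ∀ ε : ℝ, 0 < ε → ε ≤ 1 → ∀ y : Vec d, ‖y‖ ≤ ε →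
      eLpNorm (fun x => f x - f (x - proj y)) (ENNReal.ofReal r) volume ≤
        A * ENNReal.ofReal (ε ^ β) * Λ := by
  have hr : 1 ≤ r := hq.trans hqr
  obtain ⟨C, hC, hmol⟩ := exists_isMollifier_seq d
  set θ : ℝ := 1 / q - 1 / r with hθ
  -- Halving the scale multiplies ε^β by ρ = 2^{-β} < 1, so the dyadic telescoping sum is a
  -- convergent geometric series.
  set ρ : ℝ≥0∞ := ENNReal.ofReal ((1 / 2 : ℝ) ^ β) with hρ
  have hρ1 : ρ < 1 := by
    rw [hρ, ENNReal.ofReal_lt_one]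
    exact Real.rpow_lt_one (by norm_num) (by norm_num) hβ
  have hgeo : (1 - ρ)⁻¹ ≠ ⊤ := by
    rw [ne_eq, ENNReal.inv_eq_top, tsub_eq_zero_iff_le, not_le]; exact hρ1
  -- One factor 2 comes from the two terms in the difference of consecutive mollifications, the
  -- other from e n = 2 e (n + 1).
  set B : ℝ≥0∞ := 4 * (ENNReal.ofReal (C ^ θ) * ENNReal.ofReal C ^ (1 / q)) with hB
  have hBT : B ≠ ⊤ := by
    have : ENNReal.ofReal C ^ (1 / q) ≠ ⊤ := by finiteness
    finiteness
  refine ⟨2 * (B * (1 - ρ)⁻¹) + ENNReal.ofReal (C ^ θ), by finiteness,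
    fun f Λ hfm hf hΛ ε hε hε1 y hy => ?_⟩
  set e : ℕ → ℝ := fun n => ε * (1 / 2) ^ n with he
  have he0 : ∀ n, 0 < e n := fun n => by positivity
  have he1 : ∀ n, e n ≤ 1 := fun n =>
    mul_le_one₀ hε1 (by positivity) (pow_le_one₀ (by norm_num) (by norm_num))
  have helim : Tendsto e atTop (𝓝 0) := by
    have := (tendsto_pow_atTop_nhds_zero_of_lt_one (r := (1 / 2 : ℝ)) (by norm_num)
      (by norm_num)).const_mul ε
    rwa [mul_zero] at this
  have hes : ∀ n, e n = 2 * e (n + 1) := fun n => by simp only [he, pow_succ]; ring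
  have heβ : ∀ n, ENNReal.ofReal (e n ^ β) = ENNReal.ofReal (ε ^ β) * ρ ^ n := fun n => by
    rw [hρ, ← ENNReal.ofReal_pow (by positivity), ← ENNReal.ofReal_mul (by positivity), he,
      Real.mul_rpow hε.le (by positivity), ← Real.rpow_natCast, ← Real.rpow_natCast,
      ← Real.rpow_mul (by norm_num), ← Real.rpow_mul (by norm_num), mul_comm β]
  obtain ⟨K, K', hK⟩ := hmol e he0 he1
  have cw : ∀ n, Continuous (conv (K n) f) := fun n => continuous_conv (hK n).cont hf
  have hstep : ∀ n, eLpNorm (fun x => conv (K (n + 1)) f x - conv (K n) f x)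
      (ENNReal.ofReal r) volume ≤ B * ENNReal.ofReal (ε ^ β) * Λ * ρ ^ n := by
    intro n
    refine ((hK n).eLpNorm_conv_sub_conv_le (hK (n + 1)) (he0 _)
      (by linarith [hes n, he0 (n + 1)]) hC hfm hf hq hqr hΛ).trans ?_
    have h1 := ofReal_div_pow_rpow_mul (d := d) hC (he0 (n + 1)) hdβ
    rw [hes n, ENNReal.ofReal_mul zero_le_two, ENNReal.ofReal_ofNat]
    calc _ = 4 * ENNReal.ofReal C ^ (1 / q) * Λ *
          (ENNReal.ofReal (C / e (n + 1) ^ d) ^ θ * ENNReal.ofReal (e (n + 1))) := by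
          rw [← hθ]; ring
      _ = B * ENNReal.ofReal (ε ^ β) * Λ * ρ ^ (n + 1) := by rw [h1, heβ, hB]; ring
      _ ≤ _ := by
        exact mul_le_mul' le_rfl (pow_le_pow_of_le_one zero_le hρ1.le (Nat.le_succ n))
  have hw0 : ∀ n, eLpNorm (fun x => conv (K n) f x - conv (K 0) f x) (ENNReal.ofReal r) volume ≤
      B * ENNReal.ofReal (ε ^ β) * Λ * (1 - ρ)⁻¹ := by
    intro n
    refine (eLpNorm_sub_le_sum hr (fun n => (cw n).measurable) n).trans
      ((Finset.sum_le_sum fun k _ => hstep k).trans ?_)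
    rw [← Finset.mul_sum, ← ENNReal.tsum_geometric]
    gcongr
    exact ENNReal.sum_le_tsum _
  obtain ⟨ns, -, hns⟩ := exists_seq_tendsto_conv helim hK hfm hf
  -- Fatou's lemma transfers the bound on the partial sums to the limit f.
  have hf0 : eLpNorm (fun x => f x - conv (K 0) f x) (ENNReal.ofReal r) volume ≤
      B * ENNReal.ofReal (ε ^ β) * Λ * (1 - ρ)⁻¹ := by
    refine (Lp.eLpNorm_lim_le_liminf_eLpNorm
      (f := fun n x => conv (K (ns n)) f x - conv (K 0) f x)
      (fun n => ((cw (ns n)).sub (cw 0)).aestronglyMeasurable) _ ?_).trans ?_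
    · filter_upwards [hns] with x h1 using h1.sub_const _
    · refine liminf_le_of_le (by isBoundedDefault) fun b hb => ?_
      obtain ⟨n, hn⟩ := hb.exists
      exact hn.trans (hw0 _)
  set z := proj y with hz
  have cwz : Continuous fun x => conv (K 0) f (x - z) := (cw 0).comp (by fun_prop)
  have h2 : eLpNorm (fun x => conv (K 0) f x - conv (K 0) f (x - z)) (ENNReal.ofReal r) volume ≤
      ENNReal.ofReal (C ^ θ) * ENNReal.ofReal (ε ^ β) * Λ := by
    simp only [increment_conv_eq (hK 0).cont hf]
    refine ((hK 0).eLpNorm_conv_le (hfm.sub (measurable_comp_sub hfm z)) hq hqr).trans ?_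
    have e0 : e 0 = ε := by simp [he]
    rw [e0, ← ofReal_div_pow_rpow_mul hC hε hdβ, mul_assoc, ← hθ]
    gcongr
    exact (hΛ y).trans (by gcongr)
  have h3 : eLpNorm (fun x => conv (K 0) f (x - z) - f (x - z)) (ENNReal.ofReal r) volume ≤
      B * ENNReal.ofReal (ε ^ β) * Λ * (1 - ρ)⁻¹ := by
    rw [eLpNorm_comp_sub (f := fun x => conv (K 0) f x - f x) ((cw 0).measurable.sub hfm)]
    exact (eLpNorm_sub_comm (conv (K 0) f) f _ _).trans_le hf0
  -- Compare f with its mollification at scale ε at both x and x - y; the increment of the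
  -- mollification itself is controlled by Young's inequality.
  calc _ ≤ _ := eLpNorm_sub_triangle hr hfm (cw 0).measurable (measurable_comp_sub hfm z)
    _ ≤ eLpNorm (fun x => f x - conv (K 0) f x) (ENNReal.ofReal r) volume +
        (eLpNorm (fun x => conv (K 0) f x - conv (K 0) f (x - z)) (ENNReal.ofReal r) volume +
          eLpNorm (fun x => conv (K 0) f (x - z) - f (x - z)) (ENNReal.ofReal r) volume) := by
        gcongr
        exact eLpNorm_sub_triangle hr (cw 0).measurable cwz.measurable (measurable_comp_sub hfm z)
    _ ≤ B * ENNReal.ofReal (ε ^ β) * Λ * (1 - ρ)⁻¹ + (ENNReal.ofReal (C ^ θ) *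
        ENNReal.ofReal (ε ^ β) * Λ + B * ENNReal.ofReal (ε ^ β) * Λ * (1 - ρ)⁻¹) := by gcongr
    _ = _ := by ring

/-- The pair (f, g) minus its mollification is again such a pair, and its gradient part is small in
L^q. This is what upgrades O to o. -/
theorem HasMollifiedGradient.sub_conv {f : Torus d → ℝ} {g : Fin d → Torus d → ℝ}
    (h : HasMollifiedGradient f g) (hf : Integrable f) (hg : ∀ j, Integrable (g j))
    {C ε : ℝ} {L : Torus d → ℝ} {L' : Fin d → Torus d → ℝ} (hL : IsMollifier C ε L L') :
    HasMollifiedGradient (fun x => f x - conv L f x) (fun j x => g j x - conv L (g j) x) := by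
  intro C₁ ε₁ K K' hK j x
  rw [conv_sub (hK.cont_deriv j) hf (integrable_of_continuous (continuous_conv hL.cont hf)),
    conv_sub hK.cont (hg j) (integrable_of_continuous (continuous_conv hL.cont (hg j))),
    h _ _ _ _ hK, conv_conv_comm (hK.cont_deriv j) hL.cont hf, conv_conv_comm hK.cont hL.cont (hg j),
    show conv (K' j) f = conv K (g j) from funext fun x => h _ _ _ _ hK j x]

/-- Functions with gradient in `L^q` have increments of size `o(ε ^ β)` in `L^r`. -/
theorem HasMollifiedGradient.eventually_increment_le {f : Torus d → ℝ} {g : Fin d → Torus d → ℝ}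
    (h : HasMollifiedGradient f g) (hfm : Measurable f) (hf : Integrable f)
    (hgm : ∀ j, Measurable (g j)) {β : ℝ} (hβ : 0 < β) (hβ1 : β < 1) (hq : 1 ≤ q) (hqr : q ≤ r)
    (hg : ∀ j, MemLp (g j) (ENNReal.ofReal q) volume)
    (hdβ : d * (1 / q - 1 / r) = 1 - β) {δ : ℝ≥0∞} (hδ : 0 < δ) :
    ∀ᶠ ε in 𝓝[>] (0 : ℝ), ∀ y : Vec d, ‖y‖ ≤ ε →
      eLpNorm (fun x => f x - f (x - proj y)) (ENNReal.ofReal r) volume ≤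
        δ * ENNReal.ofReal (ε ^ β) := by
  have hr : 1 ≤ r := hq.trans hqr
  have hgi : ∀ j, Integrable (g j) := fun j => (hg j).integrable (by simpa using hq)
  obtain ⟨A, hA, hA'⟩ := exists_eLpNorm_increment_le (d := d) hβ hq hqr hdβ
  obtain ⟨C, hC, hmol⟩ := exists_isMollifier_seq d
  have hlim := tendsto_one_div_add_atTop_nhds_zero_nat (𝕜 := ℝ)
  obtain ⟨K, K', hK⟩ := hmol (fun n => 1 / ((n : ℝ) + 1)) (fun n => by positivity) fun n => by
    rw [div_le_one (by positivity)]; linarith [n.cast_nonneg (α := ℝ)]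
  have h1 : Tendsto (fun n => A * ∑ j, eLpNorm (fun x => g j x - conv (K n) (g j) x)
      (ENNReal.ofReal q) volume) atTop (𝓝 0) := by
    have h2 := ENNReal.Tendsto.const_mul (a := A) (tendsto_finsetSum Finset.univ fun j _ =>
      tendsto_eLpNorm_sub_conv hq hlim hK (hgm j) (hg j)) (Or.inr hA)
    simpa using h2
  have hδ2 : 0 < δ / 2 := ENNReal.half_pos hδ.ne'
  -- Fix one mollification scale for which the remainder has so small a gradient that its increments
  -- use only half of δ.
  obtain ⟨n, hn⟩ := ((ENNReal.tendsto_nhds_zero.1 h1) (δ / 2) hδ2).exists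
  set L := K n with hL
  set S : ℝ≥0∞ := ENNReal.ofReal (C / (1 / ((n : ℝ) + 1)) ^ d) ^ (1 / q - 1 / r) *
    ∑ j, eLpNorm (g j) (ENNReal.ofReal q) volume with hS
  have hST : S ≠ ⊤ := by
    have hθ : 0 ≤ 1 / q - 1 / r :=
      sub_nonneg.2 (one_div_le_one_div_of_le (by linarith) hqr)
    refine ENNReal.mul_ne_top (ENNReal.rpow_ne_top_of_nonneg hθ ENNReal.ofReal_ne_top) ?_
    exact ENNReal.sum_ne_top.2 fun j _ => (hg j).eLpNorm_ne_top
  -- The mollified part has L^r increments of size ε = ε^{1-β} · ε^β, and β < 1 makes the first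
  -- factor vanish.
  have h3 : Tendsto (fun ε : ℝ => S * ENNReal.ofReal (ε ^ (1 - β))) (𝓝[>] 0) (𝓝 0) := by
    have h4 : Tendsto (fun ε : ℝ => ε ^ (1 - β)) (𝓝[>] 0) (𝓝 0) := by
      have := (Real.continuousAt_rpow_const 0 (1 - β) (Or.inr (by linarith))).tendsto
      rw [Real.zero_rpow (by linarith)] at this
      exact this.mono_left nhdsWithin_le_nhds
    have h5 := ENNReal.Tendsto.const_mul (a := S) (ENNReal.tendsto_ofReal h4) (Or.inr hST)
    simpa using h5
  have hε1 : ∀ᶠ ε in 𝓝[>] (0 : ℝ), ε < 1 := nhdsWithin_le_nhds (gt_mem_nhds one_pos)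
  filter_upwards [(ENNReal.tendsto_nhds_zero.1 h3) (δ / 2) hδ2, self_mem_nhdsWithin, hε1]
    with ε hεS hε hε1 y hy
  have hε : 0 < ε := hε
  have cL := continuous_conv (hK n).cont hf
  have cLg : ∀ j, Continuous (conv L (g j)) := fun j => continuous_conv (hK n).cont (hgi j)
  set z := proj y with hz
  have b1 : eLpNorm (fun x => (f x - conv L f x) - (f (x - z) - conv L f (x - z)))
      (ENNReal.ofReal r) volume ≤ δ / 2 * ENNReal.ofReal (ε ^ β) := by
    have hsm : Measurable fun x => f x - conv L f x := hfm.sub cL.measurable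
    have hsi : Integrable fun x => f x - conv L f x := hf.sub (integrable_of_continuous cL)
    refine (hA' _ _ hsm hsi (fun y => (h.sub_conv hf hgi (hK n)).eLpNorm_increment_le hsm hsi
      (fun j => (hgm j).sub (cLg j).measurable) hq y) ε hε hε1.le y hy).trans ?_
    rw [mul_right_comm]
    gcongr
  have b2 : eLpNorm (fun x => conv L f x - conv L f (x - z)) (ENNReal.ofReal r) volume ≤
      δ / 2 * ENNReal.ofReal (ε ^ β) := by
    rw [show (fun x => conv L f x - conv L f (x - z)) = conv L (fun x => f x - f (x - z)) from
      funext fun x => increment_conv_eq (hK n).cont hf z x]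
    refine ((hK n).eLpNorm_conv_le (hfm.sub (measurable_comp_sub hfm z)) hq hqr).trans ?_
    calc _ ≤ ENNReal.ofReal (C / (1 / ((n : ℝ) + 1)) ^ d) ^ (1 / q - 1 / r) *
          (ENNReal.ofReal ε * ∑ j, eLpNorm (g j) (ENNReal.ofReal q) volume) := by
          gcongr
          exact (h.eLpNorm_increment_le hfm hf hgm hq y).trans (by gcongr)
      _ = S * ENNReal.ofReal (ε ^ (1 - β)) * ENNReal.ofReal (ε ^ β) := by
          rw [mul_assoc S, ← ENNReal.ofReal_mul (by positivity), ← Real.rpow_add hε, hS]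
          simp only [sub_add_cancel, Real.rpow_one]
          ring
      _ ≤ _ := by gcongr
  have mLz : Measurable fun x => conv L f (x - z) := measurable_comp_sub cL.measurable z
  have mfz := measurable_comp_sub hfm z
  have mL := cL.measurable
  have h6 := eLpNorm_add_le (μ := (volume : Measure (Torus d))) (p := ENNReal.ofReal r)
    (f := fun x => (f x - conv L f x) - (f (x - z) - conv L f (x - z)))
    (g := fun x => conv L f x - conv L f (x - z)) (by fun_prop) (by fun_prop) (by simpa using hr)
  calc eLpNorm (fun x => f x - f (x - z)) (ENNReal.ofReal r) volume ≤ _ :=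
        le_of_eq_of_le (by congr 1; ext x; simp only [Pi.add_apply]; ring) h6
    _ ≤ δ / 2 * ENNReal.ofReal (ε ^ β) + δ / 2 * ENNReal.ofReal (ε ^ β) := add_le_add b1 b2
    _ = _ := by rw [← add_mul, ENNReal.add_halves]

end Increments

/-! ### The gradient condition -/

section Gradient

variable {d : ℕ} {T p q r : ℝ}

theorem IsMollifier.isSmooth_comp_sub {C ε : ℝ} {K : Torus d → ℝ} {K' : Fin d → Torus d → ℝ}
    (hK : IsMollifier C ε K K') (x : Torus d) : IsSmooth fun y => K (x - y) := by
  have h := isSmoothSpaceTime_mul_comp_sub (χ := fun _ => 1) contDiff_const hK.smooth x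
  have h1 : ContDiff ℝ ∞ fun y : Vec d => ((0 : ℝ), y) := contDiff_const.prodMk contDiff_id
  have h2 := h.comp h1
  simpa [IsSmooth, Function.comp_def] using h2

/-- Test the weak gradient with y ↦ K(x - y); the minus signs from the reflection and from the
definition cancel. -/
theorem IsWeakGradient.hasMollifiedGradient {u : Torus d → Vec d}
    {g : Torus d → EuclideanSpace ℝ (Fin d × Fin d)} (h : IsWeakGradient u g) (i : Fin d) :
    HasMollifiedGradient (fun x => u x i) fun j x => g x (i, j) := by
  intro C ε K K' hK j x
  have h1 := h _ (hK.isSmooth_comp_sub x) i j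
  simp only [((hK.hasPDeriv j).comp_sub_left x).pderiv_eq, mul_neg, integral_neg, neg_inj] at h1
  simp only [conv, mul_comm (K' j _), mul_comm (K _), h1]

theorem HasMollifiedGradient.congr {f₁ f₂ : Torus d → ℝ} {g₁ g₂ : Fin d → Torus d → ℝ}
    (h : HasMollifiedGradient f₁ g₁) (hf : f₁ =ᵐ[volume] f₂) (hg : ∀ j, g₁ j =ᵐ[volume] g₂ j) :
    HasMollifiedGradient f₂ g₂ := by
  intro C ε K K' hK j x
  rw [← conv_congr hf, ← conv_congr (hg j), h _ _ _ _ hK j x]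

theorem eLpNorm_le_sum_apply {w : Torus d → Vec d} (hw : Measurable w) (hr : 1 ≤ r) :
    eLpNorm w (ENNReal.ofReal r) volume ≤
      ∑ i, eLpNorm (fun x => w x i) (ENNReal.ofReal r) volume := by
  have h1 : eLpNorm w (ENNReal.ofReal r) volume ≤
      eLpNorm (∑ i, fun x => ‖w x i‖) (ENNReal.ofReal r) volume := by
    refine eLpNorm_mono_real fun x => ?_
    have h2 : w x = ∑ i, EuclideanSpace.single i (w x i) := by
      ext k
      simp [Finset.sum_apply, Pi.single_apply]
    rw [Finset.sum_apply]
    calc ‖w x‖ = ‖∑ i, (EuclideanSpace.single i (w x i) : Vec d)‖ := by rw [← h2]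
      _ ≤ ∑ i, ‖(EuclideanSpace.single i (w x i) : Vec d)‖ := norm_sum_le _ _
      _ = _ := by simp
  refine h1.trans ((eLpNorm_sum_le (fun i _ => ?_) (by simpa using hr)).trans_eq ?_)
  · exact Measurable.aestronglyMeasurable (by fun_prop)
  · simp only [eLpNorm_norm]

theorem averaged_increments_le {u : Torus d → Vec d} (hu : Measurable u) (hp : 0 < p) (hr : 0 < r)
    {ε : ℝ} (hε : 0 < ε) {B : ℝ≥0∞} (hB : ∀ y : Vec d, ‖y‖ ≤ ε →
      eLpNorm (fun x => u x - u (x - proj y)) (ENNReal.ofReal r) volume ≤ B) :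
    (∫⁻ x, ∫⁻ y, ‖u x - u (x - proj y)‖ₑ ^ r ∂ballAvg d ε) ^ (p / r) ≤ B ^ p := by
  have hpm := measurable_proj (d := d)
  have hprob := isProbabilityMeasure_ballAvg (d := d) hε
  rw [lintegral_lintegral_swap (by fun_prop)]
  calc _ ≤ (∫⁻ _, B ^ r ∂ballAvg d ε) ^ (p / r) := by
        refine ENNReal.rpow_le_rpow (lintegral_mono_ae (ae_ballAvg_of_forall fun y hy => ?_))
          (by positivity)
        rw [← eLpNorm_ofReal_rpow hr (fun x => u x - u (x - proj y))]
        exact ENNReal.rpow_le_rpow (hB y (mem_ball_zero_iff.1 hy).le) hr.le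
    _ = B ^ p := by
        rw [lintegral_const, measure_univ, mul_one, ← ENNReal.rpow_mul, mul_div_cancel₀ _ hr.ne']

theorem averaged_increments_le_of_apply {u : Torus d → Vec d} (hu : Measurable u) (hp : 0 < p)
    (hr : 1 ≤ r) {ε : ℝ} (hε : 0 < ε) {B : ℝ≥0∞} (hB : ∀ (i : Fin d) (y : Vec d), ‖y‖ ≤ ε →
      eLpNorm (fun x => u x i - u (x - proj y) i) (ENNReal.ofReal r) volume ≤
        B * ENNReal.ofReal (ε ^ (1 / p))) :
    (∫⁻ x, ∫⁻ y, ‖u x - u (x - proj y)‖ₑ ^ r ∂ballAvg d ε) ^ (p / r) ≤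
      (d * B) ^ p * ENNReal.ofReal ε := by
  refine (averaged_increments_le hu hp (by linarith) hε (B := d * (B * ENNReal.ofReal (ε ^ (1 / p))))
    fun y hy => ?_).trans_eq ?_
  · refine (eLpNorm_le_sum_apply (by fun_prop) hr).trans
      ((Finset.sum_le_sum fun i _ => hB i y hy).trans_eq ?_)
    simp
  · rw [← mul_assoc, ENNReal.mul_rpow_of_nonneg _ _ hp.le, ENNReal.ofReal_rpow_of_nonneg
      (by positivity) hp.le, ← Real.rpow_mul hε.le, one_div_mul_cancel hp.ne', Real.rpow_one]

theorem eLpNorm_apply_le {ι : Type*} [Fintype ι] (G : Torus d → EuclideanSpace ℝ ι) (hq : 0 < q)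
    (k : ι) : eLpNorm (fun x => G x k) (ENNReal.ofReal q) volume ≤
      (∫⁻ x, ‖G x‖ₑ ^ q) ^ (1 / q) := by
  rw [← eLpNorm_ofReal_eq hq]
  exact eLpNorm_mono fun x => PiLp.norm_apply_le _ _

/-- This quantitative bound, uniform in ε ≤ 1, supplies the dominating function in time. -/
theorem exists_averaged_increments_le (hp : 0 < p) (hq : 1 ≤ q) (hqr : q ≤ r)
    (hdβ : d * (1 / q - 1 / r) = 1 - 1 / p) :
    ∃ A : ℝ≥0∞, A ≠ ⊤ ∧ ∀ (u : Torus d → Vec d) (G : Torus d → EuclideanSpace ℝ (Fin d × Fin d)),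
      Measurable u → (∀ i, Integrable fun x => u x i) → Measurable G →
      (∀ i, HasMollifiedGradient (fun x => u x i) fun j x => G x (i, j)) →
      ∀ ε : ℝ, 0 < ε → ε ≤ 1 →
        (∫⁻ x, ∫⁻ y, ‖u x - u (x - proj y)‖ₑ ^ r ∂ballAvg d ε) ^ (p / r) ≤
          A * (∫⁻ x, ‖G x‖ₑ ^ q) ^ (p / q) * ENNReal.ofReal ε := by
  obtain ⟨A, hA, hA'⟩ := exists_eLpNorm_increment_le (d := d) (one_div_pos.2 hp) hq hqr hdβ
  refine ⟨(d * (A * d)) ^ p, ENNReal.rpow_ne_top_of_nonneg hp.le (by finiteness), ?_⟩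
  intro u G hu hui hG h ε hε hε1
  set N : ℝ≥0∞ := (∫⁻ x, ‖G x‖ₑ ^ q) ^ (1 / q) with hN
  refine (averaged_increments_le_of_apply hu hp (hq.trans hqr) hε (B := A * (d * N))
    fun i y hy => ?_).trans_eq ?_
  · refine (hA' _ (d * N) (by fun_prop) (hui i) (fun z => ((h i).eLpNorm_increment_le (by fun_prop)
      (hui i) (fun j => by fun_prop) hq z).trans ?_) ε hε hε1 y hy).trans_eq (by ring)
    gcongr
    refine (Finset.sum_le_sum fun j _ => eLpNorm_apply_le G (by linarith) (i, j)).trans_eq ?_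
    simp [hN]
  · rw [← mul_assoc A, ← mul_assoc (d : ℝ≥0∞), ENNReal.mul_rpow_of_nonneg _ _ hp.le, hN,
      ← ENNReal.rpow_mul, one_div_mul_eq_div]

/-- The qualitative counterpart at a single time: it supplies the pointwise limit for dominated
convergence. -/
theorem tendsto_averaged_increments {u : Torus d → Vec d}
    {G : Torus d → EuclideanSpace ℝ (Fin d × Fin d)} (hu : Measurable u)
    (hui : ∀ i, Integrable fun x => u x i) (hG : Measurable G)
    (hGq : ∫⁻ x, ‖G x‖ₑ ^ q ≠ ⊤)
    (h : ∀ i, HasMollifiedGradient (fun x => u x i) fun j x => G x (i, j)) (hp : 1 < p) (hq : 1 ≤ q)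
    (hqr : q ≤ r) (hdβ : d * (1 / q - 1 / r) = 1 - 1 / p) :
    Tendsto (fun ε : ℝ => (∫⁻ x, ∫⁻ y, ‖u x - u (x - proj y)‖ₑ ^ r ∂ballAvg d ε) ^ (p / r) /
      ENNReal.ofReal ε) (𝓝[>] 0) (𝓝 0) := by
  have hp0 : 0 < p := by linarith
  have hq0 : 0 < q := by linarith
  rw [ENNReal.tendsto_nhds_zero]
  intro η hη
  -- Summing over the d components costs a factor d; dividing by d + 1 absorbs it and is harmless
  -- also for d = 0.
  set δ : ℝ≥0∞ := η ^ (1 / p) / (d + 1) with hδ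
  have hδ0 : 0 < δ := ENNReal.div_pos
    (ENNReal.rpow_pos_of_nonneg hη (by positivity)).ne' (by finiteness)
  have hδη : (d * δ) ^ p ≤ η := by
    calc (d * δ) ^ p ≤ (η ^ (1 / p)) ^ p := by
          gcongr
          calc d * δ ≤ (d + 1) * δ := by gcongr; exact le_self_add
            _ ≤ _ := ENNReal.mul_div_le
      _ = η := by rw [← ENNReal.rpow_mul, one_div_mul_cancel hp0.ne', ENNReal.rpow_one]
  have hGm : ∀ i j, MemLp (fun x => G x (i, j)) (ENNReal.ofReal q) volume := fun i j =>
    ⟨Measurable.aestronglyMeasurable (by fun_prop), (eLpNorm_apply_le G hq0 (i, j)).trans_lt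
      (ENNReal.rpow_lt_top_of_nonneg (by positivity) hGq)⟩
  filter_upwards [eventually_all.2 fun i => (h i).eventually_increment_le (by fun_prop) (hui i)
    (fun j => by fun_prop) (one_div_pos.2 hp0) (by rw [div_lt_one hp0]; exact hp) hq hqr (hGm i)
    hdβ hδ0, self_mem_nhdsWithin] with ε hε hε0
  have hε0 : 0 < ε := hε0
  rw [ENNReal.div_le_iff (ENNReal.ofReal_pos.2 hε0).ne' ENNReal.ofReal_ne_top]
  refine (averaged_increments_le_of_apply hu hp0 (hq.trans hqr) hε0 hε).trans ?_
  gcongr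

variable {v : ℝ → Torus d → Vec d} {Pr : ℝ → Torus d → ℝ}

theorem IsWeakSolution.energy_eq_of_gradMemLpLq (hT : 0 < T) (hv : IsWeakSolution T v Pr)
    (hp1 : 1 < p) (hp3 : p ≤ 3) (hq : 1 ≤ q) (hqr : q ≤ 2 * p / (p - 1))
    (hdβ : d * (1 / q - 1 / (2 * p / (p - 1))) = 1 - 1 / p) (h : GradMemLpLq T p q v) {t : ℝ}
    (ht : t ∈ Icc 0 T) : ∫ x, ‖v t x‖ ^ 2 = ∫ x, ‖v 0 x‖ ^ 2 := by
  have hp0 : 0 < p := by linarith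
  have hq0 : 0 < q := by linarith
  have hpos : ∀ n : ℕ, (0 : ℝ) < 1 / ((n : ℝ) + 1) := fun n => by positivity
  have hle : ∀ n : ℕ, 1 / ((n : ℝ) + 1) ≤ 1 := fun n => by
    rw [div_le_one (by positivity)]; linarith [n.cast_nonneg (α := ℝ)]
  have hlim := tendsto_one_div_add_atTop_nhds_zero_nat (𝕜 := ℝ)
  refine hv.energy_eq_of_averaged_increments hT hp1 hp3 (ε := fun n => 1 / ((n : ℝ) + 1)) hpos
    hle hlim ?_ ht
  set r : ℝ := 2 * p / (p - 1) with hr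
  have hr0 : 0 < r := by linarith
  obtain ⟨V, hVm, hV, -, -, -⟩ := hv.exists_representative
  obtain ⟨g, ⟨⟨G, hGm, hgG⟩, hgp⟩, hg⟩ := h
  replace hGm := hGm.measurable
  have hG : ∀ᵐ s ∂volume.restrict (Ioo 0 T), g s =ᵐ[volume] fun x => G (s, x) :=
    Measure.ae_ae_of_ae_prod hgG
  have hpm := measurable_proj (d := d)
  have hGfin : ∫⁻ s in Ioo 0 T, (∫⁻ x, ‖G (s, x)‖ₑ ^ q) ^ (p / q) ≠ ⊤ := by
    have h1 := ENNReal.rpow_ne_top_of_nonneg hp0.le hgp.ne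
    rw [mixedNorm_rpow hp0] at h1
    refine ne_of_eq_of_ne (lintegral_congr_ae ?_) h1
    filter_upwards [hG] with s hs
    congr 1
    refine lintegral_congr_ae ?_
    filter_upwards [hs] with x hx
    rw [hx]
  have hGmeas : Measurable fun s => (∫⁻ x, ‖G (s, x)‖ₑ ^ q) ^ (p / q) :=
    (Measurable.lintegral_prod_right' (f := fun z => ‖G z‖ₑ ^ q) (by fun_prop)).pow_const _
  have hGs : ∀ᵐ s ∂volume.restrict (Ioo 0 T), ∫⁻ x, ‖G (s, x)‖ₑ ^ q ≠ ⊤ := by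
    filter_upwards [ae_lt_top hGmeas hGfin] with s hs htop
    rw [htop, ENNReal.top_rpow_of_pos (by positivity)] at hs
    exact lt_irrefl _ hs
  have hVi : ∀ᵐ s ∂volume.restrict (Ioo 0 T), ∀ i, Integrable fun x => V (s, x) i := by
    filter_upwards [hV, ae_restrict_mem measurableSet_Ioo] with s hs hsT i
    refine (EulerTorus.integrable_apply (hv.memLp_two s (Ioo_subset_Icc_self hsT)) i).congr ?_
    filter_upwards [hs] with x hx
    rw [hx]
  have hgrad : ∀ᵐ s ∂volume.restrict (Ioo 0 T), ∀ i,
      HasMollifiedGradient (fun x => V (s, x) i) fun j x => G (s, x) (i, j) := by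
    filter_upwards [hV, hG, hg] with s hs hGs hgs i
    refine (hgs.hasMollifiedGradient i).congr ?_ fun j => ?_
    · filter_upwards [hs] with x hx
      rw [hx]
    · filter_upwards [hGs] with x hx
      rw [hx]
  obtain ⟨A, hA, hA'⟩ := exists_averaged_increments_le (d := d) hp0 hq hqr hdβ
  have hε0 : ∀ n : ℕ, ENNReal.ofReal (1 / ((n : ℝ) + 1)) ≠ 0 := fun n =>
    (ENNReal.ofReal_pos.2 (hpos n)).ne'
  have hmeas : ∀ n : ℕ, Measurable fun s => (∫⁻ x, ∫⁻ y, ‖V (s, x) - V (s, x - proj y)‖ₑ ^ r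
      ∂ballAvg d (1 / ((n : ℝ) + 1))) ^ (p / r) := by
    intro n
    have hprob := isProbabilityMeasure_ballAvg (d := d) (hpos n)
    refine Measurable.pow_const (Measurable.lintegral_prod_right' (f := fun z : ℝ × Torus d =>
      ∫⁻ y, ‖V z - V (z.1, z.2 - proj y)‖ₑ ^ r ∂ballAvg d (1 / ((n : ℝ) + 1))) ?_) _
    exact Measurable.lintegral_prod_right' (f := fun z : (ℝ × Torus d) × Vec d =>
      ‖V z.1 - V (z.1.1, z.1.2 - proj z.2)‖ₑ ^ r) (by fun_prop)
  have hdct : Tendsto (fun n : ℕ => ∫⁻ s in Ioo 0 T, (∫⁻ x, ∫⁻ y,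
      ‖V (s, x) - V (s, x - proj y)‖ₑ ^ r ∂ballAvg d (1 / ((n : ℝ) + 1))) ^ (p / r) /
        ENNReal.ofReal (1 / ((n : ℝ) + 1))) atTop (𝓝 (∫⁻ _ in Ioo 0 T, 0)) := by
    -- The dominating function is, up to a constant, the p-th power of the spatial L^q norm of the
    -- gradient, integrable in time by hypothesis.
    refine tendsto_lintegral_of_dominated_convergence
      (fun s => A * (∫⁻ x, ‖G (s, x)‖ₑ ^ q) ^ (p / q)) (fun n => (hmeas n).div_const _)
      (fun n => ?_) ?_ ?_
    · filter_upwards [hVi, hgrad] with s hsi hsg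
      rw [ENNReal.div_le_iff (hε0 n) ENNReal.ofReal_ne_top]
      exact hA' (fun x => V (s, x)) (fun x => G (s, x)) (by fun_prop) hsi (by fun_prop) hsg _
        (hpos n) (hle n)
    · rw [lintegral_const_mul _ hGmeas]
      exact ENNReal.mul_ne_top hA hGfin
    · filter_upwards [hVi, hgrad, hGs] with s hsi hsg hsG
      exact (tendsto_averaged_increments (u := fun x => V (s, x)) (G := fun x => G (s, x))
        (by fun_prop) hsi (by fun_prop) hsG hsg hp1 hq hqr hdβ).comp
          (tendsto_nhdsWithin_iff.2 ⟨hlim, Eventually.of_forall hpos⟩)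
  rw [lintegral_zero] at hdct
  refine hdct.congr fun n => ?_
  have hprob := isProbabilityMeasure_ballAvg (d := d) (hpos n)
  simp only [div_eq_mul_inv _ (ENNReal.ofReal _)]
  rw [lintegral_mul_const _ (hmeas n)]
  congr 1
  refine lintegral_congr_ae ?_
  filter_upwards [hV] with s hs
  rw [lintegral_increment_congr hs]

end Gradient

end EulerTorus

theorem theorem1p2 (d : ℕ) (hd : d = 2 ∨ d = 3) (T : ℝ) (hT : 0 < T)
    (v : ℝ → EulerTorus.Torus d → EulerTorus.Vec d) (Pr : ℝ → EulerTorus.Torus d → ℝ)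
    (hv : EulerTorus.IsWeakSolution T v Pr) (p : ℝ) (hp1 : 1 < p) (hp3 : p ≤ 3)
    (h : EulerTorus.MemLpBesovC T p (1 / p) (2 * p / (p - 1)) v ∨
      EulerTorus.MemLpBesovVMO T p (1 / p) (2 * p / (p - 1)) v ∨
      EulerTorus.GradMemLpLq T p (2 * d * p / ((d + 2) * (p - 1))) v) :
    ∀ t ∈ Icc (0 : ℝ) T,
      (1 / 2 : ℝ) * ∫ x, ‖v t x‖ ^ 2 = (1 / 2 : ℝ) * ∫ x, ‖v 0 x‖ ^ 2 := by
  intro t ht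
  congr 1
  rcases h with h | h | h
  · exact hv.energy_eq_of_memLpBesovC hT hp1 hp3 h ht
  · exact hv.energy_eq_of_memLpBesovVMO hT hp1 hp3 h ht
  · have hp : 0 < p - 1 := by linarith
    have hd2 : (2 : ℝ) ≤ d := by exact_mod_cast (by omega : 2 ≤ d)
    -- The condition q ≥ 1 uses 2d ≥ d + 2, that is d ≥ 2; q ≤ r follows from d ≤ d + 2; and 1/q -
    -- 1/r = (p-1)/(dp) gives the scaling identity.
    refine hv.energy_eq_of_gradMemLpLq hT hp1 hp3 ?_ ?_ ?_ h ht
    · rw [le_div_iff₀ (by positivity)]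
      nlinarith
    · rw [div_le_div_iff₀ (by positivity) hp]
      nlinarith [mul_pos hp (by linarith : 0 < p)]
    · field_simp
      ring
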